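/- An instance of \textsc{Bend-Restricted RAC Drawing} consists of a nonempty finite simple graph $G=(V,E)$, an integer $b\ge 0$ and a labelling $\beta:E\to\{0,1,2,3\}$. A \emph{polyline drawing} of $G$ maps the vertices injectively to points of the Euclidean plane and each edge $uv$ to a simple polyline joining the points of $u$ and $v$ that does not pass through the point of any other vertex; a polyline is a finite sequence of non-degenerate closed segments in which consecutive segments meet exactly in a common end point (a \emph{bend}), at an angle different from $180^\circ$, and all other pairs of segments are disjoint. The drawing is a \emph{$b$-bend $\beta$-restricted RAC drawing} if it has at most $b$ bends in total, every edge $e$ has at most $\beta(e)$ bends, and every common point of the interiors of two distinct edges lies in the relative interiors of a segment of the one and a segment of the other that are orthogonal to each other. $(G,b,\beta)$ is a yes-instance if $G$ has such a drawing. The \emph{neighborhood diversity} $\mathbf{nd}(G)$ is the minimum number of parts of a partition of $V$ such that $N(x)\setminus\{y\}=N(y)\setminus\{x\}$ for all $x,y$ in the same part. The size of an instance is the length of its encoding, which consists of $b$ in binary and the edge-labelled adjacency matrix of $G$ over a finite alphabet. \textbf{Theorem 17.} \textsc{Bend-Restricted RAC Drawing}, parameterized by $b+\mathbf{nd}(G)$,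 admits a kernel of size $\mathcal{O}\big((b+1)^2\cdot\mathbf{nd}(G)\cdot 2^{\mathbf{nd}(G)}\big)$. That is, there are a constant $C$ and a polynomial-time algorithm that maps every instance $(G,b,\beta)$ to an instance $(G',b',\beta')$ such that $(G,b,\beta)$ is a yes-instance if and only if $(G',b',\beta')$ is, and such that both the size of $(G',b',\beta')$ and its parameter $b'+\mathbf{nd}(G')$ are at most $C\cdot(b+1)^2\cdot\mathbf{nd}(G)\cdot 2^{\mathbf{nd}(G)}$. -/

import Mathlib

/-! ## Polyline drawings and right-angle crossings -/

/-- The Euclidean plane. -/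
abbrev Plane : Type := EuclideanSpace ℝ (Fin 2)

/-- The `i`-th closed segment of the polyline with corners `c 0, c 1, c 2, …`. -/
def polySegment (c : ℕ → Plane) (i : ℕ) : Set Plane := segment ℝ (c i) (c (i + 1))

/-- The polyline with corners `c 0, …, c (m + 1)`: it has `m` bends `c 1, …, c m` and consists of
the `m + 1` segments with indices `0, …, m`. -/
def polyline (c : ℕ → Plane) (m : ℕ) : Set Plane := {p | ∃ i ≤ m, p ∈ polySegment c i}

/-- The polyline with corners `c 0, …, c (m + 1)` without its two end points. -/
def polylineInt (c : ℕ → Plane) (m : ℕ) : Set Plane := polyline c m \ {c 0, c (m + 1)}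

/-- A polyline drawing of a graph: vertices are distinct points, every edge is a simple polyline
joining its end points, and no edge passes through a vertex that is not one of its end points. -/
structure PolylineDrawing {V : Type} (G : SimpleGraph V) where
  /-- the position of each vertex -/
  pos : V → Plane
  /-- the number of bends of each edge -/
  bends : G.edgeSet → ℕ
  /-- the corners of the polyline of an edge `e`: its end points are the corners `0` and
  `bends e + 1`, its bends are the corners in between, larger indices play no role -/
  corner : G.edgeSet → ℕ → Plane
  /-- distinct vertices are distinct points -/
  pos_injective : Function.Injective pos
  /-- the polyline of an edge (in one of its two orientations) joins its two end points -/
  joins : ∀ e : G.edgeSet, ∃ u v : V, (e : Sym2 V) = s(u, v) ∧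
    corner e 0 = pos u ∧ corner e (bends e + 1) = pos v
  /-- segments do not degenerate to points -/
  nondegenerate : ∀ (e : G.edgeSet) (i : ℕ), i ≤ bends e → corner e i ≠ corner e (i + 1)
  /-- consecutive segments share precisely the bend between them -/
  consecutive : ∀ (e : G.edgeSet) (i : ℕ), i < bends e →
    polySegment (corner e) i ∩ polySegment (corner e) (i + 1) = {corner e (i + 1)}
  /-- the angle at a bend is not `180°` -/
  angle_ne : ∀ (e : G.edgeSet) (i : ℕ), i < bends e →
    EuclideanGeometry.angle (corner e i) (corner e (i + 1)) (corner e (i + 2)) ≠ Real.pi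
  /-- every other pair of segments of an edge is disjoint -/
  disjoint : ∀ (e : G.edgeSet) (i j : ℕ), i + 1 < j → j ≤ bends e →
    Disjoint (polySegment (corner e) i) (polySegment (corner e) j)
  /-- an edge does not pass through a vertex that is not incident to it -/
  avoids : ∀ (e : G.edgeSet) (v : V), v ∉ (e : Sym2 V) →
    pos v ∉ polylineInt (corner e) (bends e)

/-- All crossings are right-angle crossings: every common point of the interiors of two distinct
edges lies in the relative interiors of a segment of the one and a segment of the other edge that
are orthogonal to each other. (So there are finitely many crossings: two orthogonal segments have
at most one common point.) -/
def PolylineDrawing.IsRAC {V : Type} {G : SimpleGraph V} (D : PolylineDrawing G) : Prop :=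
  ∀ e f : G.edgeSet, e ≠ f →
    ∀ p ∈ polylineInt (D.corner e) (D.bends e) ∩ polylineInt (D.corner f) (D.bends f),
      ∃ i ≤ D.bends e, ∃ j ≤ D.bends f,
        p ∈ openSegment ℝ (D.corner e i) (D.corner e (i + 1)) ∧
        p ∈ openSegment ℝ (D.corner f j) (D.corner f (j + 1)) ∧
        inner ℝ (D.corner e (i + 1) - D.corner e i) (D.corner f (j + 1) - D.corner f j) = 0

open Classical in
/-- `G` admits a `b`-bend `β`-restricted RAC drawing. -/
def AdmitsRACDrawing {V : Type} [Fintype V] (G : SimpleGraph V) (b : ℕ)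
    (β : G.edgeSet → Fin 4) : Prop :=
  ∃ D : PolylineDrawing G, D.IsRAC ∧ ∑ e : G.edgeSet, D.bends e ≤ b ∧
    ∀ e : G.edgeSet, D.bends e ≤ (β e : ℕ)

/-! ## Neighborhood diversity -/

/-- The neighborhood diversity of a finite graph: the minimum number of parts of a partition of the
vertices (given as an equivalence relation) such that `N(a) \ {b} = N(b) \ {a}` for all `a`, `b` in
a common part. -/
noncomputable def neighborhoodDiversity {V : Type} (G : SimpleGraph V) : ℕ :=
  sInf {k : ℕ | ∃ r : Setoid V, Nat.card (Quotient r) = k ∧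
    ∀ a b : V, r a b → G.neighborSet a \ {b} = G.neighborSet b \ {a}}

/-! ## The problem -/

/-- An instance of Bend-Restricted RAC Drawing: a (nonempty, finite, simple) graph, a bound on the
total number of bends, and for each edge a bound in `{0, 1, 2, 3}` on its number of bends. -/
structure BRACInstance where
  /-- the number of vertices -/
  order : ℕ
  /-- there is at least one vertex -/
  order_pos : 0 < order
  /-- the graph -/
  graph : SimpleGraph (Fin order)
  /-- the bound on the total number of bends -/
  budget : ℕ
  /-- the bound on the number of bends of each edge -/
  label : graph.edgeSet → Fin 4

namespace BRACInstance

/-- Yes-instances. -/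
def IsYes (I : BRACInstance) : Prop := AdmitsRACDrawing I.graph I.budget I.label

/-- The neighborhood diversity of the graph of an instance. -/
noncomputable def nd (I : BRACInstance) : ℕ := neighborhoodDiversity I.graph

/-- The parameter `b + nd(G)`. -/
noncomputable def parameter (I : BRACInstance) : ℕ := I.budget + I.nd

/-- The alphabet in which instances are written: binary digits, the entries of a matrix, and a
separator. -/
inductive Symbol
  | bit (d : Bool)
  | entry (c : Option (Fin 4))
  | sep

open Classical in
/-- The entry of the edge-labelled adjacency matrix in row `i` and column `j`: `none` for
non-adjacent vertices, the label of the edge for adjacent ones. -/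
noncomputable def matrixEntry (I : BRACInstance) (i j : Fin I.order) : Option (Fin 4) :=
  if h : I.graph.Adj i j then some (I.label ⟨s(i, j), h⟩) else none

/-- An instance is written as its bend bound in binary, a separator, and the rows of the
edge-labelled adjacency matrix of its graph, each followed by a separator. -/
noncomputable def encode (I : BRACInstance) : List Symbol :=
  (Computability.encodeNat I.budget).map Symbol.bit ++ Symbol.sep ::
    (List.ofFn fun i : Fin I.order =>
      (List.ofFn fun j : Fin I.order => Symbol.entry (I.matrixEntry i j)) ++ [Symbol.sep]).flatten

/-- The size of an instance is the length of its encoding; it is at least the square of the number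
of vertices. -/
noncomputable def size (I : BRACInstance) : ℕ := I.encode.length

end BRACInstance

/-! Call two vertices twins if they have the same neighbors apart from each other. This is an
equivalence relation with c ≤ nd(G) classes. From each class the kernel keeps about c(b+1) vertices,
up to a constant factor, together with all edges and labels among the kept vertices, and leaves b
unchanged. Being an induced subinstance, it inherits every drawing of G.

For the converse, take a drawing of the kernel with at most b bends. Three vertices have at most b +
54 common neighbors (`card_common_le`). Hence a class with more than b + 57 kept vertices is
independent, its vertices have at most two neighbors, and these lie in classes with at most two kept
vertices. The kept vertices of small classes therefore form a vertex cover X with at most c(b + 57)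
elements. Since crossings are orthogonal, the straight edges at one vertex u cross those at another
vertex x on at most two edges of u (`card_fan_le`), and a single segment crosses at most one
straight edge at u (`card_foot_le`). So at most 5b + 6|X| vertices of a large class have a bent or a
crossed edge (`exists_clean`). Classes that lost vertices are larger than that and contain a vertex
w all of whose edges are straight and uncrossed. All deleted twins of w can be placed very close to
w, with straight uncrossed edges (`exists_insert`). The new edges have no bends, so neither b nor
the labels matter for them; this is why twins are defined without regard to labels.

The kernel has O(nd² (b+1)) vertices, hence a matrix of size O(nd⁴ (b+1)²), and nd³ ≤ 8 · 2^nd gives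
the bound (`kernel_bounds`).

For the running time, a small structured language is compiled to stack machines, and the
kernelization is written in it. It ranks each vertex by the number of its later twins and keeps
those of small rank. Since b is given in binary and may be exponentially large, ranks are halved
repeatedly instead of being compared with a multiple of b. -/

/-! ## A structured language for stack machines -/

namespace StackProgram

/-- Programs that act on stacks indexed by `K` with symbols in `A`. -/
inductive Cmd (K A : Type) : Type
  | skip : Cmd K A
  | push (k : K) (a : A) : Cmd K A
  | seq (c d : Cmd K A) : Cmd K A
  /-- pop a symbol and branch on the result -/
  | case (k : K) (f : Option A → Cmd K A) : Cmd K A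
  /-- pop symbols and process them until the stack is empty or a end marker has been popped -/
  | loop (k : K) (fin : A → Bool) (f : A → Cmd K A) : Cmd K A

variable {K A : Type}

/-- `Exec c s s' t`: the program `c` transforms the stacks `s` into `s'` in `t` steps. -/
inductive Exec [DecidableEq K] : Cmd K A → (K → List A) → (K → List A) → ℕ → Prop
  | skip (s) : Exec .skip s s 1
  | push (k a s) : Exec (.push k a) s (Function.update s k (a :: s k)) 1
  | seq {c d s s₁ s₂ t₁ t₂} : Exec c s s₁ t₁ → Exec d s₁ s₂ t₂ → Exec (.seq c d) s s₂ (t₁ + t₂)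
  | case {k f s s₁ t} : Exec (f (s k).head?) (Function.update s k (s k).tail) s₁ t →
      Exec (.case k f) s s₁ (1 + t)
  | loop_nil {k fin f s} : s k = [] → Exec (.loop k fin f) s s 1
  | loop_exit {k fin f s a l} : s k = a :: l → fin a = true →
      Exec (.loop k fin f) s (Function.update s k l) 1
  | loop_cons {k fin f s a l s₁ s₂ t₁ t₂} : s k = a :: l → fin a = false →
      Exec (f a) (Function.update s k l) s₁ t₁ → Exec (.loop k fin f) s₁ s₂ t₂ →
      Exec (.loop k fin f) s s₂ (1 + t₁ + t₂)

/-- The control states of the machine that runs a program. -/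
def Lab : Cmd K A → Type
  | .skip => Unit
  | .push _ _ => Unit
  | .seq c d => Lab c ⊕ Lab d
  | .case _ f => Unit ⊕ (Σ o : Option A, Lab (f o))
  | .loop _ _ f => Unit ⊕ (Σ a : A, Lab (f a))

/-- The control state in which a program starts. -/
def entry : (c : Cmd K A) → Lab c
  | .skip => ()
  | .push _ _ => ()
  | .seq c _ => Sum.inl (entry c)
  | .case _ _ => Sum.inl ()
  | .loop _ _ _ => Sum.inl ()

/-- The control states of a program are finite in number. -/
@[reducible]
noncomputable def labFintype [Fintype A] : (c : Cmd K A) → Fintype (Lab c)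
  | .skip => inferInstanceAs (Fintype Unit)
  | .push _ _ => inferInstanceAs (Fintype Unit)
  | .seq c d =>
    letI := labFintype c
    letI := labFintype d
    inferInstanceAs (Fintype (Lab c ⊕ Lab d))
  | .case _ f =>
    letI := fun o => labFintype (f o)
    inferInstanceAs (Fintype (Unit ⊕ (Σ o : Option A, Lab (f o))))
  | .loop _ _ f =>
    letI := fun a => labFintype (f a)
    inferInstanceAs (Fintype (Unit ⊕ (Σ a : A, Lab (f a))))

/-- The statements of the machine that runs a program, inside a larger machine with labels `Λ`:
`emb` embeds the labels, and `exit` is the label at which the larger machine continues. -/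
def code {Λ : Type} : (c : Cmd K A) → (Lab c → Λ) → Λ → Lab c →
    Turing.TM2.Stmt (fun _ : K => A) Λ (Option A)
  | .skip, _, exit => fun _ => .goto fun _ => exit
  | .push k a, _, exit => fun _ => .push k (fun _ => a) (.goto fun _ => exit)
  | .seq c d, emb, exit => fun l => match l with
    | Sum.inl l => code c (fun l => emb (Sum.inl l)) (emb (Sum.inr (entry d))) l
    | Sum.inr l => code d (fun l => emb (Sum.inr l)) exit l
  | .case k f, emb, exit => fun l => match l with
    | Sum.inl _ => .pop k (fun _ o => o) (.goto fun o => emb (Sum.inr ⟨o, entry (f o)⟩))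
    | Sum.inr ⟨o, l⟩ => code (f o) (fun l => emb (Sum.inr ⟨o, l⟩)) exit l
  | .loop k fin f, emb, exit => fun l => match l with
    | Sum.inl _ => .pop k (fun _ o => o) (.goto fun o => match o with
      | none => exit
      | some a => if fin a then exit else emb (Sum.inr ⟨a, entry (f a)⟩))
    | Sum.inr ⟨a, l⟩ => code (f a) (fun l => emb (Sum.inr ⟨a, l⟩)) (emb (Sum.inl ())) l

/-- Iterating the step function of a machine. -/
def stepsTo [DecidableEq K] {Λ : Type} (M : Λ → Turing.TM2.Stmt (fun _ : K => A) Λ (Option A))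
    (n : ℕ) (x y : Turing.TM2.Cfg (fun _ : K => A) Λ (Option A)) : Prop :=
  (flip bind (Turing.TM2.step M))^[n] (some x) = some y

theorem stepsTo.trans [DecidableEq K] {Λ : Type}
    {M : Λ → Turing.TM2.Stmt (fun _ : K => A) Λ (Option A)} {m n : ℕ}
    {x y z : Turing.TM2.Cfg (fun _ : K => A) Λ (Option A)}
    (h : stepsTo M m x y) (h' : stepsTo M n y z) : stepsTo M (m + n) x z := by
  unfold stepsTo at *
  rw [add_comm, Function.iterate_add_apply, h, h']

theorem stepsTo_one [DecidableEq K] {Λ : Type}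
    {M : Λ → Turing.TM2.Stmt (fun _ : K => A) Λ (Option A)}
    {x y : Turing.TM2.Cfg (fun _ : K => A) Λ (Option A)}
    (h : Turing.TM2.step M x = some y) : stepsTo M 1 x y := h

/-- Induction on the execution. The statement is quantified over the embedding of labels and over
the exit label, so that the induction hypotheses apply to subprograms sitting inside the compiled
code, in particular to a loop body whose exit is the loop head. -/
theorem Exec.stepsTo [DecidableEq K] {Λ : Type}
    {M : Λ → Turing.TM2.Stmt (fun _ : K => A) Λ (Option A)} {c : Cmd K A} {s s' : K → List A}
    {t : ℕ} (h : Exec c s s' t) : ∀ (emb : Lab c → Λ) (exit : Λ),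
    (∀ l, M (emb l) = code c emb exit l) → ∀ v : Option A, ∃ v' : Option A,
      StackProgram.stepsTo M t ⟨some (emb (entry c)), v, s⟩ ⟨some exit, v', s'⟩ := by
  induction h with
  | skip s =>
    intro emb exit hM v
    refine ⟨v, stepsTo_one ?_⟩
    rw [Turing.TM2.step, hM]; rfl
  | push k a s =>
    intro emb exit hM v
    refine ⟨v, stepsTo_one ?_⟩
    rw [Turing.TM2.step, hM]; rfl
  | @seq c d s s₁ s₂ t₁ t₂ _ _ ih₁ ih₂ =>
    intro emb exit hM v
    obtain ⟨v₁, h₁⟩ := ih₁ (fun l => emb (Sum.inl l)) (emb (Sum.inr (entry d)))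
      (fun l => hM (Sum.inl l)) v
    obtain ⟨v₂, h₂⟩ := ih₂ (fun l => emb (Sum.inr l)) exit (fun l => hM (Sum.inr l)) v₁
    exact ⟨v₂, h₁.trans h₂⟩
  | @case k f s s₁ t _ ih =>
    intro emb exit hM v
    obtain ⟨v₁, h₁⟩ := ih (fun l => emb (Sum.inr ⟨_, l⟩)) exit
      (fun l => by simpa only [code] using hM (Sum.inr ⟨_, l⟩)) (s k).head?
    refine ⟨v₁, stepsTo.trans (stepsTo_one ?_) h₁⟩
    rw [Turing.TM2.step, hM]
    simp [entry, code, Turing.TM2.stepAux]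
  | @loop_nil k fin f s hs =>
    intro emb exit hM v
    refine ⟨none, stepsTo_one ?_⟩
    rw [Turing.TM2.step, hM]
    simp only [entry, code, Turing.TM2.stepAux, hs, List.head?_nil, List.tail_nil]
    rw [← hs, Function.update_eq_self]
  | @loop_exit k fin f s a l hs ha =>
    intro emb exit hM v
    refine ⟨some a, stepsTo_one ?_⟩
    rw [Turing.TM2.step, hM]
    simp [entry, code, Turing.TM2.stepAux, hs, ha]
  | @loop_cons k fin f s a l s₁ s₂ t₁ t₂ hs ha _ _ ih₁ ih₂ =>
    intro emb exit hM v
    obtain ⟨v₁, h₁⟩ := ih₁ (fun l => emb (Sum.inr ⟨_, l⟩)) (emb (Sum.inl ()))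
      (fun l => by simpa only [code] using hM (Sum.inr ⟨_, l⟩)) (some a)
    obtain ⟨v₂, h₂⟩ := ih₂ emb exit hM v₁
    refine ⟨v₂, stepsTo.trans (stepsTo.trans (stepsTo_one ?_) h₁) h₂⟩
    rw [Turing.TM2.step, hM]
    simp [entry, code, Turing.TM2.stepAux, hs, ha]

/-- The program `c` transforms the stacks `s` into `s'` in at most `T` steps. -/
def Within [DecidableEq K] (c : Cmd K A) (s s' : K → List A) (T : ℕ) : Prop :=
  ∃ t ≤ T, Exec c s s' t

/-- The machine that runs a program and halts. -/
noncomputable def machine [DecidableEq K] [Fintype K] [Fintype A] (c : Cmd K A) (kin kout : K) :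
    Turing.FinTM2 where
  K := K
  k₀ := kin
  k₁ := kout
  Γ := fun _ => A
  Λ := Option (Lab c)
  main := some (entry c)
  ΛFin := letI := labFintype c; inferInstance
  σ := Option A
  initialState := none
  Γk₀Fin := inferInstanceAs (Fintype A)
  m := fun l => match l with
    | none => .load (fun _ => none) .halt
    | some l => code c some none l

/-- A program that computes `f` on encodings within a polynomial number of steps gives rise to a
polynomial-time Turing machine. -/
theorem polyTime_of_within [DecidableEq K] [Fintype K] [Fintype A] {α β : Type} (ea : α → List A)
    (eb : β → List A) (f : α → β) (c : Cmd K A) (kin kout : K) (T : Polynomial ℕ)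
    (h : ∀ a, Within c (Function.update (fun _ => []) kin (ea a))
      (Function.update (fun _ => []) kout (eb (f a))) (T.eval (ea a).length)) :
    Nonempty (Turing.TM2ComputableInPolyTime ea eb f) := by
  refine ⟨{ tm := machine c kin kout, inputAlphabet := Equiv.refl A, outputAlphabet := Equiv.refl A,
            time := T + 1, outputsFun := fun a => ?_ }⟩
  have key : ∃ t ≤ T.eval (ea a).length + 1,
      (flip bind (machine c kin kout).step)^[t]
        (some (Turing.initList (machine c kin kout) (List.map (Equiv.refl A).invFun (ea a)))) =
      some (Turing.haltList (machine c kin kout)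
          (List.map (Equiv.refl A).invFun (eb (f a)))) := by
    obtain ⟨t, ht, hex⟩ := h a
    obtain ⟨v', hst⟩ := hex.stepsTo (M := (machine c kin kout).m) some none (fun l => rfl) none
    -- The additional step is taken at the label `none`, which resets the register and halts.
    refine ⟨t + 1, by omega, ?_⟩
    have hi : Turing.initList (machine c kin kout) (ea a) =
        (⟨some (some (entry c)), none, Function.update (fun _ => []) kin (ea a)⟩ :
          Turing.TM2.Cfg (fun _ : K => A) (Option (Lab c)) (Option A)) := by
      unfold Turing.initList
      congr 1
      funext (k : K)
      by_cases hk : k = kin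
      · obtain rfl : k = kin := hk
        exact (dif_pos rfl).trans (Function.update_self (β := fun _ => List A) k (ea a) fun _ => []).symm
      · exact (dif_neg hk).trans (Function.update_of_ne (β := fun _ => List A) hk (ea a) fun _ => []).symm
    have hf : Turing.haltList (machine c kin kout) (eb (f a)) =
        (⟨none, none, Function.update (fun _ => []) kout (eb (f a))⟩ :
          Turing.TM2.Cfg (fun _ : K => A) (Option (Lab c)) (Option A)) := by
      unfold Turing.haltList
      congr 1
      funext (k : K)
      by_cases hk : k = kout
      · obtain rfl : k = kout := hk
        exact (dif_pos rfl).trans (Function.update_self (β := fun _ => List A) k (eb (f a)) fun _ => []).symm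
      · exact (dif_neg hk).trans (Function.update_of_ne (β := fun _ => List A) hk (eb (f a)) fun _ => []).symm
    have e₁ : List.map (Equiv.refl A).invFun (ea a) = ea a := List.map_id _
    have e₂ : List.map (Equiv.refl A).invFun (eb (f a)) = eb (f a) := List.map_id _
    have hi' := (congrArg (Turing.initList (machine c kin kout)) e₁).trans hi
    have hf' := (congrArg (Turing.haltList (machine c kin kout)) e₂).trans hf
    refine (congrArg (fun x => (flip bind (machine c kin kout).step)^[t + 1] (some x)) hi').trans
      (Eq.trans ?_ (congrArg some hf').symm)
    exact hst.trans (stepsTo_one rfl)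
  classical
  refine ⟨⟨Classical.choose key, ?_⟩, ?_⟩
  · exact (Classical.choose_spec key).2
  · exact (Classical.choose_spec key).1.trans_eq (by simp)

end StackProgram

/-! ## The kernelization program -/

namespace StackProgram

open BRACInstance (Symbol)

/-- The names of the stacks of the kernelization program. -/
inductive Stk
  | inp
  | res
  | out
  | bits
  | bits2
  | unit
  | unit2
  | aux
  | row
  | row2
  | flag
  | rk
  | cls
  | cls2
  | x
  | y
  | kp
  | kp2
  | kr
  | mat
  deriving DecidableEq

instance : Fintype Stk where
  elems := {.inp, .res, .out, .bits, .bits2, .unit, .unit2, .aux, .row, .row2, .flag, .rk,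
    .cls, .cls2, .x, .y, .kp, .kp2, .kr, .mat}
  complete k := by cases k <;> simp

/-- The contents of all stacks. -/
@[ext]
structure Sto where
  inp : List Symbol
  res : List Symbol
  out : List Symbol
  bits : List Symbol
  bits2 : List Symbol
  unit : List Symbol
  unit2 : List Symbol
  aux : List Symbol
  row : List Symbol
  row2 : List Symbol
  flag : List Symbol
  rk : List Symbol
  cls : List Symbol
  cls2 : List Symbol
  x : List Symbol
  y : List Symbol
  kp : List Symbol
  kp2 : List Symbol
  kr : List Symbol
  mat : List Symbol

/-- The contents of all stacks, as a function. -/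
def Sto.fn (s : Sto) : Stk → List Symbol
  | .inp => s.inp
  | .res => s.res
  | .out => s.out
  | .bits => s.bits
  | .bits2 => s.bits2
  | .unit => s.unit
  | .unit2 => s.unit2
  | .aux => s.aux
  | .row => s.row
  | .row2 => s.row2
  | .flag => s.flag
  | .rk => s.rk
  | .cls => s.cls
  | .cls2 => s.cls2
  | .x => s.x
  | .y => s.y
  | .kp => s.kp
  | .kp2 => s.kp2
  | .kr => s.kr
  | .mat => s.mat

/-- Replace the contents of one stack. -/
def Sto.set (s : Sto) (k : Stk) (v : List Symbol) : Sto :=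
  match k with
  | .inp => { s with inp := v }
  | .res => { s with res := v }
  | .out => { s with out := v }
  | .bits => { s with bits := v }
  | .bits2 => { s with bits2 := v }
  | .unit => { s with unit := v }
  | .unit2 => { s with unit2 := v }
  | .aux => { s with aux := v }
  | .row => { s with row := v }
  | .row2 => { s with row2 := v }
  | .flag => { s with flag := v }
  | .rk => { s with rk := v }
  | .cls => { s with cls := v }
  | .cls2 => { s with cls2 := v }
  | .x => { s with x := v }
  | .y => { s with y := v }
  | .kp => { s with kp := v }
  | .kp2 => { s with kp2 := v }
  | .kr => { s with kr := v }
  | .mat => { s with mat := v }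

/-- All stacks are empty. -/
def Sto.nil : Sto := ⟨[], [], [], [], [], [], [], [], [], [], [], [], [], [], [], [], [], [], [], []⟩

theorem Sto.update_fn (s : Sto) (k : Stk) (v : List Symbol) :
    Function.update s.fn k v = (s.set k v).fn := by
  funext j
  by_cases h : j = k
  · subst h
    rw [Function.update_self]
    cases j <;> rfl
  · rw [Function.update_of_ne h]
    cases k <;> cases j <;> first | rfl | exact absurd rfl h

theorem Sto.fn_set_self (s : Sto) (k : Stk) (v : List Symbol) : (s.set k v).fn k = v := by
  rw [← Sto.update_fn, Function.update_self]

theorem Sto.fn_set_of_ne (s : Sto) {k j : Stk} (h : j ≠ k) (v : List Symbol) :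
    (s.set k v).fn j = s.fn j := by
  rw [← Sto.update_fn, Function.update_of_ne h]

theorem Sto.fn_injective : Function.Injective Sto.fn := by
  intro s t h
  ext1
  · exact congrFun h .inp
  · exact congrFun h .res
  · exact congrFun h .out
  · exact congrFun h .bits
  · exact congrFun h .bits2
  · exact congrFun h .unit
  · exact congrFun h .unit2
  · exact congrFun h .aux
  · exact congrFun h .row
  · exact congrFun h .row2
  · exact congrFun h .flag
  · exact congrFun h .rk
  · exact congrFun h .cls
  · exact congrFun h .cls2
  · exact congrFun h .x
  · exact congrFun h .y
  · exact congrFun h .kp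
  · exact congrFun h .kp2
  · exact congrFun h .kr
  · exact congrFun h .mat

/-! ### Cost calculus for programs on the named stacks. -/

/-- The program `c` transforms the stacks `s` into `s'` in at most `T` steps. -/
def Run (c : Cmd Stk Symbol) (s s' : Sto) (T : ℕ) : Prop := Within c s.fn s'.fn T

theorem Run.mono {c : Cmd Stk Symbol} {s s' : Sto} {T T' : ℕ} (h : Run c s s' T) (hT : T ≤ T') :
    Run c s s' T' := by
  obtain ⟨t, ht, h⟩ := h
  exact ⟨t, ht.trans hT, h⟩

theorem Run.skip (s : Sto) : Run .skip s s 1 := ⟨1, le_rfl, .skip _⟩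

theorem Run.push (k : Stk) (a : Symbol) (s : Sto) : Run (.push k a) s (s.set k (a :: s.fn k)) 1 :=
  ⟨1, le_rfl, by rw [← Sto.update_fn]; exact .push _ _ _⟩

theorem Run.seq {c d : Cmd Stk Symbol} {s s₁ s₂ : Sto} {T₁ T₂ : ℕ} (h₁ : Run c s s₁ T₁)
    (h₂ : Run d s₁ s₂ T₂) : Run (.seq c d) s s₂ (T₁ + T₂) := by
  obtain ⟨t₁, ht₁, h₁⟩ := h₁
  obtain ⟨t₂, ht₂, h₂⟩ := h₂
  exact ⟨t₁ + t₂, by omega, .seq h₁ h₂⟩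

theorem Run.case {k : Stk} {f : Option Symbol → Cmd Stk Symbol} {s s₁ : Sto} {T : ℕ}
    (h : Run (f (s.fn k).head?) (s.set k (s.fn k).tail) s₁ T) : Run (.case k f) s s₁ (1 + T) := by
  obtain ⟨t, ht, h⟩ := h
  exact ⟨1 + t, by omega, .case (by rwa [Sto.update_fn])⟩

theorem Run.loop_nil {k : Stk} {fin : Symbol → Bool} {f : Symbol → Cmd Stk Symbol} {s : Sto}
    (h : s.fn k = []) : Run (.loop k fin f) s s 1 := ⟨1, le_rfl, .loop_nil h⟩

theorem Run.loop_exit {k : Stk} {fin : Symbol → Bool} {f : Symbol → Cmd Stk Symbol} {s : Sto}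
    {a : Symbol} {l : List Symbol} (h : s.fn k = a :: l) (ha : fin a = true) :
    Run (.loop k fin f) s (s.set k l) 1 :=
  ⟨1, le_rfl, by rw [← Sto.update_fn]; exact .loop_exit h ha⟩

theorem Run.loop_cons {k : Stk} {fin : Symbol → Bool} {f : Symbol → Cmd Stk Symbol}
    {s s₁ s₂ : Sto} {a : Symbol} {l : List Symbol} {T₁ T₂ : ℕ} (h : s.fn k = a :: l)
    (ha : fin a = false) (h₁ : Run (f a) (s.set k l) s₁ T₁) (h₂ : Run (.loop k fin f) s₁ s₂ T₂) :
    Run (.loop k fin f) s s₂ (1 + T₁ + T₂) := by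
  obtain ⟨t₁, ht₁, h₁⟩ := h₁
  obtain ⟨t₂, ht₂, h₂⟩ := h₂
  exact ⟨1 + t₁ + t₂, by omega, .loop_cons h ha (by rwa [Sto.update_fn]) h₂⟩

infixr:67 " ;; " => Cmd.seq

/-- Never leave a loop before the stack is empty. -/
def never : Symbol → Bool := fun _ => false

/-- Is a symbol the separator? -/
def isSep : Symbol → Bool
  | .sep => true
  | _ => false

/-- The symbol used in unary numbers. -/
def tok : Symbol := .bit true

/-- The symbol that marks the diagonal of the matrix. -/
def mark : Symbol := .bit false

/-- Move the contents of a stack to another stack, in reverse order. -/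
def mv (a b : Stk) : Cmd Stk Symbol := .loop a never (fun x => .push b x)

/-- Empty a stack. -/
def clear (a : Stk) : Cmd Stk Symbol := .loop a never (fun _ => .skip)

/-- Repeat a program while a stack is not empty. -/
def whileNE (a : Stk) (c : Cmd Stk Symbol) : Cmd Stk Symbol :=
  .loop a never (fun x => .push a x ;; c)

theorem Sto.set_fn_self (s : Sto) (k : Stk) : s.set k (s.fn k) = s := by
  apply Sto.fn_injective
  rw [← Sto.update_fn, Function.update_eq_self]

theorem Sto.set_set (s : Sto) (k : Stk) (v w : List Symbol) : (s.set k v).set k w = s.set k w := by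
  cases k <;> rfl

theorem run_mv {a b : Stk} (hab : b ≠ a) (s : Sto) :
    Run (mv a b) s ((s.set a []).set b ((s.fn a).reverse ++ s.fn b)) (2 * (s.fn a).length + 1) := by
  generalize hl : s.fn a = l
  induction l generalizing s with
  | nil =>
    have : (s.set a []).set b (([] : List Symbol).reverse ++ s.fn b) = s := by
      rw [← hl, Sto.set_fn_self, hl]
      exact Sto.set_fn_self s b
    rw [this]
    exact Run.loop_nil hl
  | cons x l ih =>
    have h := ih ((s.set a l).set b (x :: (s.set a l).fn b))
      (by rw [Sto.fn_set_of_ne _ hab.symm, Sto.fn_set_self])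
    have e : (((s.set a l).set b (x :: (s.set a l).fn b)).set a []).set b
        (l.reverse ++ ((s.set a l).set b (x :: (s.set a l).fn b)).fn b) =
        (s.set a []).set b ((x :: l).reverse ++ s.fn b) := by
      apply Sto.fn_injective
      simp only [← Sto.update_fn, Function.update_self]
      funext j
      by_cases hb : j = b
      · subst hb; simp [hab]
      · by_cases ha : j = a
        · subst ha; simp [hb]
        · simp [ha, hb]
    rw [e] at h
    refine (Run.loop_cons hl rfl (Run.push _ _ _) h).mono ?_
    simp only [List.length_cons]; omega

theorem run_clear (a : Stk) (s : Sto) :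
    Run (clear a) s (s.set a []) (2 * (s.fn a).length + 1) := by
  generalize hl : s.fn a = l
  induction l generalizing s with
  | nil =>
    have : s.set a [] = s := by rw [← hl, Sto.set_fn_self]
    rw [this]
    exact Run.loop_nil hl
  | cons x l ih =>
    have := ih (s.set a l) (Sto.fn_set_self _ _ _)
    rw [Sto.set_set] at this
    refine (Run.loop_cons hl rfl (Run.skip _) this).mono ?_
    simp only [List.length_cons]; omega

theorem Run.whileNE_nil {k : Stk} {c : Cmd Stk Symbol} {s : Sto} (T : ℕ) (h : s.fn k = []) :
    Run (whileNE k c) s s (T + 1) := (Run.loop_nil h).mono (by omega)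

theorem Run.whileNE_cons {k : Stk} {c : Cmd Stk Symbol} {s s₁ s₂ : Sto} {T₁ T₂ : ℕ}
    (h : s.fn k ≠ []) (h₁ : Run c s s₁ T₁) (h₂ : Run (whileNE k c) s₁ s₂ T₂) :
    Run (whileNE k c) s s₂ (2 + T₁ + T₂) := by
  obtain ⟨x, l, hl⟩ := List.exists_cons_of_ne_nil h
  have h₃ : Run (.push k x) (s.set k l) s 1 := by
    have := Run.push k x (s.set k l)
    rwa [Sto.set_set, Sto.fn_set_self, ← hl, Sto.set_fn_self] at this
  exact (Run.loop_cons hl rfl (h₃.seq h₁) h₂).mono (by omega)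

/-- The rows of a matrix as a string. -/
def flat : List (List Symbol) → List Symbol
  | [] => []
  | r :: rs => r ++ .sep :: flat rs

theorem flat_ne_nil {r : List Symbol} {rs : List (List Symbol)} : flat (r :: rs) ≠ [] := by
  simp [flat]

theorem isSep_eq_false {x : Symbol} (h : x ≠ .sep) : isSep x = false := by
  cases x <;> simp_all [isSep]

/-! ### The header -/

/-- Read the bits of the bend bound. -/
def headerLoop : Cmd Stk Symbol :=
  .loop .inp isSep (fun x => .push .bits x ;; .push .res x)

theorem run_headerLoop (l t b o : List Symbol) (s : Sto) (hl : ∀ x ∈ l, x ≠ .sep) :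
    Run headerLoop { s with inp := l ++ .sep :: t, bits := b, res := o }
      { s with inp := t, bits := l.reverse ++ b, res := l.reverse ++ o } (3 * l.length + 1) := by
  induction l generalizing b o with
  | nil => exact Run.loop_exit (a := .sep) rfl rfl
  | cons x l ih =>
    have := ih (x :: b) (x :: o) (fun y hy => hl y (List.mem_cons_of_mem _ hy))
    simp only [List.reverse_cons, List.append_assoc, List.singleton_append]
    refine (Run.loop_cons (a := x) rfl (isSep_eq_false (hl x List.mem_cons_self))
      ((Run.push _ _ _).seq (Run.push _ _ _)) this).mono ?_
    simp only [List.length_cons]; omega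

/-! ### Marking the diagonal -/

/-- Replace the symbol `x` by a mark if the symbol `y` is a mark. -/
def markSym : Symbol → Symbol → Symbol
  | .bit false, _ => mark
  | _, x => x

/-- Put marks into a row at the places where the first list has marks. -/
def markZip : List Symbol → List Symbol → List Symbol
  | _, [] => []
  | [], x :: r => x :: markZip [] r
  | y :: u, x :: r => markSym y x :: markZip u r

/-- Mark one row. -/
def markLoop : Cmd Stk Symbol :=
  .loop .inp isSep (fun x => .case .unit fun o => match o with
    | none => .push .aux x
    | some y => .push .unit2 y ;; .push .aux (markSym y x))

theorem run_markLoop (r t u v a : List Symbol) (s : Sto) (hr : ∀ x ∈ r, x ≠ .sep) :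
    Run markLoop { s with inp := r ++ .sep :: t, unit := u, unit2 := v, aux := a }
      { s with inp := t, unit := u.drop r.length, unit2 := (u.take r.length).reverse ++ v,
               aux := (markZip u r).reverse ++ a } (4 * r.length + 1) := by
  induction r generalizing u v a with
  | nil =>
    have : markZip u [] = [] := by cases u <;> rfl
    rw [this]
    exact Run.loop_exit (a := .sep) rfl rfl
  | cons x r ih =>
    have hr' : ∀ x ∈ r, x ≠ .sep := fun y hy => hr y (List.mem_cons_of_mem _ hy)
    have hx := isSep_eq_false (hr x List.mem_cons_self)
    cases u with
    | nil =>
      have := ih [] v (x :: a) hr'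
      simp only [markZip, List.reverse_cons, List.append_assoc, List.singleton_append,
        List.take_nil, List.drop_nil] at this ⊢
      refine (Run.loop_cons (a := x) rfl hx (Run.case (T := 1) (Run.push _ _ _)) this).mono ?_
      simp only [List.length_cons]; omega
    | cons y u =>
      have := ih u (y :: v) (markSym y x :: a) hr'
      simp only [markZip, List.reverse_cons, List.append_assoc, List.singleton_append,
        List.length_cons, List.take_succ_cons, List.drop_succ_cons] at this ⊢
      refine (Run.loop_cons (a := x) rfl hx
        (Run.case (T := 2) ((Run.push _ _ _).seq (Run.push _ _ _))) this).mono ?_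
      omega

/-- Mark the rows of a matrix along a diagonal. -/
def markRows : List Symbol → List (List Symbol) → List (List Symbol)
  | _, [] => []
  | u, r :: rs => markZip u r :: markRows (tok :: u) rs

/-- Mark all rows. -/
def markAll : Cmd Stk Symbol :=
  whileNE .inp (markLoop ;; .push .aux .sep ;; mv .unit2 .unit ;; .push .unit tok)

/-- While row i is processed, `unit` should hold i tokens followed by a mark, so the mark meets the
diagonal entry. Scanning a row moves a prefix of `unit` to `unit2`; moving it back restores the
list, and one more token advances the diagonal. -/
theorem run_markAll (N : ℕ) (rs : List (List Symbol)) (u a : List Symbol) (s : Sto)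
    (hr : ∀ r ∈ rs, (∀ x ∈ r, x ≠ .sep) ∧ r.length ≤ N) :
    Run markAll { s with inp := flat rs, unit := u, unit2 := [], aux := a }
      { s with inp := [], unit := List.replicate rs.length tok ++ u, unit2 := [],
               aux := (flat (markRows u rs)).reverse ++ a } (rs.length * (6 * N + 6) + 1) := by
  induction rs generalizing u a with
  | nil => exact Run.whileNE_nil _ (by rfl)
  | cons r rs ih =>
    obtain ⟨hr₁, hr₂⟩ := hr r List.mem_cons_self
    have h₁ := run_markLoop r (flat rs) u [] a s hr₁
    have h₂ := ih (tok :: u) (.sep :: ((markZip u r).reverse ++ a))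
      (fun y hy => hr y (List.mem_cons_of_mem _ hy))
    have h₃ := run_mv (a := .unit2) (b := .unit) (by decide)
      { s with inp := flat rs, unit := u.drop r.length, unit2 := (u.take r.length).reverse ++ [],
               aux := .sep :: ((markZip u r).reverse ++ a) }
    simp only [Sto.fn, Sto.set, List.append_nil, List.reverse_reverse, List.take_append_drop,
      List.length_reverse] at h₁ h₃
    have e₁ : (flat (markRows u (r :: rs))).reverse ++ a =
        (flat (markRows (tok :: u) rs)).reverse ++ .sep :: ((markZip u r).reverse ++ a) := by
      simp [markRows, flat]
    have e₂ : List.replicate (r :: rs).length tok ++ u =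
        List.replicate rs.length tok ++ tok :: u := by
      rw [List.length_cons, List.replicate_succ']; simp
    rw [e₁, e₂]
    refine (Run.whileNE_cons (by exact flat_ne_nil) (h₁.seq ((Run.push _ _ _).seq (h₃.seq (Run.push _ _ _))))
      h₂).mono ?_
    have : (u.take r.length).length ≤ r.length := List.length_take_le _ _
    simp only [List.length_cons]
    nlinarith

/-! ### Ranks -/

/-- May two rows of the marked matrix of a graph with twin vertices have these two symbols at the
same place? -/
def agree : Symbol → Symbol → Bool
  | .bit _, _ => true
  | _, .bit _ => true
  | .entry none, .entry none => true
  | .entry (some _), .entry (some _) => true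
  | _, _ => false

/-- The number of disagreements between two rows. -/
def mism : List Symbol → List Symbol → ℕ
  | [], _ => 0
  | _ :: _, [] => 0
  | x :: xs, y :: ys => mism xs ys + if agree x y then 0 else 1

/-- Compare a row of the input with a row that is kept in memory. -/
def cmpLoop : Cmd Stk Symbol :=
  .loop .inp isSep (fun x => .push .aux x ;; .case .row fun o => match o with
    | none => .skip
    | some y => .push .row2 y ;; (if agree x y then .skip else .push .flag tok))

theorem run_cmpLoop (r t u v f a : List Symbol) (s : Sto) (hr : ∀ x ∈ r, x ≠ .sep) :
    Run cmpLoop { s with inp := r ++ .sep :: t, row := u, row2 := v, flag := f, aux := a }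
      { s with inp := t, row := u.drop r.length, row2 := (u.take r.length).reverse ++ v,
               flag := List.replicate (mism r u) tok ++ f, aux := r.reverse ++ a }
      (5 * r.length + 1) := by
  induction r generalizing u v f a with
  | nil => exact Run.loop_exit (a := .sep) rfl rfl
  | cons x r ih =>
    have hr' : ∀ x ∈ r, x ≠ .sep := fun y hy => hr y (List.mem_cons_of_mem _ hy)
    have hx := isSep_eq_false (hr x List.mem_cons_self)
    cases u with
    | nil =>
      have hm : mism r [] = 0 := by cases r <;> rfl
      have := ih [] v f (x :: a) hr'
      simp only [mism, hm, List.reverse_cons, List.append_assoc, List.singleton_append,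
        List.take_nil, List.drop_nil] at this ⊢
      refine (Run.loop_cons (a := x) rfl hx
        ((Run.push _ _ _).seq (Run.case (T := 1) (Run.skip _))) this).mono ?_
      simp only [List.length_cons]; omega
    | cons y u =>
      by_cases hxy : agree x y = true
      · have := ih u (y :: v) f (x :: a) hr'
        simp only [mism, hxy, if_true, add_zero, List.reverse_cons, List.append_assoc,
          List.singleton_append, List.length_cons, List.take_succ_cons, List.drop_succ_cons] at this ⊢
        refine (Run.loop_cons (a := x) rfl hx ((Run.push _ _ _).seq
          (Run.case (T := 2) ((Run.push _ _ _).seq (T₂ := 1) ?_))) this).mono ?_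
        · rw [if_pos hxy]; exact Run.skip _
        · omega
      · have := ih u (y :: v) (tok :: f) (x :: a) hr'
        have e : List.replicate (mism r u) tok ++ tok :: f =
            List.replicate (mism r u + 1) tok ++ f := by
          rw [List.replicate_succ']; simp
        rw [e] at this
        simp only [mism, hxy, List.reverse_cons, List.append_assoc,
          List.singleton_append, List.length_cons, List.take_succ_cons, List.drop_succ_cons] at this ⊢
        refine (Run.loop_cons (a := x) rfl hx ((Run.push _ _ _).seq
          (Run.case (T := 2) ((Run.push _ _ _).seq (T₂ := 1) ?_))) this).mono ?_
        · rw [if_neg hxy]; exact Run.push _ _ _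
        · omega

/-- The number of rows of a list that fully agree with a given row. -/
def cnt (r : List Symbol) : List (List Symbol) → ℕ
  | [] => 0
  | r' :: rs => cnt r rs + if mism r' r = 0 then 1 else 0

/-- Count the remaining rows that agree with the row in memory. -/
def cntAll : Cmd Stk Symbol :=
  whileNE .inp (cmpLoop ;; .push .aux .sep ;; mv .row2 .row ;; .case .flag fun o => match o with
    | none => .push .rk tok
    | some _ => clear .flag)

theorem mism_le (r u : List Symbol) : mism r u ≤ r.length := by
  induction r generalizing u with
  | nil => simp [mism]
  | cons x r ih =>
    cases u with
    | nil => simp [mism]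
    | cons y u =>
      have := ih u
      simp only [mism, List.length_cons]
      split_ifs <;> omega

/-- `flag` collects one token per disagreement. It is empty exactly if the rows agree, in which case
the rank grows; otherwise it is cleared for the next comparison. The rows that were read are saved
on `aux` in reverse order. -/
theorem run_cntAll (N : ℕ) (rs : List (List Symbol)) (r a k : List Symbol) (s : Sto)
    (hr : ∀ r ∈ rs, (∀ x ∈ r, x ≠ .sep) ∧ r.length ≤ N) :
    Run cntAll { s with inp := flat rs, row := r, row2 := [], flag := [], aux := a, rk := k }
      { s with inp := [], row := r, row2 := [], flag := [], aux := (flat rs).reverse ++ a,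
               rk := List.replicate (cnt r rs) tok ++ k } (rs.length * (9 * N + 8) + 1) := by
  induction rs generalizing a k with
  | nil => exact Run.whileNE_nil _ (by rfl)
  | cons r' rs ih =>
    obtain ⟨hr₁, hr₂⟩ := hr r' List.mem_cons_self
    have h₁ := run_cmpLoop r' (flat rs) r [] [] a { s with rk := k } hr₁
    have h₃ := run_mv (a := .row2) (b := .row) (by decide)
      { s with inp := flat rs, row := r.drop r'.length, row2 := (r.take r'.length).reverse ++ [],
               flag := List.replicate (mism r' r) tok ++ [], rk := k,
               aux := .sep :: (r'.reverse ++ a) }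
    simp only [Sto.fn, Sto.set, List.append_nil, List.reverse_reverse, List.take_append_drop,
      List.length_reverse] at h₁ h₃
    have e₁ : (flat (r' :: rs)).reverse ++ a = (flat rs).reverse ++ .sep :: (r'.reverse ++ a) := by
      simp [flat]
    have hlen : (r.take r'.length).length ≤ r'.length := List.length_take_le _ _
    have hlen' := mism_le r' r
    rw [e₁]
    rcases hm : mism r' r with _ | m
    · have h₂ := ih (.sep :: (r'.reverse ++ a)) (tok :: k)
        (fun y hy => hr y (List.mem_cons_of_mem _ hy))
      have e : List.replicate (cnt r (r' :: rs)) tok ++ k =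
          List.replicate (cnt r rs) tok ++ tok :: k := by
        simp only [cnt, hm, if_true]
        rw [List.replicate_succ']; simp
      rw [e]
      rw [hm] at h₁ h₃
      refine (Run.whileNE_cons (by exact flat_ne_nil) (h₁.seq ((Run.push _ _ _).seq (h₃.seq
        (Run.case (T := 1) (Run.push _ _ _))))) h₂).mono ?_
      simp only [List.length_cons]
      nlinarith
    · have h₂ := ih (.sep :: (r'.reverse ++ a)) k
        (fun y hy => hr y (List.mem_cons_of_mem _ hy))
      have e : cnt r (r' :: rs) = cnt r rs := by simp [cnt, hm]
      rw [e]
      rw [hm] at h₁ h₃ hlen'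
      refine (Run.whileNE_cons (by exact flat_ne_nil) (h₁.seq ((Run.push _ _ _).seq (h₃.seq
        (Run.case (T := 2 * m + 1) ((run_clear .flag _).mono ?_))))) h₂).mono ?_
      · simp [Sto.fn, Sto.set, List.replicate_succ]
      · simp only [List.length_cons]
        nlinarith

/-- The ranks of the rows: how many later rows agree with a row. -/
def ranks : List (List Symbol) → List ℕ
  | [] => []
  | r :: rs => cnt r rs :: ranks rs

/-- A sequence of numbers in unary. -/
def unary : List ℕ → List Symbol
  | [] => []
  | n :: ns => List.replicate n tok ++ .sep :: unary ns

theorem unary_append (l m : List ℕ) : unary (l ++ m) = unary l ++ unary m := by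
  induction l with
  | nil => rfl
  | cons n l ih => simp [unary, ih]

/-- Read a row into memory. -/
def readRow : Cmd Stk Symbol := .loop .inp isSep (fun x => .push .row2 x)

theorem run_readRow (r t v : List Symbol) (s : Sto) (hr : ∀ x ∈ r, x ≠ .sep) :
    Run readRow { s with inp := r ++ .sep :: t, row2 := v }
      { s with inp := t, row2 := r.reverse ++ v } (2 * r.length + 1) := by
  induction r generalizing v with
  | nil => exact Run.loop_exit (a := .sep) rfl rfl
  | cons x r ih =>
    have := ih (x :: v) (fun y hy => hr y (List.mem_cons_of_mem _ hy))
    simp only [List.reverse_cons, List.append_assoc, List.singleton_append]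
    refine (Run.loop_cons (a := x) rfl (isSep_eq_false (hr x List.mem_cons_self))
      (by exact Run.push _ _ _) this).mono ?_
    simp only [List.length_cons]; omega

/-- Determine the ranks of all rows, and the number of rows of rank zero. -/
def rankAll : Cmd Stk Symbol :=
  whileNE .inp (.push .rk .sep ;; readRow ;; mv .row2 .row ;; cntAll ;; mv .aux .inp ;;
    (.case .rk fun o => match o with
      | some .sep => .push .rk .sep ;; .push .cls tok
      | some y => .push .rk y
      | none => .skip) ;; mv .row .mat ;; .push .mat .sep)

theorem flat_length_le (N : ℕ) (rs : List (List Symbol)) (hr : ∀ r ∈ rs, r.length ≤ N) :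
    (flat rs).length ≤ rs.length * (N + 1) := by
  induction rs with
  | nil => simp [flat]
  | cons r rs ih =>
    have := ih (fun y hy => hr y (List.mem_cons_of_mem _ hy))
    have := hr r List.mem_cons_self
    simp only [flat, List.length_append, List.length_cons]
    nlinarith

/-- Each row is compared with the later rows only, which is what the rank counts. The separator is
pushed on `rk` before counting, so a separator on top afterwards signals rank zero, and `cls` gains
a token. Ranks and rows pile up in reverse order. -/
theorem run_rankAll (N : ℕ) (rs : List (List Symbol)) (k c m : List Symbol) (s : Sto)
    (hr : ∀ r ∈ rs, (∀ x ∈ r, x ≠ .sep) ∧ r.length ≤ N) (hN : rs.length ≤ N) :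
    Run rankAll { s with inp := flat rs, row := [], row2 := [], flag := [], aux := [],
                         rk := k, cls := c, mat := m }
      { s with inp := [], row := [], row2 := [], flag := [], aux := [],
               rk := unary (ranks rs).reverse ++ k,
               cls := List.replicate ((ranks rs).count 0) tok ++ c,
               mat := (flat rs).reverse ++ m } (rs.length * (11 * N * N + 20 * N + 20) + 1) := by
  induction rs generalizing k c m with
  | nil => exact Run.whileNE_nil _ (by rfl)
  | cons r rs ih =>
    obtain ⟨hr₁, hr₂⟩ := hr r List.mem_cons_self
    have hr' : ∀ r ∈ rs, (∀ x ∈ r, x ≠ .sep) ∧ r.length ≤ N :=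
      fun y hy => hr y (List.mem_cons_of_mem _ hy)
    have h₁ := run_readRow r (flat rs) []
      { s with row := [], flag := [], aux := [], rk := .sep :: k, cls := c, mat := m } hr₁
    have h₂ := run_mv (a := .row2) (b := .row) (by decide)
      { s with inp := flat rs, row := [], row2 := r.reverse ++ [], flag := [], aux := [],
                         rk := .sep :: k, cls := c, mat := m }
    have h₃ := run_cntAll N rs r [] (.sep :: k) { s with cls := c, mat := m } hr'
    have h₄ := run_mv (a := .aux) (b := .inp) (by decide)
      { s with inp := [], row := r, row2 := [], flag := [], aux := (flat rs).reverse ++ [],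
               rk := List.replicate (cnt r rs) tok ++ .sep :: k, cls := c, mat := m }
    simp only [Sto.fn, Sto.set, List.append_nil, List.reverse_reverse,
      List.length_reverse] at h₁ h₂ h₃ h₄
    have hf := flat_length_le N rs (fun y hy => (hr' y hy).2)
    simp only [List.length_cons] at hN
    have ef : (flat (r :: rs)).reverse ++ m = (flat rs).reverse ++ .sep :: (r.reverse ++ m) := by
      simp [flat]
    have eu : unary (ranks (r :: rs)).reverse ++ k =
        unary (ranks rs).reverse ++ (List.replicate (cnt r rs) tok ++ .sep :: k) := by
      simp [ranks, unary_append, unary]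
    rw [ef, eu]
    rcases hm : cnt r rs with _ | q
    · have h₅ := run_mv (a := .row) (b := .mat) (by decide)
        { s with inp := flat rs, row := r, row2 := [], flag := [], aux := [],
                 rk := .sep :: k, cls := tok :: c, mat := m }
      have h₆ := ih (.sep :: k) (tok :: c) (.sep :: (r.reverse ++ m)) hr' (by omega)
      rw [hm] at h₃ h₄
      have ec : List.replicate ((ranks (r :: rs)).count 0) tok ++ c =
          List.replicate ((ranks rs).count 0) tok ++ tok :: c := by
        simp only [ranks, hm, List.count_cons_self, List.replicate_succ']; simp
      rw [ec]
      refine (Run.whileNE_cons (by exact flat_ne_nil) ((Run.push _ _ _).seq (h₁.seq (h₂.seq (h₃.seq (h₄.seq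
        ((Run.case (T := 2) ((Run.push _ _ _).seq (Run.push _ _ _))).seq
          (h₅.seq (Run.push _ _ _)))))))) h₆).mono ?_
      simp only [List.length_cons, Sto.fn]
      nlinarith
    · have h₅ := run_mv (a := .row) (b := .mat) (by decide)
        { s with inp := flat rs, row := r, row2 := [], flag := [], aux := [],
                 rk := List.replicate (q + 1) tok ++ .sep :: k, cls := c, mat := m }
      have h₆ := ih (List.replicate (q + 1) tok ++ .sep :: k) c (.sep :: (r.reverse ++ m)) hr'
        (by omega)
      rw [hm] at h₃ h₄
      have ec : (ranks (r :: rs)).count 0 = (ranks rs).count 0 := by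
        simp [ranks, hm]
      rw [ec]
      refine (Run.whileNE_cons (by exact flat_ne_nil) ((Run.push _ _ _).seq (h₁.seq (h₂.seq (h₃.seq (h₄.seq
        ((Run.case (T := 1) (Run.push _ _ _)).seq
          (h₅.seq (Run.push _ _ _)))))))) h₆).mono ?_
      simp only [List.length_cons, Sto.fn]
      nlinarith

/-! ### Selecting rows -/

/-- Read a number in unary. -/
def readNum : Cmd Stk Symbol := .loop .rk isSep (fun _ => .push .x tok)

theorem run_readNum (n m : ℕ) (t : List Symbol) (s : Sto) :
    Run readNum { s with rk := List.replicate n tok ++ .sep :: t, x := List.replicate m tok }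
      { s with rk := t, x := List.replicate (n + m) tok } (2 * n + 1) := by
  induction n generalizing m with
  | zero =>
    simp only [zero_add]
    exact Run.loop_exit (a := .sep) rfl rfl
  | succ n ih =>
    have := ih (m + 1)
    have e : n + 1 + m = n + (m + 1) := by omega
    rw [e]
    refine (Run.loop_cons (a := tok) rfl rfl (by exact Run.push _ _ _) this).mono ?_
    omega

/-- Halve a number, first part. -/
def halveLoop : Cmd Stk Symbol :=
  .loop .x never (fun _ => .case .x fun o => match o with
    | none => .skip
    | some _ => .push .y tok)

/-- Halve a number. -/
def halve : Cmd Stk Symbol := halveLoop ;; mv .y .x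

theorem run_halveLoop (n m : ℕ) (s : Sto) :
    Run halveLoop { s with x := List.replicate n tok, y := List.replicate m tok }
      { s with x := [], y := List.replicate (n / 2 + m) tok } (2 * n + 2) := by
  induction n using Nat.strong_induction_on generalizing m with
  | _ n ih =>
    match n with
    | 0 =>
      simp only [Nat.zero_div, zero_add]
      exact (Run.loop_nil (by rfl)).mono (by omega)
    | 1 =>
      have e : 1 / 2 + m = m := by omega
      rw [e]
      refine (Run.loop_cons (a := tok) rfl rfl (by exact Run.case (T := 1) (Run.skip _))
        (Run.loop_nil (by rfl))).mono ?_
      omega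
    | n + 2 =>
      have := ih n (by omega) (m + 1)
      have e : (n + 2) / 2 + m = n / 2 + (m + 1) := by omega
      rw [e]
      refine (Run.loop_cons (a := tok) rfl rfl (by exact Run.case (T := 1) (Run.push _ _ _))
        this).mono ?_
      omega

theorem run_halve (n : ℕ) (s : Sto) :
    Run halve { s with x := List.replicate n tok, y := [] }
      { s with x := List.replicate (n / 2) tok, y := [] } (3 * n + 3) := by
  have h₁ := run_halveLoop n 0 s
  have h₂ := run_mv (a := .y) (b := .x) (by decide)
    { s with x := [], y := List.replicate (n / 2 + 0) tok }
  simp only [Sto.fn, Sto.set, List.append_nil, List.reverse_replicate, List.length_replicate,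
    add_zero] at h₁ h₂
  exact (h₁.seq h₂).mono (by omega)

/-- Halve a number as often as there are symbols on a stack. -/
def halveMany : Cmd Stk Symbol := .loop .bits never (fun z => .push .bits2 z ;; halve)

/-- Only the number of symbols on `bits` matters; it is the exponent. The power of two itself, which
may be exponentially large in the input length, is never written down. -/
theorem run_halveMany (b b' : List Symbol) (n : ℕ) (s : Sto) :
    Run halveMany { s with bits := b, bits2 := b', x := List.replicate n tok, y := [] }
      { s with bits := [], bits2 := b.reverse ++ b', x := List.replicate (n / 2 ^ b.length) tok,
               y := [] } (b.length * (3 * n + 5) + 1) := by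
  induction b generalizing b' n with
  | nil =>
    simp only [List.length_nil, pow_zero, Nat.div_one]
    exact (Run.loop_nil (by rfl)).mono (by omega)
  | cons z b ih =>
    have h₁ := run_halve n { s with bits := b, bits2 := z :: b' }
    have h₂ := ih (z :: b') (n / 2)
    have e : n / 2 ^ (z :: b).length = n / 2 / 2 ^ b.length := by
      rw [Nat.div_div_eq_div_mul, List.length_cons, pow_succ']
    rw [e]
    simp only [List.reverse_cons, List.append_assoc, List.singleton_append]
    refine (Run.loop_cons (a := z) rfl rfl (by exact (Run.push _ _ _).seq h₁) h₂).mono ?_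
    simp only [List.length_cons]
    have : b.length * (3 * (n / 2) + 5) ≤ b.length * (3 * n + 5) :=
      Nat.mul_le_mul le_rfl (by omega)
    nlinarith

/-- Subtract the number of classes from a number. -/
def subCls : Cmd Stk Symbol :=
  .loop .cls never (fun z => .push .cls2 z ;; .case .x fun _ => .skip)

theorem run_subCls (c c' : List Symbol) (n : ℕ) (s : Sto) :
    Run subCls { s with cls := c, cls2 := c', x := List.replicate n tok }
      { s with cls := [], cls2 := c.reverse ++ c', x := List.replicate (n - c.length) tok }
      (4 * c.length + 1) := by
  induction c generalizing c' n with
  | nil => exact Run.loop_nil (by rfl)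
  | cons z c ih =>
    have h₂ := ih (z :: c') (n - 1)
    have e : n - (z :: c).length = n - 1 - c.length := by simp only [List.length_cons]; omega
    rw [e]
    simp only [List.reverse_cons, List.append_assoc, List.singleton_append]
    have h₁ : Run (Cmd.case .x fun _ => .skip)
        { s with cls := c, cls2 := z :: c', x := List.replicate n tok }
        { s with cls := c, cls2 := z :: c', x := List.replicate (n - 1) tok } 2 := by
      cases n with
      | zero => exact Run.case (T := 1) (Run.skip _)
      | succ n => exact Run.case (T := 1) (Run.skip _)
    refine (Run.loop_cons (a := z) rfl rfl (by exact (Run.push _ _ _).seq h₁) h₂).mono ?_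
    simp only [List.length_cons]; omega

/-- The symbol that tells whether a row of a given rank is kept. -/
def keepSym (L c n : ℕ) : Symbol := if n / 2 ^ L ≤ c then tok else .sep

/-- Decide for all rows whether they are kept. -/
def keepAll : Cmd Stk Symbol :=
  whileNE .rk (readNum ;; halveMany ;; mv .bits2 .bits ;; subCls ;; mv .cls2 .cls ;;
    (.case .x fun o => match o with
      | none => .push .kp tok ;; .push .kr tok
      | some _ => .push .kp .sep ;; .push .kr .sep) ;; clear .x)

/-- The flags are produced twice, once for the columns (`kp`) and once for the rows (`kr`). Pushing
reverses the order, which undoes the reversal of the ranks on `rk`. -/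
theorem run_keepAll (N : ℕ) (ns : List ℕ) (b c p q : List Symbol) (s : Sto)
    (hns : ∀ n ∈ ns, n ≤ N) :
    Run keepAll { s with rk := unary ns, bits := b, bits2 := [], cls := c, cls2 := [], x := [],
                         y := [], kp := p, kr := q }
      { s with rk := [], bits := b, bits2 := [], cls := c, cls2 := [], x := [], y := [],
               kp := (ns.map (keepSym b.length c.length)).reverse ++ p,
               kr := (ns.map (keepSym b.length c.length)).reverse ++ q }
      (ns.length * (b.length * (3 * N + 7) + 6 * c.length + 4 * N + 20) + 1) := by
  induction ns generalizing p q with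
  | nil => exact Run.whileNE_nil _ (by rfl)
  | cons n ns ih =>
    have hn := hns n List.mem_cons_self
    have h₁ := run_readNum n 0 (unary ns)
      { s with bits := b, bits2 := [], cls := c, cls2 := [], y := [], kp := p, kr := q }
    have h₂ := run_halveMany b [] n
      { s with rk := unary ns, cls := c, cls2 := [], kp := p, kr := q }
    have h₃ := run_mv (a := .bits2) (b := .bits) (by decide)
      { s with rk := unary ns, bits := [], bits2 := b.reverse ++ [], cls := c, cls2 := [],
               x := List.replicate (n / 2 ^ b.length) tok, y := [], kp := p, kr := q }
    have h₄ := run_subCls c [] (n / 2 ^ b.length)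
      { s with rk := unary ns, bits := b, bits2 := [], y := [], kp := p, kr := q }
    have h₅ := run_mv (a := .cls2) (b := .cls) (by decide)
      { s with rk := unary ns, bits := b, bits2 := [], cls := [], cls2 := c.reverse ++ [],
               x := List.replicate (n / 2 ^ b.length - c.length) tok, y := [], kp := p, kr := q }
    have h₇ := ih (keepSym b.length c.length n :: p) (keepSym b.length c.length n :: q)
      (fun y hy => hns y (List.mem_cons_of_mem _ hy))
    simp only [Sto.fn, Sto.set, List.append_nil, List.reverse_reverse, List.length_reverse,
      add_zero, List.replicate_zero] at h₁ h₂ h₃ h₄ h₅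
    simp only [List.map_cons, List.reverse_cons, List.append_assoc, List.singleton_append]
    have h₆ : Run ((.case .x fun o => match o with
          | none => .push .kp tok ;; .push .kr tok
          | some _ => .push .kp .sep ;; .push .kr .sep) ;; clear .x)
        { s with rk := unary ns, bits := b, bits2 := [], cls := c, cls2 := [],
                 x := List.replicate (n / 2 ^ b.length - c.length) tok, y := [], kp := p, kr := q }
        { s with rk := unary ns, bits := b, bits2 := [], cls := c, cls2 := [], x := [], y := [],
                 kp := keepSym b.length c.length n :: p, kr := keepSym b.length c.length n :: q }
        (2 * n + 4) := by
      have hle : n / 2 ^ b.length ≤ n := Nat.div_le_self _ _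
      -- The subtraction is truncated, so the result is zero exactly if the quotient is at most the
      -- number of classes.
      rcases hm : n / 2 ^ b.length - c.length with _ | m
      · rw [keepSym, if_pos (by omega)]
        refine (Run.seq (Run.case (T := 2) ((Run.push _ _ _).seq (Run.push _ _ _)))
          (Run.loop_nil (by rfl))).mono ?_
        omega
      · rw [keepSym, if_neg (by omega)]
        have h := run_clear .x
          { s with rk := unary ns, bits := b, bits2 := [], cls := c, cls2 := [],
                   x := List.replicate m tok, y := [], kp := .sep :: p, kr := .sep :: q }
        refine (Run.seq (Run.case (T := 2) ((Run.push _ _ _).seq (Run.push _ _ _))) h).mono ?_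
        simp only [Sto.fn, List.length_replicate]
        omega
    refine (Run.whileNE_cons (by simp [Sto.fn])
      (h₁.seq (h₂.seq (h₃.seq (h₄.seq (h₅.seq h₆))))) h₇).mono ?_
    simp only [List.length_cons]
    have : b.length * (3 * n + 5) ≤ b.length * (3 * N + 5) :=
      Nat.mul_le_mul le_rfl (by omega)
    nlinarith

/-! ### Output -/

/-- Is a row with this symbol kept? -/
def isKeep : Symbol → Bool
  | .bit _ => true
  | _ => false

/-- Remove a mark. -/
def unmark : Symbol → Symbol
  | .bit _ => .entry none
  | x => x

/-- The entries of a row in the columns that are kept. -/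
def selectRow : List Symbol → List Symbol → List Symbol
  | y :: p, x :: r => if isKeep y then unmark x :: selectRow p r else selectRow p r
  | _, _ => []

/-- Write the entries of a row in the columns that are kept. -/
def writeRow : Cmd Stk Symbol :=
  .loop .inp isSep (fun x => .case .kp fun o => match o with
    | none => .skip
    | some y => .push .kp2 y ;; (if isKeep y then .push .res (unmark x) else .skip))

theorem run_writeRow (r t p p' o : List Symbol) (s : Sto) (hr : ∀ x ∈ r, x ≠ .sep) :
    Run writeRow { s with inp := r ++ .sep :: t, kp := p, kp2 := p', res := o }
      { s with inp := t, kp := p.drop r.length, kp2 := (p.take r.length).reverse ++ p',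
               res := (selectRow p r).reverse ++ o } (4 * r.length + 1) := by
  induction r generalizing p p' o with
  | nil =>
    have : selectRow p [] = [] := by cases p <;> rfl
    rw [this]
    exact Run.loop_exit (a := .sep) rfl rfl
  | cons x r ih =>
    have hr' : ∀ x ∈ r, x ≠ .sep := fun y hy => hr y (List.mem_cons_of_mem _ hy)
    have hx := isSep_eq_false (hr x List.mem_cons_self)
    cases p with
    | nil =>
      have := ih [] p' o hr'
      simp only [selectRow, List.reverse_nil, List.nil_append, List.take_nil, List.drop_nil]
        at this ⊢
      refine (Run.loop_cons (a := x) rfl hx (by exact Run.case (T := 1) (Run.skip _)) this).mono ?_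
      simp only [List.length_cons]; omega
    | cons y p =>
      by_cases hy : isKeep y = true
      · have := ih p (y :: p') (unmark x :: o) hr'
        simp only [selectRow, hy, if_true, List.reverse_cons, List.append_assoc,
          List.singleton_append, List.length_cons, List.take_succ_cons, List.drop_succ_cons] at this ⊢
        refine (Run.loop_cons (a := x) rfl hx
          (Run.case (T := 2) ((Run.push _ _ _).seq (T₂ := 1) ?_)) this).mono ?_
        · rw [if_pos hy]; exact Run.push _ _ _
        · omega
      · have := ih p (y :: p') o hr'
        simp only [selectRow, hy, List.reverse_cons, List.append_assoc,
          List.singleton_append, List.length_cons, List.take_succ_cons, List.drop_succ_cons] at this ⊢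
        refine (Run.loop_cons (a := x) rfl hx
          (Run.case (T := 2) ((Run.push _ _ _).seq (T₂ := 1) ?_)) this).mono ?_
        · rw [if_neg hy]; exact Run.skip _
        · omega

/-- Skip a row of the input. -/
def skipRow : Cmd Stk Symbol := .loop .inp isSep (fun _ => .skip)

theorem run_skipRow (r t : List Symbol) (s : Sto) (hr : ∀ x ∈ r, x ≠ .sep) :
    Run skipRow { s with inp := r ++ .sep :: t } { s with inp := t } (2 * r.length + 1) := by
  induction r with
  | nil => exact Run.loop_exit (a := .sep) rfl rfl
  | cons x r ih =>
    have := ih (fun y hy => hr y (List.mem_cons_of_mem _ hy))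
    refine (Run.loop_cons (a := x) rfl (isSep_eq_false (hr x List.mem_cons_self))
      (by exact Run.skip _) this).mono ?_
    simp only [List.length_cons]; omega

/-- The submatrix of the kept rows (according to the second list) and columns (according to the
first list). -/
def selectRows (p : List Symbol) : List Symbol → List (List Symbol) → List (List Symbol)
  | y :: q, r :: rs => if isKeep y then selectRow p r :: selectRows p q rs else selectRows p q rs
  | _, _ => []

/-- Write the matrix restricted to the kept rows and columns. -/
def writeAll : Cmd Stk Symbol :=
  whileNE .inp (.case .kr fun o => match o with
    | some (.bit _) => writeRow ;; .push .res .sep ;; mv .kp2 .kp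
    | _ => skipRow)

theorem run_writeAll (N : ℕ) (rs : List (List Symbol)) (p q o : List Symbol) (s : Sto)
    (hr : ∀ r ∈ rs, (∀ x ∈ r, x ≠ .sep) ∧ r.length ≤ N) (hq : q.length = rs.length) :
    Run writeAll { s with inp := flat rs, kp := p, kp2 := [], kr := q, res := o }
      { s with inp := [], kp := p, kp2 := [], kr := [],
               res := (flat (selectRows p q rs)).reverse ++ o }
      (rs.length * (6 * N + 6) + 1) := by
  induction rs generalizing q o with
  | nil =>
    obtain rfl : q = [] := List.eq_nil_of_length_eq_zero hq
    exact Run.whileNE_nil _ (by rfl)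
  | cons r rs ih =>
    obtain ⟨hr₁, hr₂⟩ := hr r List.mem_cons_self
    have hr' : ∀ r ∈ rs, (∀ x ∈ r, x ≠ .sep) ∧ r.length ≤ N :=
      fun y hy => hr y (List.mem_cons_of_mem _ hy)
    cases q with
    | nil => simp at hq
    | cons y q =>
      have hq' : q.length = rs.length := by simpa using hq
      have hskip := run_skipRow r (flat rs) { s with kp := p, kp2 := [], kr := q, res := o } hr₁
      have ho := ih q o hr' hq'
      have hT : 2 + (1 + (2 * r.length + 1)) + (rs.length * (6 * N + 6) + 1) ≤
          (r :: rs).length * (6 * N + 6) + 1 := by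
        simp only [List.length_cons]
        nlinarith
      cases y with
      | sep => exact (Run.whileNE_cons (by exact flat_ne_nil) (Run.case hskip) ho).mono hT
      | entry c => exact (Run.whileNE_cons (by exact flat_ne_nil) (Run.case hskip) ho).mono hT
      | bit d =>
        have h₁ := run_writeRow r (flat rs) p [] o { s with kr := q } hr₁
        have h₂ := run_mv (a := .kp2) (b := .kp) (by decide)
          { s with inp := flat rs, kp := p.drop r.length, kp2 := (p.take r.length).reverse ++ [],
                   kr := q, res := .sep :: ((selectRow p r).reverse ++ o) }
        have h₃ := ih q (.sep :: ((selectRow p r).reverse ++ o)) hr' hq'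
        simp only [Sto.fn, Sto.set, List.append_nil, List.reverse_reverse, List.take_append_drop,
          List.length_reverse] at h₁ h₂
        have e : (flat (selectRows p (.bit d :: q) (r :: rs))).reverse ++ o =
            (flat (selectRows p q rs)).reverse ++ .sep :: ((selectRow p r).reverse ++ o) := by
          simp [selectRows, isKeep, flat]
        rw [e]
        refine (Run.whileNE_cons (by exact flat_ne_nil)
          (Run.case (h₁.seq ((Run.push _ _ _).seq h₂))) h₃).mono ?_
        have : (p.take r.length).length ≤ r.length := List.length_take_le _ _
        simp only [List.length_cons]
        nlinarith

/-! ### The whole program -/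

/-- Repeat a program a fixed number of times. -/
def times (c : Cmd Stk Symbol) : ℕ → Cmd Stk Symbol
  | 0 => .skip
  | n + 1 => c ;; times c n

theorem run_times_push (n : ℕ) (b : List Symbol) (s : Sto) :
    Run (times (.push .bits tok) n) { s with bits := b }
      { s with bits := List.replicate n tok ++ b } (n + 1) := by
  induction n generalizing b with
  | zero => exact Run.skip _
  | succ n ih =>
    have := ih (tok :: b)
    have e : List.replicate (n + 1) tok ++ b = List.replicate n tok ++ tok :: b := by
      rw [List.replicate_succ']; simp
    rw [e]
    exact ((Run.push _ _ _).seq this).mono (by omega)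

/-- The kernelization program. -/
def kernelProgram : Cmd Stk Symbol :=
  headerLoop ;; .push .res .sep ;; times (.push .bits tok) 9 ;; .push .unit mark ;; markAll ;;
  mv .aux .inp ;; clear .unit ;; rankAll ;; mv .mat .inp ;; keepAll ;; clear .bits ;;
  clear .cls ;; writeAll ;; clear .kp ;; mv .res .out

/-- The matrix that the program works with. -/
def marked (rs : List (List Symbol)) : List (List Symbol) := markRows [mark] rs

/-- The flags that tell which rows are kept; `L` is the number of bits of the bend bound. -/
def keepFlags (L : ℕ) (rs : List (List Symbol)) : List Symbol :=
  (ranks rs).map (keepSym (L + 9) ((ranks rs).count 0))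

theorem length_markZip (u r : List Symbol) : (markZip u r).length = r.length := by
  induction r generalizing u with
  | nil => cases u <;> rfl
  | cons x r ih => cases u <;> simp [markZip, ih]

theorem markZip_ne_sep {u r : List Symbol} (h : ∀ x ∈ r, x ≠ .sep) : ∀ x ∈ markZip u r, x ≠ .sep := by
  induction r generalizing u with
  | nil => cases u <;> simp [markZip]
  | cons x r ih =>
    have hx := h x List.mem_cons_self
    have hr : ∀ x ∈ r, x ≠ .sep := fun y hy => h y (List.mem_cons_of_mem _ hy)
    cases u with
    | nil =>
      intro z hz
      simp only [markZip, List.mem_cons] at hz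
      rcases hz with rfl | hz
      · exact hx
      · exact ih hr z hz
    | cons y u =>
      intro z hz
      simp only [markZip, List.mem_cons] at hz
      rcases hz with rfl | hz
      · unfold markSym
        split
        · simp [mark]
        · exact hx
      · exact ih hr z hz

theorem markRows_mem {N : ℕ} {u : List Symbol} {rs : List (List Symbol)}
    (hr : ∀ r ∈ rs, (∀ x ∈ r, x ≠ .sep) ∧ r.length ≤ N) :
    ∀ r ∈ markRows u rs, (∀ x ∈ r, x ≠ .sep) ∧ r.length ≤ N := by
  induction rs generalizing u with
  | nil => simp [markRows]
  | cons r rs ih =>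
    intro z hz
    simp only [markRows, List.mem_cons] at hz
    rcases hz with rfl | hz
    · obtain ⟨h₁, h₂⟩ := hr r List.mem_cons_self
      exact ⟨markZip_ne_sep h₁, by rwa [length_markZip]⟩
    · exact ih (fun y hy => hr y (List.mem_cons_of_mem _ hy)) z hz

theorem length_markRows (u : List Symbol) (rs : List (List Symbol)) :
    (markRows u rs).length = rs.length := by
  induction rs generalizing u with
  | nil => rfl
  | cons r rs ih => simp [markRows, ih]

theorem length_ranks (rs : List (List Symbol)) : (ranks rs).length = rs.length := by
  induction rs with
  | nil => rfl
  | cons r rs ih => simp [ranks, ih]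

theorem cnt_le (r : List Symbol) (rs : List (List Symbol)) : cnt r rs ≤ rs.length := by
  induction rs with
  | nil => simp [cnt]
  | cons r' rs ih =>
    simp only [cnt, List.length_cons]
    split_ifs <;> omega

theorem ranks_le (rs : List (List Symbol)) : ∀ n ∈ ranks rs, n ≤ rs.length := by
  induction rs with
  | nil => simp [ranks]
  | cons r rs ih =>
    intro n hn
    simp only [ranks, List.mem_cons] at hn
    simp only [List.length_cons]
    rcases hn with rfl | hn
    · exact (cnt_le r rs).trans (by omega)
    · exact (ih n hn).trans (by omega)

theorem length_selectRow_le (p r : List Symbol) : (selectRow p r).length ≤ r.length := by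
  induction r generalizing p with
  | nil => cases p <;> simp [selectRow]
  | cons x r ih =>
    cases p with
    | nil => simp [selectRow]
    | cons y p =>
      have := ih p
      simp only [selectRow, List.length_cons]
      split_ifs
      · simpa using this
      · omega

theorem length_flat_selectRows_le (p q : List Symbol) (rs : List (List Symbol)) :
    (flat (selectRows p q rs)).length ≤ (flat rs).length := by
  induction rs generalizing q with
  | nil => cases q <;> simp [selectRows]
  | cons r rs ih =>
    cases q with
    | nil => simp [selectRows, flat]
    | cons y q =>
      have h₁ := ih q
      have h₂ := length_selectRow_le p r
      simp only [selectRows, flat, List.length_append, List.length_cons]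
      split_ifs
      · simp only [flat, List.length_append, List.length_cons]; omega
      · omega

/-- A bound on the running time of the program on inputs of length `N`. -/
noncomputable def kernelTime : Polynomial ℕ := 200 * (Polynomial.X + 1) ^ 3

/-- The cubic term comes from the ranks: each row is compared with every later row, symbol by
symbol. The remaining phases cost at most quadratic time, apart from the halving of ranks, which
takes up to N + 9 linear passes for each of up to N ranks. -/
theorem run_kernelProgram (N : ℕ) (l : List Symbol) (rs : List (List Symbol))
    (hl : ∀ x ∈ l, x ≠ .sep) (hr : ∀ r ∈ rs, (∀ x ∈ r, x ≠ .sep) ∧ r.length ≤ N)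
    (hN : rs.length ≤ N) (hlN : l.length ≤ N) :
    Run kernelProgram { Sto.nil with inp := l ++ .sep :: flat rs }
      { Sto.nil with out := l ++ .sep :: flat (selectRows (keepFlags l.length (marked rs))
          (keepFlags l.length (marked rs)) (marked rs)) } (200 * (N + 1) ^ 3) := by
  have hM : ∀ r ∈ marked rs, (∀ x ∈ r, x ≠ .sep) ∧ r.length ≤ N := markRows_mem hr
  have hMl : (marked rs).length = rs.length := length_markRows _ _
  have hfl := flat_length_le N (marked rs) (fun y hy => (hM y hy).2)
  have h₁ := run_headerLoop l (flat rs) [] [] Sto.nil hl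
  -- Nine additional symbols on `bits` provide the factor 2 ^ 9 = 512 in the number of twins kept
  -- per class.
  have h₂ := run_times_push 9 l.reverse { Sto.nil with inp := flat rs, res := .sep :: l.reverse }
  have h₃ := run_markAll N rs [mark] []
    { Sto.nil with bits := List.replicate 9 tok ++ l.reverse, res := .sep :: l.reverse } hr
  have h₄ := run_mv (a := .aux) (b := .inp) (by decide)
    { Sto.nil with bits := List.replicate 9 tok ++ l.reverse, res := .sep :: l.reverse,
                   unit := List.replicate rs.length tok ++ [mark],
                   aux := (flat (marked rs)).reverse }
  have h₅ := run_clear .unit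
    { Sto.nil with bits := List.replicate 9 tok ++ l.reverse, res := .sep :: l.reverse,
                   unit := List.replicate rs.length tok ++ [mark], inp := flat (marked rs) }
  have h₆ := run_rankAll N (marked rs) [] [] []
    { Sto.nil with bits := List.replicate 9 tok ++ l.reverse, res := .sep :: l.reverse } hM
    (by omega)
  have h₇ := run_mv (a := .mat) (b := .inp) (by decide)
    { Sto.nil with bits := List.replicate 9 tok ++ l.reverse, res := .sep :: l.reverse,
                   rk := unary (ranks (marked rs)).reverse,
                   cls := List.replicate ((ranks (marked rs)).count 0) tok,
                   mat := (flat (marked rs)).reverse }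
  have h₈ := run_keepAll N (ranks (marked rs)).reverse (List.replicate 9 tok ++ l.reverse)
    (List.replicate ((ranks (marked rs)).count 0) tok) [] []
    { Sto.nil with res := .sep :: l.reverse, inp := flat (marked rs) }
    (fun n hn => ((ranks_le _ n (by simpa using hn)).trans (by omega)))
  have ek : ((ranks (marked rs)).reverse.map (keepSym (List.replicate 9 tok ++ l.reverse).length
      (List.replicate ((ranks (marked rs)).count 0) tok).length)).reverse =
      keepFlags l.length (marked rs) := by
    rw [List.map_reverse, List.reverse_reverse]
    simp only [keepFlags, List.length_append, List.length_replicate, List.length_reverse]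
    rw [add_comm 9]
  rw [ek] at h₈
  have h₉ := run_clear .bits
    { Sto.nil with bits := List.replicate 9 tok ++ l.reverse, res := .sep :: l.reverse,
                   cls := List.replicate ((ranks (marked rs)).count 0) tok,
                   inp := flat (marked rs), kp := keepFlags l.length (marked rs),
                   kr := keepFlags l.length (marked rs) }
  have h₁₀ := run_clear .cls
    { Sto.nil with res := .sep :: l.reverse,
                   cls := List.replicate ((ranks (marked rs)).count 0) tok,
                   inp := flat (marked rs), kp := keepFlags l.length (marked rs),
                   kr := keepFlags l.length (marked rs) }
  have hkl : (keepFlags l.length (marked rs)).length = (marked rs).length := by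
    simp [keepFlags, length_ranks]
  have h₁₁ := run_writeAll N (marked rs) (keepFlags l.length (marked rs))
    (keepFlags l.length (marked rs)) (.sep :: l.reverse) Sto.nil hM hkl
  have h₁₂ := run_clear .kp
    { Sto.nil with res := (flat (selectRows (keepFlags l.length (marked rs))
                     (keepFlags l.length (marked rs)) (marked rs))).reverse ++ .sep :: l.reverse,
                   kp := keepFlags l.length (marked rs) }
  have h₁₃ := run_mv (a := .res) (b := .out) (by decide)
    { Sto.nil with res := (flat (selectRows (keepFlags l.length (marked rs))
                     (keepFlags l.length (marked rs)) (marked rs))).reverse ++ .sep :: l.reverse }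
  have hsel := length_flat_selectRows_le (keepFlags l.length (marked rs))
    (keepFlags l.length (marked rs)) (marked rs)
  have hcount : (ranks (marked rs)).count 0 ≤ rs.length := by
    have := List.count_le_length (a := 0) (l := ranks (marked rs))
    rwa [length_ranks, hMl] at this
  have hrank : (ranks (marked rs)).length = rs.length := by rw [length_ranks, hMl]
  simp only [Sto.fn, Sto.set, Sto.nil, List.append_nil, List.reverse_reverse, List.length_reverse,
    List.reverse_append, List.reverse_cons, List.append_assoc, List.singleton_append,
    List.length_append, List.length_cons, List.length_nil, List.length_replicate]
    at h₁ h₂ h₃ h₄ h₅ h₆ h₇ h₈ h₉ h₁₀ h₁₁ h₁₂ h₁₃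
  refine (h₁.seq ((Run.push _ _ _).seq (h₂.seq ((Run.push _ _ _).seq (h₃.seq (h₄.seq (h₅.seq
    (h₆.seq (h₇.seq (h₈.seq (h₉.seq (h₁₀.seq (h₁₁.seq (h₁₂.seq h₁₃)))))))))))))).mono ?_
  rw [hMl] at hfl
  rw [hrank, hMl, hkl, hMl]
  generalize (flat (marked rs)).length = F at *
  generalize (flat (selectRows (keepFlags l.length (marked rs))
    (keepFlags l.length (marked rs)) (marked rs))).length = S at *
  generalize (ranks (marked rs)).count 0 = c at *
  generalize rs.length = n at *
  generalize l.length = L at *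
  have hF : F ≤ N * (N + 1) := hfl.trans (Nat.mul_le_mul hN le_rfl)
  have a₁ : n * (6 * N + 6) ≤ N * (6 * N + 6) := Nat.mul_le_mul hN le_rfl
  have a₂ : n * (11 * N * N + 20 * N + 20) ≤ N * (11 * N * N + 20 * N + 20) :=
    Nat.mul_le_mul hN le_rfl
  have a₃ : n * ((9 + L) * (3 * N + 7) + 6 * c + 4 * N + 20) ≤
      N * ((9 + N) * (3 * N + 7) + 6 * N + 4 * N + 20) := by
    have : c ≤ N := hcount.trans hN
    gcongr
  nlinarith

end StackProgram

/-! ## The kernel -/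

section TwinClasses

variable {n : ℕ} (G : SimpleGraph (Fin n))

/-- Twins: vertices with the same neighbors, apart from each other. -/
def SimpleGraph.Twin {V : Type} (G : SimpleGraph V) (a b : V) : Prop :=
  ∀ c, c ≠ a → c ≠ b → (G.Adj a c ↔ G.Adj b c)

open Classical in
/-- The number of later twins of a vertex. -/
noncomputable def SimpleGraph.twinRank (i : Fin n) : ℕ :=
  (Finset.univ.filter fun j : Fin n => i < j ∧ G.Twin j i).card

open Classical in
/-- The number of vertices without later twins. -/
noncomputable def SimpleGraph.numTwinClasses : ℕ :=
  (Finset.univ.filter fun i : Fin n => G.twinRank i = 0).card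

open Classical in
/-- The vertices with few later twins. -/
noncomputable def SimpleGraph.keptList (L : ℕ) : List (Fin n) :=
  (List.finRange n).filter fun i => decide (G.twinRank i / 2 ^ (L + 9) ≤ G.numTwinClasses)

theorem SimpleGraph.mem_keptList {L : ℕ} {i : Fin n} :
    i ∈ G.keptList L ↔ G.twinRank i / 2 ^ (L + 9) ≤ G.numTwinClasses := by
  classical
  simp [SimpleGraph.keptList]

theorem SimpleGraph.nodup_keptList (L : ℕ) : (G.keptList L).Nodup :=
  (List.nodup_finRange n).filter _

theorem SimpleGraph.keptList_length_pos (hn : 0 < n) (L : ℕ) : 0 < (G.keptList L).length := by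
  classical
  rw [List.length_pos_iff_exists_mem]
  -- The last vertex has no later twin at all.
  refine ⟨⟨n - 1, by omega⟩, G.mem_keptList.2 ?_⟩
  have : G.twinRank ⟨n - 1, by omega⟩ = 0 := by
    rw [SimpleGraph.twinRank, Finset.card_eq_zero, Finset.filter_eq_empty_iff]
    rintro j - ⟨h, -⟩
    rw [Fin.lt_def] at h
    have := j.2
    simp only at h
    omega
  rw [this]
  simp

end TwinClasses

namespace BRACInstance

/-- The number of bits of the bend bound. -/
def bitLength (I : BRACInstance) : ℕ := (Computability.encodeNat I.budget).length

/-- The vertices that the kernelization keeps. -/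
noncomputable def kept (I : BRACInstance) : List (Fin I.order) := I.graph.keptList I.bitLength

/-- The kernel: the subinstance on the vertices that are kept. -/
noncomputable def kernel (I : BRACInstance) : BRACInstance where
  order := I.kept.length
  order_pos := I.graph.keptList_length_pos I.order_pos _
  graph := I.graph.comap I.kept.get
  budget := I.budget
  label := fun e => I.label ⟨Sym2.map I.kept.get e, by
    obtain ⟨e, he⟩ := e
    induction e using Sym2.ind with
    | _ a b => simpa using he⟩

theorem matrixEntry_self (I : BRACInstance) (i : Fin I.order) : I.matrixEntry i i = none := by
  simp [matrixEntry]

theorem matrixEntry_eq_none (I : BRACInstance) (i j : Fin I.order) :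
    I.matrixEntry i j = none ↔ ¬ I.graph.Adj i j := by
  unfold matrixEntry
  split_ifs with h <;> simp [h]

/-- The rows of the matrix of an instance. -/
noncomputable def rows (I : BRACInstance) : List (List Symbol) :=
  List.ofFn fun i : Fin I.order => List.ofFn fun j : Fin I.order => Symbol.entry (I.matrixEntry i j)

end BRACInstance

namespace StackProgram

open BRACInstance (Symbol)

noncomputable instance : Fintype Symbol := by
  classical
  exact Fintype.ofSurjective
    (fun x : Bool ⊕ Option (Fin 4) ⊕ Unit => match x with
      | .inl d => Symbol.bit d
      | .inr (.inl c) => Symbol.entry c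
      | .inr (.inr _) => Symbol.sep)
    (fun s => match s with
      | .bit d => ⟨.inl d, rfl⟩
      | .entry c => ⟨.inr (.inl c), rfl⟩
      | .sep => ⟨.inr (.inr ()), rfl⟩)

/-! ### What the list operations of the program mean for the matrix of an instance. -/

theorem flat_eq_flatten (rs : List (List Symbol)) :
    flat rs = (rs.map fun r => r ++ [Symbol.sep]).flatten := by
  induction rs with
  | nil => rfl
  | cons r rs ih => simp [flat, ih]

theorem encode_eq (I : BRACInstance) :
    I.encode = (Computability.encodeNat I.budget).map Symbol.bit ++ Symbol.sep :: flat I.rows := by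
  rw [flat_eq_flatten, BRACInstance.rows, List.map_ofFn]
  rfl

theorem rows_kernel (I : BRACInstance) : I.kernel.rows =
    I.kept.map fun i => I.kept.map fun j => Symbol.entry (I.matrixEntry i j) := by
  have h (f : Fin I.order → List Symbol) :
      (List.ofFn fun a : Fin I.kernel.order => f (I.kept.get a)) = I.kept.map f :=
    List.map_ofFn.symm.trans (congrArg (List.map f) (List.ofFn_get I.kept))
  have h' (f : Fin I.order → Symbol) :
      (List.ofFn fun a : Fin I.kernel.order => f (I.kept.get a)) = I.kept.map f :=
    List.map_ofFn.symm.trans (congrArg (List.map f) (List.ofFn_get I.kept))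
  rw [← h]
  unfold BRACInstance.rows
  congr 1
  funext a
  rw [← h']
  congr 1

theorem getElem_markZip_nil (r : List Symbol) : markZip [] r = r := by
  induction r with
  | nil => rfl
  | cons x r ih => simp [markZip, ih]

theorem markZip_ofFn {n : ℕ} (i : ℕ) (f : Fin n → Symbol) :
    markZip (List.replicate i tok ++ [mark]) (List.ofFn f) =
      List.ofFn fun j : Fin n => if i = j then mark else f j := by
  induction n generalizing i with
  | zero => cases i <;> rfl
  | succ n ih =>
    rw [List.ofFn_succ, List.ofFn_succ]
    cases i with
    | zero => simp [markZip, getElem_markZip_nil, markSym, mark]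
    | succ i =>
      simp only [List.replicate_succ, List.cons_append, markZip, ih i]
      simp [markSym, tok]

theorem markRows_ofFn {m n : ℕ} (i : ℕ) (f : Fin m → Fin n → Symbol) :
    markRows (List.replicate i tok ++ [mark]) (List.ofFn fun a => List.ofFn (f a)) =
      List.ofFn fun a : Fin m => List.ofFn fun j : Fin n => if i + a = j then mark else f a j := by
  induction m generalizing i with
  | zero => rfl
  | succ m ih =>
    rw [List.ofFn_succ, List.ofFn_succ, markRows, markZip_ofFn]
    have := ih (i + 1) (fun a => f a.succ)
    rw [List.replicate_succ, List.cons_append] at this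
    rw [this]
    simp only [Fin.val_zero, add_zero, Fin.val_succ]
    congr! 7
    omega

theorem mism_eq_zero {n : ℕ} (f g : Fin n → Symbol) :
    mism (List.ofFn f) (List.ofFn g) = 0 ↔ ∀ j, agree (f j) (g j) = true := by
  induction n with
  | zero => simp [mism]
  | succ n ih =>
    rw [List.ofFn_succ, List.ofFn_succ, mism, Fin.forall_fin_succ, Nat.add_eq_zero_iff, ih]
    split_ifs with h <;> simp [h]

theorem cnt_ofFn {n : ℕ} (r : List Symbol) (R : Fin n → List Symbol) :
    cnt r (List.ofFn R) = (Finset.univ.filter fun j => mism (R j) r = 0).card := by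
  induction n with
  | zero => simp [cnt]
  | succ n ih =>
    rw [List.ofFn_succ, cnt, ih, Fin.card_filter_univ_succ', add_comm]

theorem ranks_ofFn {n : ℕ} (R : Fin n → List Symbol) :
    ranks (List.ofFn R) = List.ofFn fun i =>
      (Finset.univ.filter fun j => i < j ∧ mism (R j) (R i) = 0).card := by
  induction n with
  | zero => rfl
  | succ n ih =>
    rw [List.ofFn_succ, List.ofFn_succ, ranks, ih, cnt_ofFn]
    congr 1
    · rw [Fin.card_filter_univ_succ']
      simp
    · congr 1
      funext i
      rw [Fin.card_filter_univ_succ']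
      simp

theorem count_ofFn {n : ℕ} (f : Fin n → ℕ) :
    (List.ofFn f).count 0 = (Finset.univ.filter fun i => f i = 0).card := by
  induction n with
  | zero => simp
  | succ n ih =>
    rw [List.ofFn_succ, List.count_cons, ih, Fin.card_filter_univ_succ', add_comm]
    simp

theorem selectRow_map {α : Type} (l : List α) (k f : α → Symbol) :
    selectRow (l.map k) (l.map f) = (l.filter fun a => isKeep (k a)).map fun a => unmark (f a) := by
  induction l with
  | nil => rfl
  | cons a l ih =>
    simp only [List.map_cons, selectRow, ih, List.filter_cons]
    split_ifs <;> simp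

theorem selectRows_map {α : Type} (l : List α) (p : List Symbol) (k : α → Symbol)
    (R : α → List Symbol) :
    selectRows p (l.map k) (l.map R) =
      (l.filter fun a => isKeep (k a)).map fun a => selectRow p (R a) := by
  induction l with
  | nil => rfl
  | cons a l ih =>
    simp only [List.map_cons, selectRows, ih, List.filter_cons]
    split_ifs <;> simp

theorem marked_rows (I : BRACInstance) : marked I.rows = List.ofFn fun i : Fin I.order =>
    List.ofFn fun j : Fin I.order => if i = j then mark else Symbol.entry (I.matrixEntry i j) := by
  have := markRows_ofFn 0 fun i j : Fin I.order => Symbol.entry (I.matrixEntry i j)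
  simp only [zero_add, List.replicate_zero, List.nil_append, Fin.val_inj] at this
  exact this

/-- Marks act as wildcards: rows i and j carry marks in columns i and j respectively, so comparing
them skips exactly the two columns that twins may disagree in. Elsewhere `agree` only asks whether
both entries are edges or both are not, whatever their labels. -/
theorem ranks_marked (I : BRACInstance) : ranks (marked I.rows) = List.ofFn I.graph.twinRank := by
  classical
  rw [marked_rows, ranks_ofFn]
  congr 1
  funext i
  unfold SimpleGraph.twinRank
  congr 1
  ext j
  simp only [Finset.mem_filter, Finset.mem_univ, true_and, mism_eq_zero]
  refine and_congr_right fun hij => forall_congr' fun k => ?_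
  by_cases hj : j = k
  · subst hj; simp [agree, mark]
  by_cases hi : i = k
  · subst hi
    simp [hj, agree, mark]
  have h₁ := I.matrixEntry_eq_none i k
  have h₂ := I.matrixEntry_eq_none j k
  rw [if_neg hj, if_neg hi, ← not_iff_not (a := I.graph.Adj j k), ← h₁, ← h₂]
  cases I.matrixEntry i k <;> cases I.matrixEntry j k <;> simp [agree, Ne.symm hi, Ne.symm hj]

theorem keepFlags_marked (I : BRACInstance) : keepFlags I.bitLength (marked I.rows) =
    (List.finRange I.order).map fun i =>
      keepSym (I.bitLength + 9) I.graph.numTwinClasses (I.graph.twinRank i) := by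
  classical
  rw [keepFlags, ranks_marked, count_ofFn, List.ofFn_eq_map, List.map_map]
  unfold SimpleGraph.numTwinClasses
  congr! 4

/-- The only entries changed by marking are on the diagonal, and unmarking returns them to `none`,
the value that a loopless graph has there. -/
theorem selectRows_marked (I : BRACInstance) :
    selectRows (keepFlags I.bitLength (marked I.rows)) (keepFlags I.bitLength (marked I.rows))
      (marked I.rows) = I.kernel.rows := by
  have hk : (List.finRange I.order).filter (fun i => isKeep
      (keepSym (I.bitLength + 9) I.graph.numTwinClasses (I.graph.twinRank i))) = I.kept := by
    unfold BRACInstance.kept SimpleGraph.keptList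
    congr 1
    funext i
    unfold keepSym
    split_ifs with h <;> simp [isKeep, tok, h]
  rw [keepFlags_marked, marked_rows, rows_kernel, List.ofFn_eq_map, selectRows_map, hk]
  refine List.map_congr_left fun i _ => ?_
  rw [List.ofFn_eq_map, selectRow_map, hk]
  refine List.map_congr_left fun j _ => ?_
  split_ifs with h
  · subst h
    rw [I.matrixEntry_self]
    rfl
  · rfl

theorem length_flat_ge {n : ℕ} (R : Fin n → List Symbol) : n ≤ (flat (List.ofFn R)).length := by
  induction n with
  | zero => simp
  | succ n ih =>
    have := ih fun i => R i.succ
    rw [List.ofFn_succ, flat, List.length_append, List.length_cons]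
    omega

/-- The kernel is computable in polynomial time. -/
theorem kernel_polyTime : Nonempty (Turing.TM2ComputableInPolyTime BRACInstance.encode
    BRACInstance.encode BRACInstance.kernel) := by
  -- The number and the length of the rows, and the number of bits of the bend bound, are all at
  -- most the input length, so this length can play the role of N.
  refine polyTime_of_within _ _ _ kernelProgram .inp .out kernelTime fun I => ?_
  have hlen : (flat I.rows).length ≤ I.encode.length := by
    rw [encode_eq]; simp only [List.length_append, List.length_cons]; omega
  have hord : I.order ≤ (flat I.rows).length :=
    length_flat_ge _
  have h := run_kernelProgram I.encode.length ((Computability.encodeNat I.budget).map Symbol.bit)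
    I.rows (by simp only [List.mem_map]; rintro x ⟨d, -, rfl⟩; simp) (fun r hr => by
      simp only [BRACInstance.rows, List.mem_ofFn] at hr
      obtain ⟨i, rfl⟩ := hr
      refine ⟨fun x hx => ?_, ?_⟩
      · simp only [List.mem_ofFn] at hx
        obtain ⟨j, rfl⟩ := hx
        simp
      · rw [List.length_ofFn]; omega)
    (by rw [BRACInstance.rows, List.length_ofFn]; omega)
    (by rw [encode_eq]; simp only [List.length_append]; omega)
  have hL : ((Computability.encodeNat I.budget).map Symbol.bit).length = I.bitLength := by
    rw [List.length_map]; rfl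
  rw [hL, selectRows_marked, ← encode_eq] at h
  have hb : (Computability.encodeNat I.budget).map Symbol.bit ++ Symbol.sep :: flat I.kernel.rows =
      I.kernel.encode := (encode_eq I.kernel).symm
  rw [hb] at h
  have e (k : Stk) (v : List Symbol) :
      Function.update (fun _ => []) k v = (Sto.nil.set k v).fn := by
    rw [← Sto.update_fn]
    congr 1
    funext j
    cases j <;> rfl
  rw [e, e]
  refine Run.mono h ?_
  simp [kernelTime]

end StackProgram

/-! ## Plane geometry -/

namespace Plane

/-- The orientation determinant of three points. -/
def cr (a b c : Plane) : ℝ := (b 0 - a 0) * (c 1 - a 1) - (b 1 - a 1) * (c 0 - a 0)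

/-- The point that divides a segment in a given ratio. -/
noncomputable def pt (a b : Plane) (t : ℝ) : Plane := AffineMap.lineMap a b t

@[simp]
theorem pt_apply (a b : Plane) (t : ℝ) (i : Fin 2) : pt a b t i = a i + t * (b i - a i) := by
  simp [pt, AffineMap.lineMap_apply]
  ring

theorem ext_iff' {p q : Plane} : p = q ↔ p 0 = q 0 ∧ p 1 = q 1 := by
  constructor
  · rintro rfl; exact ⟨rfl, rfl⟩
  · rintro ⟨h₀, h₁⟩
    ext i
    fin_cases i
    · exact h₀
    · exact h₁

theorem inner_eq (p q : Plane) : inner ℝ p q = p 0 * q 0 + p 1 * q 1 := by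
  simp [PiLp.inner_apply, Fin.sum_univ_two, mul_comm]

theorem inner_sub_eq (a b c d : Plane) :
    inner ℝ (a - b) (c - d) = (a 0 - b 0) * (c 0 - d 0) + (a 1 - b 1) * (c 1 - d 1) := by
  rw [inner_eq]; rfl

theorem mem_segment_iff {a b p : Plane} : p ∈ segment ℝ a b ↔ ∃ t, 0 ≤ t ∧ t ≤ 1 ∧ pt a b t = p := by
  rw [segment_eq_image_lineMap]
  simp [pt, and_assoc]

theorem mem_openSegment_iff {a b p : Plane} :
    p ∈ openSegment ℝ a b ↔ ∃ t, 0 < t ∧ t < 1 ∧ pt a b t = p := by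
  rw [openSegment_eq_image_lineMap]
  simp [pt, and_assoc]

theorem pt_mem_openSegment (a b : Plane) {t : ℝ} (h₀ : 0 < t) (h₁ : t < 1) :
    pt a b t ∈ openSegment ℝ a b := mem_openSegment_iff.2 ⟨t, h₀, h₁, rfl⟩

theorem ne_of_sq_pos {p q : Plane} (h : p ≠ q) : 0 < (p 0 - q 0) ^ 2 + (p 1 - q 1) ^ 2 := by
  by_contra hle
  apply h
  rw [ext_iff']
  constructor <;> nlinarith [sq_nonneg (p 0 - q 0), sq_nonneg (p 1 - q 1)]

/-! ### Two points joined to two further points by segments that do not cross. -/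

/-- Segments from two points to the vertices of an edge on one side of them: if the line of the
edge does not separate the two points, then two of the segments meet. -/
theorem exists_crossing {x y w v : Plane} (hD : 0 < cr x y w * cr x y v)
    (hA : 0 ≤ cr x w v * cr y w v) :
    (∃ t s, 0 < t ∧ t ≤ 1 ∧ 0 < s ∧ s ≤ 1 ∧ pt x w t = pt y v s) ∨
    (∃ t s, 0 < t ∧ t ≤ 1 ∧ 0 < s ∧ s ≤ 1 ∧ pt x v t = pt y w s) := by
  have hsum : cr y w v + cr x y v = cr x w v + cr x y w := by unfold cr; ring
  have h0 : cr y w v * x 0 + cr x y v * w 0 = cr x w v * y 0 + cr x y w * v 0 := by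
    unfold cr; ring
  have h1 : cr y w v * x 1 + cr x y v * w 1 = cr x w v * y 1 + cr x y w * v 1 := by
    unfold cr; ring
  generalize cr y w v = A₂ at *
  generalize cr x w v = A₁ at *
  generalize cr x y w = D at *
  generalize cr x y v = D' at *
  -- The determinants are the coefficients of the affine dependence of the four points. If all
  -- weights are nonnegative and both sides have positive total weight, dividing by it exhibits a
  -- common point of the two segments. The cases below exchange `w` and `v` and flip signs to reach
  -- this situation.
  have hside : ∀ A₁ A₂ D D' : ℝ, 0 ≤ A₁ → 0 ≤ A₂ → 0 < D → 0 < D' → A₂ + D' = A₁ + D →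
      ∀ w v : Plane, A₂ * x 0 + D' * w 0 = A₁ * y 0 + D * v 0 →
      A₂ * x 1 + D' * w 1 = A₁ * y 1 + D * v 1 →
      ∃ t s, 0 < t ∧ t ≤ 1 ∧ 0 < s ∧ s ≤ 1 ∧ pt x w t = pt y v s := by
    intro A₁ A₂ D D' hA₁ hA₂ hD hD' hsum w v h0 h1
    have hp : 0 < A₂ + D' := by linarith
    refine ⟨D' / (A₂ + D'), D / (A₂ + D'), by positivity, ?_, by positivity, ?_, ?_⟩
    · rw [div_le_one hp]; linarith
    · rw [div_le_one hp]; linarith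
    · rw [ext_iff', pt_apply, pt_apply, pt_apply, pt_apply]
      constructor
      · field_simp
        linear_combination h0 - y 0 * hsum
      · field_simp
        linear_combination h1 - y 1 * hsum
  rcases le_or_gt D 0 with hD0 | hD0
  · have hDn : D < 0 := lt_of_le_of_ne hD0 (by rintro rfl; simp at hD)
    have hDn' : D' < 0 := by nlinarith
    rcases le_total 0 A₁ with h | h
    · rcases le_or_gt 0 A₂ with h' | h'
      · right
        exact hside A₁ A₂ (-D') (-D) h h' (by linarith) (by linarith) (by linarith) v w
          (by linarith) (by linarith)
      · left
        have : A₁ ≤ 0 := by nlinarith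
        exact hside (-A₁) (-A₂) (-D) (-D') (by linarith) (by linarith) (by linarith) (by linarith)
          (by linarith) w v (by linarith) (by linarith)
    · rcases le_or_gt A₂ 0 with h' | h'
      · left
        exact hside (-A₁) (-A₂) (-D) (-D') (by linarith) (by linarith) (by linarith) (by linarith)
          (by linarith) w v (by linarith) (by linarith)
      · right
        have : 0 ≤ A₁ := by nlinarith
        exact hside A₁ A₂ (-D') (-D) this h'.le (by linarith) (by linarith) (by linarith) v w
          (by linarith) (by linarith)
  · have hDn' : 0 < D' := by nlinarith
    rcases le_total 0 A₁ with h | h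
    · rcases le_or_gt 0 A₂ with h' | h'
      · left
        exact hside A₁ A₂ D D' h h' hD0 hDn' hsum w v h0 h1
      · right
        have : A₁ ≤ 0 := by nlinarith
        exact hside (-A₁) (-A₂) D' D (by linarith) (by linarith) (by linarith) (by linarith)
          (by linarith) v w (by linarith) (by linarith)
    · rcases le_or_gt A₂ 0 with h' | h'
      · right
        exact hside (-A₁) (-A₂) D' D (by linarith) (by linarith) (by linarith) (by linarith)
          (by linarith) v w (by linarith) (by linarith)
      · left
        have : 0 ≤ A₁ := by nlinarith
        exact hside A₁ A₂ D D' this h'.le hD0 hDn' hsum w v h0 h1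

/-- Points on the line through `x` and `y` are parametrized by the line. -/
theorem exists_pt_of_cr_eq_zero {x y w : Plane} (hxy : x ≠ y) (h : cr x y w = 0) :
    ∃ t, w = pt x y t := by
  have hpos := ne_of_sq_pos hxy.symm
  refine ⟨((w 0 - x 0) * (y 0 - x 0) + (w 1 - x 1) * (y 1 - x 1)) /
    ((y 0 - x 0) ^ 2 + (y 1 - x 1) ^ 2), ?_⟩
  rw [ext_iff', pt_apply, pt_apply]
  unfold cr at h
  constructor
  · field_simp
    linear_combination (-(y 1 - x 1)) * h
  · field_simp
    linear_combination (y 0 - x 0) * h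

theorem mem_openSegment_of_pt {a b x y : Plane} {s t r : ℝ} (ha : a = pt x y s) (hb : b = pt x y t)
    (h : (s < r ∧ r < t) ∨ (t < r ∧ r < s)) : pt x y r ∈ openSegment ℝ a b := by
  have hst : t - s ≠ 0 := by rcases h with h | h <;> intro h' <;> linarith
  rw [mem_openSegment_iff]
  refine ⟨(r - s) / (t - s), ?_, ?_, ?_⟩
  · rcases h with h | h
    · exact div_pos (by linarith) (by linarith)
    · exact div_pos_of_neg_of_neg (by linarith) (by linarith)
  · rcases h with h | h
    · rw [div_lt_one (by linarith)]; linarith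
    · rw [div_lt_one_of_neg (by linarith)]; linarith
  · subst ha hb
    rw [ext_iff']
    simp only [pt_apply]
    constructor
    · field_simp; ring
    · field_simp; ring

theorem pt_zero (x y : Plane) : pt x y 0 = x := by simp [pt]

theorem pt_one (x y : Plane) : pt x y 1 = y := by simp [pt]

/-- Two points on a line through `x` and `y` that see `x` and `y` without obstruction coincide. -/
theorem not_collinear_pair {x y w v : Plane} (hxy : x ≠ y) (hw : cr x y w = 0) (hv : cr x y v = 0)
    (hwv : w ≠ v) (hwx : w ≠ x) (hwy : w ≠ y) (hvx : v ≠ x) (hvy : v ≠ y)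
    (h₁ : x ∉ openSegment ℝ y w) (h₂ : y ∉ openSegment ℝ x w)
    (h₃ : x ∉ openSegment ℝ y v) (h₄ : y ∉ openSegment ℝ x v)
    (h₅ : w ∉ openSegment ℝ x v) (h₆ : v ∉ openSegment ℝ x w) : False := by
  obtain ⟨s, hs⟩ := exists_pt_of_cr_eq_zero hxy hw
  obtain ⟨t, ht⟩ := exists_pt_of_cr_eq_zero hxy hv
  have hx := (pt_zero x y).symm
  have hy := (pt_one x y).symm
  -- A point of the line outside the segment from `x` to `y` would see one of these two points only
  -- through the other. So both points lie strictly between `x` and `y`, and the nearer one to `x`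
  -- obstructs the other.
  have key : ∀ (w : Plane) (s : ℝ), w = pt x y s → w ≠ x → w ≠ y → x ∉ openSegment ℝ y w →
      y ∉ openSegment ℝ x w → 0 < s ∧ s < 1 := by
    intro w s hs hwx hwy h₁ h₂
    constructor
    · by_contra hle
      rcases eq_or_lt_of_le (not_lt.1 hle) with h | h
      · exact hwx (by rw [hs, h, pt_zero])
      · apply h₁
        have := mem_openSegment_of_pt (r := 0) hy hs (Or.inr ⟨h, by norm_num⟩)
        rwa [pt_zero] at this
    · by_contra hle
      rcases eq_or_lt_of_le (not_lt.1 hle) with h | h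
      · exact hwy (by rw [hs, ← h, pt_one])
      · apply h₂
        have := mem_openSegment_of_pt (r := 1) hx hs (Or.inl ⟨by norm_num, h⟩)
        rwa [pt_one] at this
  obtain ⟨hs₀, hs₁⟩ := key w s hs hwx hwy h₁ h₂
  obtain ⟨ht₀, ht₁⟩ := key v t ht hvx hvy h₃ h₄
  rcases lt_trichotomy s t with h | h | h
  · apply h₅
    have := mem_openSegment_of_pt (r := s) hx ht (Or.inl ⟨hs₀, h⟩)
    rwa [← hs] at this
  · exact hwv (by rw [hs, ht, h])
  · apply h₆
    have := mem_openSegment_of_pt (r := t) hx hs (Or.inl ⟨ht₀, h⟩)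
    rwa [← ht] at this

/-- If `w` and `v` lie on the same side of the line through `x` and `y`, and the segments from `x`
and `y` to `w` and `v` do not cross, then the line through `w` and `v` separates `x` and `y`. -/
theorem separated {x y w v : Plane} (hxy : x ≠ y)
    (hs : SignType.sign (cr x y w) = SignType.sign (cr x y v))
    (hwv : w ≠ v) (hwx : w ≠ x) (hwy : w ≠ y) (hvx : v ≠ x) (hvy : v ≠ y)
    (h₁ : x ∉ openSegment ℝ y w) (h₂ : y ∉ openSegment ℝ x w)
    (h₃ : x ∉ openSegment ℝ y v) (h₄ : y ∉ openSegment ℝ x v)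
    (h₅ : w ∉ openSegment ℝ x v) (h₆ : v ∉ openSegment ℝ x w)
    (h₇ : w ∉ openSegment ℝ y v) (h₈ : v ∉ openSegment ℝ y w)
    (h₉ : Disjoint (openSegment ℝ x w) (openSegment ℝ y v))
    (h₁₀ : Disjoint (openSegment ℝ x v) (openSegment ℝ y w)) :
    cr x w v * cr y w v < 0 := by
  -- Equal signs mean strictly the same side, or both points on the line. The second case is
  -- degenerate and excluded by `not_collinear_pair`.
  by_cases hD : 0 < cr x y w * cr x y v
  · by_contra hA
    have aux : ∀ w v : Plane, w ≠ v → w ∉ openSegment ℝ y v → v ∉ openSegment ℝ x w →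
        Disjoint (openSegment ℝ x w) (openSegment ℝ y v) → ∀ t s, 0 < t → t ≤ 1 → 0 < s →
        s ≤ 1 → pt x w t = pt y v s → False := by
      intro w v hwv hw hv hdis t s ht ht' hs hs' h
      rcases eq_or_lt_of_le ht' with rfl | ht'
      · rw [pt_one] at h
        rcases eq_or_lt_of_le hs' with rfl | hs'
        · rw [pt_one] at h; exact hwv h
        · exact hw (h ▸ pt_mem_openSegment y v hs hs')
      · rcases eq_or_lt_of_le hs' with rfl | hs'
        · rw [pt_one] at h; exact hv (h ▸ pt_mem_openSegment x w ht ht')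
        · exact Set.disjoint_left.1 hdis (pt_mem_openSegment x w ht ht')
            (h ▸ pt_mem_openSegment y v hs hs')
    rcases exists_crossing hD (not_lt.1 hA) with ⟨t, s, ht, ht', hs, hs', h⟩ |
      ⟨t, s, ht, ht', hs, hs', h⟩
    · exact aux w v hwv h₇ h₆ h₉ t s ht ht' hs hs' h
    · exact aux v w hwv.symm h₈ h₅ h₁₀ t s ht ht' hs hs' h
  · exfalso
    rcases lt_trichotomy (cr x y w) 0 with h | h | h
    · rw [sign_neg h, eq_comm, sign_eq_neg_one_iff] at hs
      exact hD (mul_pos_of_neg_of_neg h hs)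
    · rw [h, sign_zero, eq_comm, sign_eq_zero_iff] at hs
      exact not_collinear_pair hxy h hs hwv hwx hwy hvx hvy h₁ h₂ h₃ h₄ h₅ h₆
    · rw [sign_pos h, eq_comm, sign_eq_one_iff] at hs
      exact hD (mul_pos h hs)

/-! ### Right-angle crossings between the segments at two points. -/

/-- Segments from a common point that meet again are not orthogonal. -/
theorem inner_ne_zero_of_common {u w v p : Plane} (h₁ : p ∈ openSegment ℝ u w)
    (h₂ : p ∈ openSegment ℝ u v) (huw : w ≠ u) : inner ℝ (w - u) (v - u) ≠ 0 := by
  obtain ⟨t, ht, -, rfl⟩ := mem_openSegment_iff.1 h₁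
  obtain ⟨s, hs, -, h⟩ := mem_openSegment_iff.1 h₂
  rw [ext_iff'] at h
  simp only [pt_apply] at h
  obtain ⟨h0, h1⟩ := h
  rw [inner_sub_eq]
  intro hz
  have hpos := ne_of_sq_pos huw
  have : s * ((w 0 - u 0) * (v 0 - u 0) + (w 1 - u 1) * (v 1 - u 1)) =
      t * ((w 0 - u 0) ^ 2 + (w 1 - u 1) ^ 2) := by
    linear_combination (w 0 - u 0) * h0 + (w 1 - u 1) * h1
  rw [hz, mul_zero] at this
  have := mul_pos ht hpos
  linarith

/-- The foot of a perpendicular is unique. -/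
theorem foot_unique {u w v a b p q : Plane} (hab : a ≠ b) (hp : p ∈ openSegment ℝ u w)
    (hq : q ∈ openSegment ℝ u v) (hp' : p ∈ openSegment ℝ a b) (hq' : q ∈ openSegment ℝ a b)
    (h₁ : inner ℝ (w - u) (b - a) = 0) (h₂ : inner ℝ (v - u) (b - a) = 0) : p = q := by
  obtain ⟨t, -, -, rfl⟩ := mem_openSegment_iff.1 hp
  obtain ⟨s, -, -, rfl⟩ := mem_openSegment_iff.1 hq
  obtain ⟨t', -, -, ht⟩ := mem_openSegment_iff.1 hp'
  obtain ⟨s', -, -, hs⟩ := mem_openSegment_iff.1 hq'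
  rw [inner_sub_eq] at h₁ h₂
  have hpos := ne_of_sq_pos hab.symm
  have h := (ext_iff'.1 ht)
  have h' := (ext_iff'.1 hs)
  simp only [pt_apply] at h h'
  have : (t' - s') * ((b 0 - a 0) ^ 2 + (b 1 - a 1) ^ 2) = 0 := by
    linear_combination (b 0 - a 0) * (h.1 - h'.1) + (b 1 - a 1) * (h.2 - h'.2) + t * h₁ - s * h₂
  have : t' = s' := by
    rcases mul_eq_zero.1 this with h | h
    · linarith
    · linarith
  rw [← ht, ← hs, this]

/-- The point at which segments from `u` and `x` cross at a right angle is not on the line through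
`u` and `x`. -/
theorem cr_ne_zero_of_perp {u x w y p : Plane} (hux : u ≠ x) (hp : p ∈ openSegment ℝ u w)
    (hp' : p ∈ openSegment ℝ x y) (h : inner ℝ (w - u) (y - x) = 0) (hpu : p ≠ u) (hpx : p ≠ x) :
    cr u x p ≠ 0 := by
  intro hc
  obtain ⟨t, ht⟩ := exists_pt_of_cr_eq_zero hux hc
  obtain ⟨a, ha, -, hpa⟩ := mem_openSegment_iff.1 hp
  obtain ⟨b, hb, -, hpb⟩ := mem_openSegment_iff.1 hp'
  rw [inner_sub_eq] at h
  have e₁ := ext_iff'.1 (hpa.trans ht)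
  have e₂ := ext_iff'.1 (hpb.trans ht)
  simp only [pt_apply] at e₁ e₂
  have hpos := ne_of_sq_pos hux.symm
  -- If p = u + t(x - u), then p - u and p - x are multiples of x - u, and their orthogonality
  -- forces t = 0 or t = 1.
  have : t * (t - 1) * ((x 0 - u 0) ^ 2 + (x 1 - u 1) ^ 2) = 0 := by
    have i0 : a * (w 0 - u 0) = t * (x 0 - u 0) := by linarith [e₁.1]
    have i1 : a * (w 1 - u 1) = t * (x 1 - u 1) := by linarith [e₁.2]
    have j0 : b * (y 0 - x 0) = (t - 1) * (x 0 - u 0) := by linarith [e₂.1]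
    have j1 : b * (y 1 - x 1) = (t - 1) * (x 1 - u 1) := by linarith [e₂.2]
    calc t * (t - 1) * ((x 0 - u 0) ^ 2 + (x 1 - u 1) ^ 2)
        = (t * (x 0 - u 0)) * ((t - 1) * (x 0 - u 0)) +
          (t * (x 1 - u 1)) * ((t - 1) * (x 1 - u 1)) := by ring
      _ = a * b * ((w 0 - u 0) * (y 0 - x 0) + (w 1 - u 1) * (y 1 - x 1)) := by
          rw [← i0, ← i1, ← j0, ← j1]; ring
      _ = 0 := by rw [h, mul_zero]
  rcases mul_eq_zero.1 this with h' | h'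
  · rcases mul_eq_zero.1 h' with h'' | h''
    · exact hpu (by rw [ht, h'', pt_zero])
    · exact hpx (by rw [ht, sub_eq_zero.1 h'', pt_one])
  · linarith

/-- Two points on the same half of the circle with diameter `ux`: the line through them does not
separate `u` and `x`. -/
theorem thales {u x p q : Plane} (hD : 0 < cr u x p * cr u x q)
    (hp : (p 0 - u 0) * (p 0 - x 0) + (p 1 - u 1) * (p 1 - x 1) = 0)
    (hq : (q 0 - u 0) * (q 0 - x 0) + (q 1 - u 1) * (q 1 - x 1) = 0) :
    0 ≤ cr u p q * cr x p q := by
  set D0 := x 0 - u 0 with hD0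
  set D1 := x 1 - u 1 with hD1
  set a0 := p 0 - u 0 with ha0
  set a1 := p 1 - u 1 with ha1
  set c0 := q 0 - u 0 with hc0
  set c1 := q 1 - u 1 with hc1
  have hp' : a0 * (a0 - D0) + a1 * (a1 - D1) = 0 := by
    rw [hD0, hD1, ha0, ha1]; linear_combination hp
  have hq' : c0 * (c0 - D0) + c1 * (c1 - D1) = 0 := by
    rw [hD0, hD1, hc0, hc1]; linear_combination hq
  have e₁ : cr u x p = D0 * a1 - D1 * a0 := rfl
  have e₂ : cr u x q = D0 * c1 - D1 * c0 := rfl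
  have e₃ : cr u p q = a0 * c1 - a1 * c0 := rfl
  have e₄ : cr x p q = (a0 - D0) * (c1 - D1) - (a1 - D1) * (c0 - D0) := by
    unfold cr; rw [ha0, ha1, hc0, hc1, hD0, hD1]; ring
  rw [e₁, e₂] at hD
  rw [e₃, e₄]
  clear_value D0 D1 a0 a1 c0 c1
  have hg : 0 < D0 ^ 2 + D1 ^ 2 := by
    by_contra hle
    have h0 : D0 = 0 := by nlinarith [sq_nonneg D0, sq_nonneg D1]
    have h1 : D1 = 0 := by nlinarith [sq_nonneg D0, sq_nonneg D1]
    simp [h0, h1] at hD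
  set g := D0 ^ 2 + D1 ^ 2 with hgdef
  set k₁ := D0 * a1 - D1 * a0 with hk₁
  set k₂ := D0 * c1 - D1 * c0 with hk₂
  set s₁ := D0 * a0 + D1 * a1 with hs₁
  set s₂ := D0 * c0 + D1 * c1 with hs₂
  -- With `s` the coordinate along `ux` and `k` the one across it, both scaled by the length of
  -- `ux`, this is the altitude theorem in a right triangle.
  have q₁ : k₁ ^ 2 = s₁ * (g - s₁) := by
    rw [hk₁, hs₁, hgdef]; linear_combination (D0 ^ 2 + D1 ^ 2) * hp'
  have q₂ : k₂ ^ 2 = s₂ * (g - s₂) := by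
    rw [hk₂, hs₂, hgdef]; linear_combination (D0 ^ 2 + D1 ^ 2) * hq'
  have f₁ : g * (a0 * c1 - a1 * c0) = s₁ * k₂ - s₂ * k₁ := by
    rw [hk₁, hk₂, hs₁, hs₂, hgdef]; ring
  have f₂ : g * ((a0 - D0) * (c1 - D1) - (a1 - D1) * (c0 - D0)) =
      (g - s₂) * k₁ - (g - s₁) * k₂ := by
    rw [hk₁, hk₂, hs₁, hs₂, hgdef]; ring
  have hs₁0 : 0 ≤ s₁ := by
    have : s₁ = a0 ^ 2 + a1 ^ 2 := by rw [hs₁]; linear_combination -hp'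
    rw [this]; positivity
  have hs₂0 : 0 ≤ s₂ := by
    have : s₂ = c0 ^ 2 + c1 ^ 2 := by rw [hs₂]; linear_combination -hq'
    rw [this]; positivity
  have hr₁0 : 0 ≤ g - s₁ := by
    have : g - s₁ = (a0 - D0) ^ 2 + (a1 - D1) ^ 2 := by
      rw [hs₁, hgdef]; linear_combination -hp'
    rw [this]; positivity
  have hr₂0 : 0 ≤ g - s₂ := by
    have : g - s₂ = (c0 - D0) ^ 2 + (c1 - D1) ^ 2 := by
      rw [hs₂, hgdef]; linear_combination -hq'
    rw [this]; positivity
  generalize a0 * c1 - a1 * c0 = A at f₁ ⊢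
  generalize (a0 - D0) * (c1 - D1) - (a1 - D1) * (c0 - D0) = B at f₂ ⊢
  generalize g - s₁ = r₁ at *
  generalize g - s₂ = r₂ at *
  clear_value k₁ k₂ s₁ s₂ g
  -- The inequality of arithmetic and geometric means for `s₁ * r₂` and `s₂ * r₁`, whose product is
  -- (k₁k₂)². By `hprod` it decides the sign of the product of the two determinants.
  have hsum : 2 * (k₁ * k₂) ≤ s₁ * r₂ + s₂ * r₁ := by
    have hn : 0 ≤ s₁ * r₂ + s₂ * r₁ := by positivity
    have hsq : (2 * (k₁ * k₂)) ^ 2 ≤ (s₁ * r₂ + s₂ * r₁) ^ 2 := by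
      have : (2 * (k₁ * k₂)) ^ 2 = 4 * ((s₁ * r₁) * (s₂ * r₂)) := by rw [← q₁, ← q₂]; ring
      have hid : (s₁ * r₂ + s₂ * r₁) ^ 2 - 4 * ((s₁ * r₁) * (s₂ * r₂)) =
          (s₁ * r₂ - s₂ * r₁) ^ 2 := by ring
      have := sq_nonneg (s₁ * r₂ - s₂ * r₁)
      linarith
    exact abs_le_of_sq_le_sq' hsq hn |>.2
  have hprod : g ^ 2 * (A * B) = k₁ * k₂ * (s₁ * r₂ + s₂ * r₁ - 2 * (k₁ * k₂)) := by
    calc g ^ 2 * (A * B) = (g * A) * (g * B) := by ring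
      _ = (s₁ * k₂ - s₂ * k₁) * (r₂ * k₁ - r₁ * k₂) := by rw [f₁, f₂]
      _ = k₁ * k₂ * (s₁ * r₂ + s₂ * r₁) - (s₁ * r₁) * k₂ ^ 2 - (s₂ * r₂) * k₁ ^ 2 := by ring
      _ = _ := by rw [← q₁, ← q₂]; ring
  have : 0 ≤ g ^ 2 * (A * B) := by
    rw [hprod]; exact mul_nonneg hD.le (by linarith)
  exact nonneg_of_mul_nonneg_right this (by positivity)

/-- If two points see a segment at a right angle and the sight lines are orthogonal even crosswise,
then the two points coincide. -/
theorem eq_of_perp_cross {u x p q : Plane} (hpu : p ≠ u) (hqx : q ≠ x)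
    (h₁ : inner ℝ (p - u) (p - x) = 0) (h₂ : inner ℝ (q - u) (q - x) = 0)
    (h₃ : inner ℝ (p - u) (q - x) = 0) : p = q := by
  rw [inner_sub_eq] at h₁ h₂ h₃
  have hα := ne_of_sq_pos hpu
  have hβ := ne_of_sq_pos hqx
  by_contra hpq
  have hδ := ne_of_sq_pos hpq
  have hz : ((p 0 - q 0) ^ 2 + (p 1 - q 1) ^ 2) * ((p 0 - u 0) ^ 2 + (p 1 - u 1) ^ 2) *
      ((q 0 - x 0) ^ 2 + (q 1 - x 1) ^ 2) = 0 := by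
    -- The vector p - q is orthogonal to p - u and to q - x, which are orthogonal to each other. In
    -- the plane three pairwise orthogonal vectors cannot all be nonzero.
    have d₁ : (p 0 - u 0) * (p 0 - q 0) + (p 1 - u 1) * (p 1 - q 1) = 0 := by
      linear_combination h₁ - h₃
    have d₂ : (q 0 - x 0) * (p 0 - q 0) + (q 1 - x 1) * (p 1 - q 1) = 0 := by
      linear_combination h₃ - h₂
    generalize p 0 - u 0 = a0 at *
    generalize p 1 - u 1 = a1 at *
    generalize p 0 - q 0 = d0 at *
    generalize p 1 - q 1 = d1 at *
    generalize q 0 - x 0 = b0 at *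
    generalize q 1 - x 1 = b1 at *
    have c₁ : (a0 ^ 2 + a1 ^ 2) * (d0 ^ 2 + d1 ^ 2) = (a0 * d1 - a1 * d0) ^ 2 := by
      linear_combination (a0 * d0 + a1 * d1) * d₁
    have c₂ : (a0 ^ 2 + a1 ^ 2) * (b0 ^ 2 + b1 ^ 2) = (a0 * b1 - a1 * b0) ^ 2 := by
      linear_combination (a0 * b0 + a1 * b1) * h₃
    have c₃ : (a0 * d1 - a1 * d0) * (a0 * b1 - a1 * b0) = 0 := by
      linear_combination (a0 ^ 2 + a1 ^ 2) * d₂ - (a0 * d0 + a1 * d1) * h₃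
    rcases mul_eq_zero.1 c₃ with h | h
    · rw [h] at c₁
      linear_combination (b0 ^ 2 + b1 ^ 2) * c₁
    · rw [h] at c₂
      linear_combination (d0 ^ 2 + d1 ^ 2) * c₂
  have := mul_pos (mul_pos hδ hα) hβ
  linarith

theorem ne_of_cr_ne_zero {a b c : Plane} (h : cr a b c ≠ 0) : c ≠ a ∧ c ≠ b := by
  constructor
  · rintro rfl; exact h (by unfold cr; ring)
  · rintro rfl; exact h (by unfold cr; ring)

theorem pt_mem_openSegment_of_mem {u w p : Plane} (hp : p ∈ openSegment ℝ u w) {t : ℝ}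
    (ht : 0 < t) (ht' : t ≤ 1) : pt u p t ∈ openSegment ℝ u w := by
  obtain ⟨a, ha, ha', rfl⟩ := mem_openSegment_iff.1 hp
  refine mem_openSegment_iff.2 ⟨t * a, by positivity, by nlinarith, ?_⟩
  rw [ext_iff']
  simp only [pt_apply]
  constructor <;> ring

theorem perp_of_mem_openSegment {u w x y p q : Plane} (hp : p ∈ openSegment ℝ u w)
    (hq : q ∈ openSegment ℝ x y) (h : inner ℝ (w - u) (y - x) = 0) :
    inner ℝ (p - u) (q - x) = 0 := by
  obtain ⟨a, -, -, rfl⟩ := mem_openSegment_iff.1 hp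
  obtain ⟨b, -, -, rfl⟩ := mem_openSegment_iff.1 hq
  rw [inner_sub_eq] at h ⊢
  simp only [pt_apply]
  linear_combination a * b * h

/-- Two points at which segments from `u` cross segments from `x` coincide if they lie on the same
side of the line through `u` and `x`, provided that the segments cross at right angles only. -/
theorem fan_crossing_unique {u x w v y z p q : Plane}
    (hp : p ∈ openSegment ℝ u w) (hp' : p ∈ openSegment ℝ x y)
    (hq : q ∈ openSegment ℝ u v) (hq' : q ∈ openSegment ℝ x z)
    (h₁ : inner ℝ (w - u) (y - x) = 0) (h₂ : inner ℝ (v - u) (z - x) = 0)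
    (h₃ : ∀ r ∈ openSegment ℝ u w, r ∈ openSegment ℝ x z → inner ℝ (w - u) (z - x) = 0)
    (h₄ : ∀ r ∈ openSegment ℝ u v, r ∈ openSegment ℝ x y → inner ℝ (v - u) (y - x) = 0)
    (hD : 0 < cr u x p * cr u x q) : p = q := by
  have i₁ := perp_of_mem_openSegment hp hp' h₁
  have i₂ := perp_of_mem_openSegment hq hq' h₂
  obtain ⟨hpu, hpx⟩ := ne_of_cr_ne_zero (left_ne_zero_of_mul hD.ne')
  obtain ⟨hqu, hqx⟩ := ne_of_cr_ne_zero (right_ne_zero_of_mul hD.ne')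
  -- Both points lie on the circle with diameter `ux` and on the same side, so a sight line of one
  -- meets a sight line of the other. That meeting point is again a right-angle crossing, and
  -- `eq_of_perp_cross` applies.
  have hA := thales hD (by rwa [inner_sub_eq] at i₁) (by rwa [inner_sub_eq] at i₂)
  rcases exists_crossing hD hA with ⟨t, s, ht, ht', hs, hs', h⟩ | ⟨t, s, ht, ht', hs, hs', h⟩
  · have := h₃ _ (pt_mem_openSegment_of_mem hp ht ht') (h ▸ pt_mem_openSegment_of_mem hq' hs hs')
    exact eq_of_perp_cross hpu hqx i₁ i₂ (perp_of_mem_openSegment hp hq' this)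
  · have := h₄ _ (pt_mem_openSegment_of_mem hq ht ht') (h ▸ pt_mem_openSegment_of_mem hp' hs hs')
    exact (eq_of_perp_cross hqu hpx i₂ i₁ (perp_of_mem_openSegment hq hp' this)).symm

end Plane

/-! ## Layouts of edge sets -/

/-- Positions of vertices and polylines for pairs of vertices. -/
structure Layout (V : Type) where
  /-- the position of a vertex -/
  pos : V → Plane
  /-- the number of bends of an edge -/
  bends : Sym2 V → ℕ
  /-- the corners of an edge -/
  corner : Sym2 V → ℕ → Plane

namespace Layout

variable {V : Type}

/-- The polyline of an edge without its end points. -/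
def int (D : Layout V) (e : Sym2 V) : Set Plane := polylineInt (D.corner e) (D.bends e)

/-- The layout restricts to a right-angle crossing drawing of the graph with vertex set `S` and edge
set `E`. -/
structure IsRACOn (D : Layout V) (S : Set V) (E : Finset (Sym2 V)) : Prop where
  mem_of_mem : ∀ e ∈ E, ∀ v ∈ e, v ∈ S
  not_isDiag : ∀ e ∈ E, ¬ e.IsDiag
  pos_injOn : Set.InjOn D.pos S
  joins : ∀ e ∈ E, ∃ u v : V, e = s(u, v) ∧
    D.corner e 0 = D.pos u ∧ D.corner e (D.bends e + 1) = D.pos v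
  nondegenerate : ∀ e ∈ E, ∀ i ≤ D.bends e, D.corner e i ≠ D.corner e (i + 1)
  consecutive : ∀ e ∈ E, ∀ i < D.bends e,
    polySegment (D.corner e) i ∩ polySegment (D.corner e) (i + 1) = {D.corner e (i + 1)}
  angle_ne : ∀ e ∈ E, ∀ i < D.bends e,
    EuclideanGeometry.angle (D.corner e i) (D.corner e (i + 1)) (D.corner e (i + 2)) ≠ Real.pi
  disjoint : ∀ e ∈ E, ∀ i j : ℕ, i + 1 < j → j ≤ D.bends e →
    Disjoint (polySegment (D.corner e) i) (polySegment (D.corner e) j)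
  avoids : ∀ e ∈ E, ∀ v ∈ S, v ∉ e → D.pos v ∉ D.int e
  rac : ∀ e ∈ E, ∀ f ∈ E, e ≠ f → ∀ p ∈ D.int e ∩ D.int f,
    ∃ i ≤ D.bends e, ∃ j ≤ D.bends f,
      p ∈ openSegment ℝ (D.corner e i) (D.corner e (i + 1)) ∧
      p ∈ openSegment ℝ (D.corner f j) (D.corner f (j + 1)) ∧
      inner ℝ (D.corner e (i + 1) - D.corner e i) (D.corner f (j + 1) - D.corner f j) = 0

/-- The segment between two vertices without its end points. -/
def seg (D : Layout V) (u v : V) : Set Plane := openSegment ℝ (D.pos u) (D.pos v)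

theorem seg_comm (D : Layout V) (u v : V) : D.seg u v = D.seg v u := openSegment_symm _ _ _

theorem polyline_zero (c : ℕ → Plane) : polyline c 0 = segment ℝ (c 0) (c 1) := by
  ext p
  simp [polyline, polySegment]

theorem segment_diff {a b : Plane} (h : a ≠ b) : segment ℝ a b \ {a, b} = openSegment ℝ a b := by
  rw [← insert_endpoints_openSegment]
  ext p
  simp only [Set.mem_sdiff, Set.mem_insert_iff, Set.mem_singleton_iff]
  constructor
  · rintro ⟨h₁ | h₁ | h₁, h₂⟩
    · exact absurd (Or.inl h₁) h₂
    · exact absurd (Or.inr h₁) h₂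
    · exact h₁
  · intro hp
    refine ⟨Or.inr (Or.inr hp), ?_⟩
    rintro (rfl | rfl)
    · exact h (left_mem_openSegment_iff.1 hp)
    · exact h (right_mem_openSegment_iff.1 hp)

theorem card_bent_le {D : Layout V} {E : Finset (Sym2 V)} {b : ℕ} (hb : ∑ e ∈ E, D.bends e ≤ b) :
    (E.filter fun e => D.bends e ≠ 0).card ≤ b := by
  rw [Finset.card_eq_sum_ones]
  refine le_trans ?_ hb
  rw [Finset.sum_filter]
  refine Finset.sum_le_sum fun e _ => ?_
  split_ifs with h'
  · omega
  · omega

namespace IsRACOn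

variable {D : Layout V} {S : Set V} {E : Finset (Sym2 V)} (h : D.IsRACOn S E)
include h

theorem left_mem {u v : V} (he : s(u, v) ∈ E) : u ∈ S := h.mem_of_mem _ he _ (Sym2.mem_mk_left u v)

theorem right_mem {u v : V} (he : s(u, v) ∈ E) : v ∈ S :=
  h.mem_of_mem _ he _ (Sym2.mem_mk_right u v)

theorem ne {u v : V} (he : s(u, v) ∈ E) : u ≠ v := fun huv => h.not_isDiag _ he (by simpa using huv)

theorem pos_ne {u v : V} (he : s(u, v) ∈ E) : D.pos u ≠ D.pos v := fun huv =>
  h.ne he (h.pos_injOn (h.left_mem he) (h.right_mem he) huv)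

theorem joins' {u v : V} (he : s(u, v) ∈ E) :
    (D.corner s(u, v) 0 = D.pos u ∧ D.corner s(u, v) (D.bends s(u, v) + 1) = D.pos v) ∨
    (D.corner s(u, v) 0 = D.pos v ∧ D.corner s(u, v) (D.bends s(u, v) + 1) = D.pos u) := by
  obtain ⟨a, b, hab, h₁, h₂⟩ := h.joins _ he
  rcases Sym2.eq_iff.1 hab with ⟨rfl, rfl⟩ | ⟨rfl, rfl⟩
  · exact Or.inl ⟨h₁, h₂⟩
  · exact Or.inr ⟨h₁, h₂⟩

theorem int_eq {u v : V} (he : s(u, v) ∈ E) (hb : D.bends s(u, v) = 0) :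
    D.int s(u, v) = D.seg u v := by
  have hj := h.joins' he
  rw [int, polylineInt, hb, polyline_zero]
  rw [hb] at hj
  rw [zero_add] at hj ⊢
  rcases hj with ⟨h₁, h₂⟩ | ⟨h₁, h₂⟩
  · rw [h₁, h₂]
    exact segment_diff (h.pos_ne he)
  · rw [h₁, h₂, seg_comm]
    exact segment_diff (h.pos_ne he).symm

theorem perp {u v x y : V} (he : s(u, v) ∈ E) (hf : s(x, y) ∈ E) (hb : D.bends s(u, v) = 0)
    (hb' : D.bends s(x, y) = 0) (hne : s(u, v) ≠ s(x, y)) {p : Plane} (hp : p ∈ D.seg u v)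
    (hp' : p ∈ D.seg x y) : inner ℝ (D.pos v - D.pos u) (D.pos y - D.pos x) = 0 := by
  rw [← h.int_eq he hb] at hp
  rw [← h.int_eq hf hb'] at hp'
  obtain ⟨i, hi, j, hj, -, -, hin⟩ := h.rac _ he _ hf hne p ⟨hp, hp'⟩
  obtain rfl : i = 0 := by omega
  obtain rfl : j = 0 := by omega
  have h₁ := h.joins' he
  have h₂ := h.joins' hf
  rw [hb] at h₁
  rw [hb'] at h₂
  rw [Plane.inner_sub_eq] at hin ⊢
  rcases h₁ with ⟨a, b⟩ | ⟨a, b⟩ <;> rcases h₂ with ⟨c, d⟩ | ⟨c, d⟩ <;>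
    rw [a, b, c, d] at hin <;> first | linear_combination hin | linear_combination -hin

/-- The edge `f` may have bends, so unlike in `perp` the orthogonality concerns only the segment of
`f` that contains the crossing. -/
theorem perp_bent {u v : V} {f : Sym2 V} (he : s(u, v) ∈ E) (hf : f ∈ E) (hb : D.bends s(u, v) = 0)
    (hne : s(u, v) ≠ f) {p : Plane} (hp : p ∈ D.seg u v) (hp' : p ∈ D.int f) :
    ∃ j ≤ D.bends f, p ∈ openSegment ℝ (D.corner f j) (D.corner f (j + 1)) ∧
      inner ℝ (D.pos v - D.pos u) (D.corner f (j + 1) - D.corner f j) = 0 := by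
  rw [← h.int_eq he hb] at hp
  obtain ⟨i, hi, j, hj, -, hpj, hin⟩ := h.rac _ he _ hf hne p ⟨hp, hp'⟩
  refine ⟨j, hj, hpj, ?_⟩
  obtain rfl : i = 0 := by omega
  have h₁ := h.joins' he
  rw [hb] at h₁
  rw [Plane.inner_sub_eq] at hin ⊢
  rcases h₁ with ⟨a, b⟩ | ⟨a, b⟩ <;> rw [a, b] at hin <;>
    first | linear_combination hin | linear_combination -hin

/-- Two segments from `u` that meet again leave `u` in the same direction, so such a crossing could
not be at a right angle. -/
theorem not_common {u v w : V} (he : s(u, v) ∈ E) (hf : s(u, w) ∈ E) (hb : D.bends s(u, v) = 0)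
    (hb' : D.bends s(u, w) = 0) (hne : v ≠ w) {p : Plane} (hp : p ∈ D.seg u v)
    (hp' : p ∈ D.seg u w) : False := by
  refine Plane.inner_ne_zero_of_common hp hp' (h.pos_ne he).symm (h.perp he hf hb hb' ?_ hp hp')
  intro heq
  rcases Sym2.eq_iff.1 heq with ⟨-, h'⟩ | ⟨h₁, h₂⟩
  · exact hne h'
  · exact hne (h₂.trans h₁)

theorem avoids_seg {u v x : V} (he : s(u, v) ∈ E) (hb : D.bends s(u, v) = 0) (hx : x ∈ S) :
    D.pos x ∉ D.seg u v := by
  intro hp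
  by_cases hxe : x ∈ s(u, v)
  · rcases Sym2.mem_iff.1 hxe with rfl | rfl
    · exact h.pos_ne he (left_mem_openSegment_iff.1 hp)
    · exact h.pos_ne he (right_mem_openSegment_iff.1 hp)
  · rw [← h.int_eq he hb] at hp
    exact h.avoids _ he x hx hxe hp

/-! ### Counting the crossed edges at a vertex. -/

open Classical in
/-- At most three straight edges at `u` are crossed by straight edges at another vertex `x`. -/
theorem card_fan_le {u x : V} (hux : u ≠ x) (F : Finset V)
    (hF : ∀ w ∈ F, s(u, w) ∈ E ∧ D.bends s(u, w) = 0 ∧ ∃ y, s(x, y) ∈ E ∧ D.bends s(x, y) = 0 ∧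
      s(u, w) ≠ s(x, y) ∧ ∃ p, p ∈ D.seg u w ∧ p ∈ D.seg x y) : F.card ≤ 3 := by
  choose! he hb y hf hb' hne p hp hp' using hF
  have hcr : ∀ w ∈ F, Plane.cr (D.pos u) (D.pos x) (p w) ≠ 0 := by
    intro w hw
    refine Plane.cr_ne_zero_of_perp ?_ (hp w hw) (hp' w hw)
      (h.perp (he w hw) (hf w hw) (hb w hw) (hb' w hw) (hne w hw) (hp w hw) (hp' w hw)) ?_ ?_
    · exact fun h' => hux (h.pos_injOn (h.left_mem (he w hw)) (h.left_mem (hf w hw)) h')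
    · intro h'
      have := hp w hw
      rw [h'] at this
      exact h.avoids_seg (he w hw) (hb w hw) (h.left_mem (he w hw)) this
    · intro h'
      have := hp' w hw
      rw [h'] at this
      exact h.avoids_seg (hf w hw) (hb' w hw) (h.left_mem (hf w hw)) this
  -- An edge at `u` that is also an edge at `x` would be `ux`, but then its crossing `p w` would lie
  -- on the line through `u` and `x`.
  have hne' : ∀ w ∈ F, ∀ v ∈ F, s(u, w) ≠ s(x, y v) := by
    intro w hw v _ heq
    rcases Sym2.eq_iff.1 heq with ⟨h', -⟩ | ⟨-, h'⟩
    · exact hux h'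
    · apply hcr w hw
      obtain ⟨t, -, -, ht⟩ := Plane.mem_openSegment_iff.1 (hp w hw)
      rw [← ht, show D.pos w = D.pos x by rw [h']]
      unfold Plane.cr
      simp only [Plane.pt_apply]
      ring
  -- On each side of the line `ux` there is only one possible crossing point, and two straight edges
  -- at `u` cannot share it. So the side determines the edge; counting all three signs, although
  -- zero does not occur, gives the bound three.
  have hinj : Set.InjOn (fun w => SignType.sign (Plane.cr (D.pos u) (D.pos x) (p w))) F := by
    intro w hw v hv hs
    by_contra hwv
    have hD : 0 < Plane.cr (D.pos u) (D.pos x) (p w) * Plane.cr (D.pos u) (D.pos x) (p v) := by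
      have hs : SignType.sign (Plane.cr (D.pos u) (D.pos x) (p w)) =
        SignType.sign (Plane.cr (D.pos u) (D.pos x) (p v)) := hs
      rcases lt_or_gt_of_ne (hcr w hw) with h' | h'
      · rw [sign_neg h', eq_comm, sign_eq_neg_one_iff] at hs
        exact mul_pos_of_neg_of_neg h' hs
      · rw [sign_pos h', eq_comm, sign_eq_one_iff] at hs
        exact mul_pos h' hs
    have key : p w = p v := Plane.fan_crossing_unique (hp w hw) (hp' w hw) (hp v hv) (hp' v hv)
      (h.perp (he w hw) (hf w hw) (hb w hw) (hb' w hw) (hne w hw) (hp w hw) (hp' w hw))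
      (h.perp (he v hv) (hf v hv) (hb v hv) (hb' v hv) (hne v hv) (hp v hv) (hp' v hv))
      (fun r hr hr' => h.perp (he w hw) (hf v hv) (hb w hw) (hb' v hv) (hne' w hw v hv) hr hr')
      (fun r hr hr' => h.perp (he v hv) (hf w hw) (hb v hv) (hb' w hw) (hne' v hv w hw) hr hr') hD
    have hpw := hp w hw
    rw [key] at hpw
    exact h.not_common (he w hw) (he v hv) (hb w hw) (hb v hv) hwv hpw (hp v hv)
  have := Finset.card_le_card_of_injOn (t := Finset.univ) _ (fun _ _ => Finset.mem_univ _) hinj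
  exact this.trans (by decide)

/-- A segment of an edge crosses at most one straight edge at `u`. -/
theorem card_foot_le {u : V} {f : Sym2 V} (hf : f ∈ E) {j : ℕ} (hj : j ≤ D.bends f) (F : Finset V)
    (hF : ∀ w ∈ F, s(u, w) ∈ E ∧ D.bends s(u, w) = 0 ∧ ∃ p, p ∈ D.seg u w ∧
      p ∈ openSegment ℝ (D.corner f j) (D.corner f (j + 1)) ∧
      inner ℝ (D.pos w - D.pos u) (D.corner f (j + 1) - D.corner f j) = 0) : F.card ≤ 1 := by
  rw [Finset.card_le_one]
  intro w hw v hv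
  obtain ⟨he, hb, p, hp, hp', hin⟩ := hF w hw
  obtain ⟨he', hb', q, hq, hq', hin'⟩ := hF v hv
  by_contra hwv
  have := Plane.foot_unique (h.nondegenerate f hf j hj) hp hq hp' hq' hin hin'
  subst this
  exact h.not_common he he' hb hb' hwv hp hq

open Classical in
/-- Few straight edges at `u` are crossed if there is a small vertex cover. -/
theorem card_crossed_le {b : ℕ} (hb : ∑ e ∈ E, D.bends e ≤ b) {X : Finset V}
    (hX : ∀ e ∈ E, ∃ x ∈ X, x ∈ e) (u : V) (F : Finset V)
    (hF : ∀ w ∈ F, s(u, w) ∈ E ∧ D.bends s(u, w) = 0 ∧ ∃ f ∈ E, f ≠ s(u, w) ∧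
      ∃ p, p ∈ D.seg u w ∧ p ∈ D.int f) : F.card ≤ 3 * X.card + 2 * b := by
  let A : V → Finset V := fun x => F.filter fun w => u ≠ x ∧ ∃ y, s(x, y) ∈ E ∧
    D.bends s(x, y) = 0 ∧ s(u, w) ≠ s(x, y) ∧ ∃ p, p ∈ D.seg u w ∧ p ∈ D.seg x y
  let B : Sym2 V → ℕ → Finset V := fun f j => F.filter fun w => ∃ p, p ∈ D.seg u w ∧
      p ∈ openSegment ℝ (D.corner f j) (D.corner f (j + 1)) ∧
      inner ℝ (D.pos w - D.pos u) (D.corner f (j + 1) - D.corner f j) = 0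
  have hA : ∀ x, (A x).card ≤ 3 := by
    intro x
    by_cases hux : u = x
    · have : A x = ∅ := by
        rw [Finset.filter_eq_empty_iff]
        exact fun w _ h' => h'.1 hux
      rw [this]; simp
    · refine h.card_fan_le hux _ fun w hw => ?_
      obtain ⟨hw, -, hy⟩ := Finset.mem_filter.1 hw
      obtain ⟨h₁, h₂, -⟩ := hF w hw
      exact ⟨h₁, h₂, hy⟩
  have hB : ∀ f ∈ E, ∀ j ≤ D.bends f, (B f j).card ≤ 1 := by
    intro f hf j hj
    refine h.card_foot_le (u := u) hf hj _ fun w hw => ?_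
    obtain ⟨hw, hp⟩ := Finset.mem_filter.1 hw
    obtain ⟨h₁, h₂, -⟩ := hF w hw
    exact ⟨h₁, h₂, hp⟩
  -- A crossing edge is either straight, and then starts at some vertex of the cover, or bent, and
  -- then one of its segments is crossed.
  have hsub : F ⊆ X.biUnion A ∪ (E.filter fun e => D.bends e ≠ 0).biUnion fun f =>
      (Finset.range (D.bends f + 1)).biUnion (B f) := by
    intro w hw
    obtain ⟨he, hb', f, hf, hne, p, hp, hp'⟩ := hF w hw
    rw [Finset.mem_union]
    by_cases hbf : D.bends f = 0
    · left
      obtain ⟨x, hx, hxf⟩ := hX f hf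
      obtain ⟨y, rfl⟩ := Sym2.mem_iff_exists.1 hxf
      rw [h.int_eq hf hbf] at hp'
      rw [Finset.mem_biUnion]
      refine ⟨x, hx, Finset.mem_filter.2 ⟨hw, ?_, y, hf, hbf, hne.symm, p, hp, hp'⟩⟩
      rintro rfl
      exact h.not_common he hf hb' hbf (fun h' => hne (by rw [h'])) hp hp'
    · right
      obtain ⟨j, hj, hpj, hin⟩ := h.perp_bent he hf hb' hne.symm hp hp'
      rw [Finset.mem_biUnion]
      refine ⟨f, Finset.mem_filter.2 ⟨hf, hbf⟩, ?_⟩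
      rw [Finset.mem_biUnion]
      exact ⟨j, Finset.mem_range.2 (by omega), Finset.mem_filter.2 ⟨hw, p, hp, hpj, hin⟩⟩
  refine (Finset.card_le_card hsub).trans ((Finset.card_union_le _ _).trans (add_le_add ?_ ?_))
  · refine (Finset.card_biUnion_le).trans ((Finset.sum_le_card_nsmul X _ 3 fun x _ => hA x).trans ?_)
    simp [mul_comm]
  · have h₁ : ∀ f ∈ E.filter fun e => D.bends e ≠ 0,
        ((Finset.range (D.bends f + 1)).biUnion (B f)).card ≤ 2 * D.bends f := by
      intro f hf
      obtain ⟨hf, hbf⟩ := Finset.mem_filter.1 hf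
      refine Finset.card_biUnion_le.trans ((Finset.sum_le_card_nsmul _ _ 1 fun j hj =>
        hB f hf j ?_).trans ?_)
      · have := Finset.mem_range.1 hj
        omega
      · simp only [Finset.card_range, smul_eq_mul, mul_one]; omega
    refine Finset.card_biUnion_le.trans ((Finset.sum_le_sum h₁).trans ?_)
    rw [← Finset.mul_sum]
    refine Nat.mul_le_mul le_rfl (le_trans ?_ hb)
    exact Finset.sum_le_sum_of_subset (Finset.filter_subset _ _)

open Classical in
/-- Few vertices are joined to given vertices by edges with bends. -/
theorem card_bent_vertices_le {b : ℕ} (hb : ∑ e ∈ E, D.bends e ≤ b) (N F : Finset V)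
    (hN : ∀ w ∈ F, ∀ u ∈ N, s(u, w) ∈ E)
    (hF : ∀ w ∈ F, ∃ u ∈ N, D.bends s(u, w) ≠ 0) : F.card ≤ b := by
  choose! u hu hbu using hF
  refine le_trans ?_ (card_bent_le hb)
  refine Finset.card_le_card_of_injOn (fun w => s(u w, w)) (fun w hw => ?_) ?_
  · exact Finset.mem_coe.2 (Finset.mem_filter.2 ⟨hN w hw _ (hu w hw), hbu w hw⟩)
  · intro w hw v hv hwv
    rcases Sym2.eq_iff.1 hwv with ⟨-, h'⟩ | ⟨h₁, h₂⟩
    · exact h'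
    · exact absurd rfl (h.ne (hN v hv v (h₁ ▸ hu w hw)))

open Classical in
/-- Three vertices have few common neighbors. -/
theorem card_common_le {b : ℕ} (hb : ∑ e ∈ E, D.bends e ≤ b) {x : Fin 3 → V}
    (hx : Function.Injective x) (W : Finset V) (hW : ∀ w ∈ W, ∀ i, s(x i, w) ∈ E) :
    W.card ≤ b + 54 := by
  let W₁ := W.filter fun w => ∃ i, D.bends s(x i, w) ≠ 0
  let P : Fin 3 → Fin 3 → V → Prop := fun i j w => D.bends s(x i, w) = 0 ∧ i ≠ j ∧
    ∃ y, s(x j, y) ∈ E ∧ D.bends s(x j, y) = 0 ∧ s(x i, w) ≠ s(x j, y) ∧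
      ∃ p, p ∈ D.seg (x i) w ∧ p ∈ D.seg (x j) y
  -- Vertices whose straight edge to `x i` is crossed by a straight edge at some other `x j`: nine
  -- pairs with at most three vertices each.
  let W₂ := (Finset.univ : Finset (Fin 3 × Fin 3)).biUnion fun q => W.filter (P q.1 q.2)
  have hW₁ : W₁.card ≤ b := by
    refine h.card_bent_vertices_le hb (Finset.univ.image x) W₁ ?_ ?_
    · intro w hw u hu
      obtain ⟨i, -, rfl⟩ := Finset.mem_image.1 hu
      exact hW w (Finset.mem_filter.1 hw).1 i
    · intro w hw
      obtain ⟨i, hi⟩ := (Finset.mem_filter.1 hw).2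
      exact ⟨x i, Finset.mem_image_of_mem _ (Finset.mem_univ _), hi⟩
  have hW₂ : W₂.card ≤ 27 := by
    refine Finset.card_biUnion_le.trans ((Finset.sum_le_card_nsmul _ _ 3 fun q _ => ?_).trans ?_)
    · by_cases hq : q.1 = q.2
      · have : W.filter (P q.1 q.2) = ∅ := by
          rw [Finset.filter_eq_empty_iff]
          exact fun w _ h' => h'.2.1 hq
        rw [this]; simp
      · refine h.card_fan_le (fun h' => hq (hx h')) _ fun w hw => ?_
        obtain ⟨hw, h₁, -, h₂⟩ := Finset.mem_filter.1 hw
        exact ⟨hW w hw q.1, h₁, h₂⟩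
    · simp
  by_contra hcard
  let W₃ := W \ (W₁ ∪ W₂)
  have hW₃ : 27 < W₃.card := by
    have h₁ := Finset.le_card_sdiff (W₁ ∪ W₂) W
    have h₂ := Finset.card_union_le W₁ W₂
    have : W₃.card = (W \ (W₁ ∪ W₂)).card := rfl
    omega
  -- The position relative to the three lines through the given vertices takes at most 3³ = 27
  -- values, so among more than 27 remaining vertices two agree. This gives b + 27 + 27 in the
  -- statement.
  let σ : V → SignType × SignType × SignType := fun w =>
    (SignType.sign (Plane.cr (D.pos (x 0)) (D.pos (x 1)) (D.pos w)),
     SignType.sign (Plane.cr (D.pos (x 0)) (D.pos (x 2)) (D.pos w)),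
     SignType.sign (Plane.cr (D.pos (x 1)) (D.pos (x 2)) (D.pos w)))
  obtain ⟨w, hw, v, hv, hwv, hσ⟩ := Finset.exists_ne_map_eq_of_card_lt_of_maps_to
    (s := W₃) (t := Finset.univ) (f := σ) (by
      refine lt_of_le_of_lt ?_ hW₃
      decide) (fun _ _ => Finset.mem_univ _)
  have hmem : ∀ w ∈ W₃, w ∈ W ∧ (∀ i, D.bends s(x i, w) = 0) ∧ ∀ i j, i ≠ j →
      ∀ y, s(x j, y) ∈ E → D.bends s(x j, y) = 0 → s(x i, w) ≠ s(x j, y) →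
      Disjoint (D.seg (x i) w) (D.seg (x j) y) := by
    intro w hw
    obtain ⟨hw, hw'⟩ := Finset.mem_sdiff.1 hw
    rw [Finset.mem_union, not_or] at hw'
    have hb0 : ∀ i, D.bends s(x i, w) = 0 := by
      intro i
      by_contra hi
      exact hw'.1 (Finset.mem_filter.2 ⟨hw, i, hi⟩)
    refine ⟨hw, hb0, fun i j hij y hy hby hne => ?_⟩
    rw [Set.disjoint_left]
    intro p hp hp'
    exact hw'.2 (Finset.mem_biUnion.2 ⟨(i, j), Finset.mem_univ _, Finset.mem_filter.2
      ⟨hw, hb0 i, hij, y, hy, hby, hne, p, hp, hp'⟩⟩)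
  obtain ⟨hwW, hwb, hwd⟩ := hmem w hw
  obtain ⟨hvW, hvb, hvd⟩ := hmem v hv
  have hwS : w ∈ S := h.right_mem (hW w hwW 0)
  have hvS : v ∈ S := h.right_mem (hW v hvW 0)
  have hxS : ∀ i, x i ∈ S := fun i => h.left_mem (hW w hwW i)
  -- The line through `w` and `v` would have to separate every two of the three vertices, but a line
  -- has only two sides.
  have hsep : ∀ i j, i ≠ j →
      SignType.sign (Plane.cr (D.pos (x i)) (D.pos (x j)) (D.pos w)) =
        SignType.sign (Plane.cr (D.pos (x i)) (D.pos (x j)) (D.pos v)) →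
      Plane.cr (D.pos (x i)) (D.pos w) (D.pos v) * Plane.cr (D.pos (x j)) (D.pos w) (D.pos v) < 0 := by
    intro i j hij hs
    have hne : ∀ {a c : V}, s(x j, a) ∈ E → s(x i, a) ≠ s(x j, c) := by
      intro a c ha heq
      rcases Sym2.eq_iff.1 heq with ⟨h', -⟩ | ⟨-, h'⟩
      · exact hij (hx h')
      · exact h.ne ha h'.symm
    refine Plane.separated (fun h' => hij (hx (h.pos_injOn (hxS i) (hxS j) h'))) hs
      (fun h' => hwv (h.pos_injOn hwS hvS h')) (h.pos_ne (hW w hwW i)).symm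
      (h.pos_ne (hW w hwW j)).symm (h.pos_ne (hW v hvW i)).symm (h.pos_ne (hW v hvW j)).symm
      (h.avoids_seg (hW w hwW j) (hwb j) (hxS i)) (h.avoids_seg (hW w hwW i) (hwb i) (hxS j))
      (h.avoids_seg (hW v hvW j) (hvb j) (hxS i)) (h.avoids_seg (hW v hvW i) (hvb i) (hxS j))
      (h.avoids_seg (hW v hvW i) (hvb i) hwS) (h.avoids_seg (hW w hwW i) (hwb i) hvS)
      (h.avoids_seg (hW v hvW j) (hvb j) hwS) (h.avoids_seg (hW w hwW j) (hwb j) hvS)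
      (hwd i j hij v (hW v hvW j) (hvb j) (hne (hW w hwW j)))
      (hvd i j hij w (hW w hwW j) (hwb j) (hne (hW v hvW j)))
  simp only [σ, Prod.mk.injEq] at hσ
  have a := hsep 0 1 (by decide) hσ.1
  have b := hsep 0 2 (by decide) hσ.2.1
  have c := hsep 1 2 (by decide) hσ.2.2
  have := mul_pos_of_neg_of_neg a b
  nlinarith [sq_nonneg (Plane.cr (D.pos (x 0)) (D.pos w) (D.pos v))]

end IsRACOn

end Layout

/-! ## Inserting a twin next to a vertex -/

open Filter Topology

namespace Plane

/-- The point `w` moved by `ε` times the vector `d`. -/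
noncomputable def shift (w d : Plane) (ε : ℝ) : Plane := w + ε • d

@[simp]
theorem shift_apply (w d : Plane) (ε : ℝ) (i : Fin 2) : shift w d ε i = w i + ε * d i := by
  simp [shift]

theorem shift_zero (w d : Plane) : shift w d 0 = w := by simp [shift]

theorem continuous_shift (w d : Plane) : Continuous (shift w d) := by
  unfold shift; fun_prop

/-- The half-open segment from `w` to `u` misses the segment from `a` to `b`. -/
def Misses (w u a b : Plane) : Prop := ∀ t, 0 ≤ t → t < 1 → pt w u t ∉ segment ℝ a b

theorem eventually_notMem {w a b : Plane} (d : Plane) (h : w ∉ segment ℝ a b) :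
    ∀ᶠ ε in 𝓝[>] (0 : ℝ), shift w d ε ∉ segment ℝ a b := by
  have hcl : IsClosed (segment ℝ a b) := by
    rw [← convexHull_pair]
    exact (Set.toFinite {a, b}).isClosed_convexHull ℝ
  have : ∀ᶠ ε in 𝓝 (0 : ℝ), shift w d ε ∈ (segment ℝ a b)ᶜ :=
    (continuous_shift w d).continuousAt.eventually
      (hcl.isOpen_compl.mem_nhds (by rw [shift_zero]; exact h))
  exact this.filter_mono nhdsWithin_le_nhds

/-- The interval is compact, so the tube lemma turns avoidance at every single `t` for ε = 0 into
avoidance for all `t` simultaneously when ε is small. -/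
theorem eventually_forall_notMem_of_isClosed {X : Type*} [TopologicalSpace X] {s : Set X}
    (hs : IsClosed s) {g : ℝ × ℝ → X} (hg : Continuous g) (h : ∀ t ∈ Set.Icc (0 : ℝ) 1, g (0, t) ∉ s) :
    ∀ᶠ ε in 𝓝[>] (0 : ℝ), ∀ t ∈ Set.Icc (0 : ℝ) 1, g (ε, t) ∉ s := by
  have hopen : IsOpen (g ⁻¹' sᶜ) := hs.isOpen_compl.preimage hg
  have hsub : ({0} : Set ℝ) ×ˢ Set.Icc (0 : ℝ) 1 ⊆ g ⁻¹' sᶜ := by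
    rintro ⟨ε, t⟩ ⟨hε, ht⟩
    obtain rfl : ε = 0 := hε
    exact h t ht
  obtain ⟨U, V, hU, -, hU0, hV, hUV⟩ := generalized_tube_lemma isCompact_singleton isCompact_Icc
    hopen hsub
  have : ∀ᶠ ε in 𝓝 (0 : ℝ), ε ∈ U := hU.mem_nhds (hU0 rfl)
  refine (this.filter_mono nhdsWithin_le_nhds).mono fun ε hε t ht => ?_
  exact hUV (Set.mk_mem_prod hε (hV ht))

theorem eventually_misses_of_disjoint {w u a b : Plane} (d : Plane)
    (h : Disjoint (segment ℝ w u) (segment ℝ a b)) :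
    ∀ᶠ ε in 𝓝[>] (0 : ℝ), Misses (shift w d ε) u a b := by
  have hcl : IsClosed (segment ℝ a b) := by
    rw [← convexHull_pair]
    exact (Set.toFinite {a, b}).isClosed_convexHull ℝ
  have hg : Continuous fun q : ℝ × ℝ => shift w d q.1 + q.2 • (u - shift w d q.1) := by
    have := (continuous_shift w d).comp (continuous_fst (X := ℝ) (Y := ℝ))
    exact this.add (continuous_snd.smul (continuous_const.sub this))
  refine (eventually_forall_notMem_of_isClosed hcl hg fun t ht hmem => ?_).mono
    fun ε hε t ht ht' => ?_
  · refine Set.disjoint_left.1 h (mem_segment_iff.2 ⟨t, ht.1, ht.2, rfl⟩) ?_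
    convert hmem using 1
    simp only [shift_zero, pt, AffineMap.lineMap_apply, vsub_eq_sub, vadd_eq_add, add_comm]
  · convert hε t ⟨ht, ht'.le⟩ using 1
    simp only [pt, AffineMap.lineMap_apply, vsub_eq_sub, vadd_eq_add, add_comm]

/-- Disjointness fails at the common end `u`, so compactness alone does not suffice. Instead `w` is
off the ray from `u` through `b`, which is an open condition and makes the half-open segment toward
`u` avoid that ray. -/
theorem eventually_misses_of_inter {w u b : Plane} (d : Plane) (hb : b ≠ u)
    (h : ∀ p ∈ segment ℝ w u, p ∈ segment ℝ u b → p = u) (hwu : w ≠ u) :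
    ∀ᶠ ε in 𝓝[>] (0 : ℝ), Misses (shift w d ε) u u b := by
  let c : ℝ → ℝ := fun ε => (shift w d ε 0 - u 0) * (b 1 - u 1) - (shift w d ε 1 - u 1) * (b 0 - u 0)
  let i : ℝ → ℝ := fun ε => (shift w d ε 0 - u 0) * (b 0 - u 0) + (shift w d ε 1 - u 1) * (b 1 - u 1)
  have hc : Continuous c := by simp only [c, shift_apply]; fun_prop
  have hi : Continuous i := by simp only [i, shift_apply]; fun_prop
  have hbpos := ne_of_sq_pos hb
  have hmiss : ∀ ε, (c ε ≠ 0 ∨ i ε < 0) → Misses (shift w d ε) u u b := by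
    intro ε hε t ht ht' hmem
    obtain ⟨s, hs, -, he⟩ := mem_segment_iff.1 hmem
    rw [ext_iff'] at he
    rw [pt_apply, pt_apply, pt_apply, pt_apply] at he
    obtain ⟨h0, h1⟩ := he
    rcases hε with hε | hε
    · apply hε
      have : (1 - t) * c ε = 0 := by
        simp only [c]
        linear_combination (b 0 - u 0) * h1 - (b 1 - u 1) * h0
      rcases mul_eq_zero.1 this with h' | h'
      · linarith
      · exact h'
    · have h₁ : (1 - t) * i ε = s * ((b 0 - u 0) ^ 2 + (b 1 - u 1) ^ 2) := by
        simp only [i]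
        linear_combination -(b 0 - u 0) * h0 - (b 1 - u 1) * h1
      have h₂ : (1 - t) * i ε < 0 := mul_neg_of_pos_of_neg (by linarith) hε
      have h₃ : 0 ≤ s * ((b 0 - u 0) ^ 2 + (b 1 - u 1) ^ 2) := mul_nonneg hs hbpos.le
      linarith
  -- If `w` were on the ray, then B(w - u) = A(b - u) with A, B > 0, and dividing by A + B yields a
  -- common point other than `u`.
  have hstart : c 0 ≠ 0 ∨ i 0 < 0 := by
    by_contra hcon
    rw [not_or, not_not, not_lt] at hcon
    obtain ⟨hc0, hi0⟩ := hcon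
    simp only [c, i, shift_zero] at hc0 hi0
    have hwpos := ne_of_sq_pos hwu
    set A := (w 0 - u 0) * (b 0 - u 0) + (w 1 - u 1) * (b 1 - u 1) with hA
    set B := (b 0 - u 0) ^ 2 + (b 1 - u 1) ^ 2 with hB
    set W := (w 0 - u 0) ^ 2 + (w 1 - u 1) ^ 2 with hW
    have hAB : A ^ 2 = W * B := by
      rw [hA, hB, hW]
      linear_combination (-((w 0 - u 0) * (b 1 - u 1) - (w 1 - u 1) * (b 0 - u 0))) * hc0
    have hApos : 0 < A := by
      rcases eq_or_lt_of_le hi0 with h' | h'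
      · rw [← h'] at hAB
        have := mul_pos hwpos hbpos
        nlinarith
      · exact h'
    have e0 : B * (w 0 - u 0) = A * (b 0 - u 0) := by
      rw [hA, hB]; linear_combination (b 1 - u 1) * hc0
    have e1 : B * (w 1 - u 1) = A * (b 1 - u 1) := by
      rw [hA, hB]; linear_combination (-(b 0 - u 0)) * hc0
    have hm : pt u w (B / (A + B)) = pt u b (A / (A + B)) := by
      have : A + B ≠ 0 := by positivity
      rw [ext_iff']
      simp only [pt_apply]
      constructor
      · field_simp; linear_combination e0
      · field_simp; linear_combination e1
    have hlt : ∀ x y : ℝ, 0 < x → 0 < y → 0 ≤ x / (x + y) ∧ x / (x + y) ≤ 1 := by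
      intro x y hx hy
      refine ⟨by positivity, ?_⟩
      rw [div_le_one (by positivity)]; linarith
    have h₁ := hlt B A hbpos hApos
    have h₂ := hlt A B hApos hbpos
    rw [add_comm B A] at h₁
    have := h (pt u w (B / (A + B))) (by
      rw [segment_symm]; exact mem_segment_iff.2 ⟨_, h₁.1, h₁.2, rfl⟩)
      (by rw [hm]; exact mem_segment_iff.2 ⟨_, h₂.1, h₂.2, rfl⟩)
    rw [ext_iff'] at this
    simp only [pt_apply] at this
    have hBA : 0 < B / (A + B) := by positivity
    apply hwu
    rw [ext_iff']
    constructor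
    · have : B / (A + B) * (w 0 - u 0) = 0 := by linarith [this.1]
      rcases mul_eq_zero.1 this with h' | h'
      · exact absurd h' hBA.ne'
      · linarith
    · have : B / (A + B) * (w 1 - u 1) = 0 := by linarith [this.2]
      rcases mul_eq_zero.1 this with h' | h'
      · exact absurd h' hBA.ne'
      · linarith
  have : ∀ᶠ ε in 𝓝 (0 : ℝ), c ε ≠ 0 ∨ i ε < 0 := by
    rcases hstart with h' | h'
    · exact (hc.continuousAt.eventually_ne h').mono fun _ => Or.inl
    · exact (hi.continuousAt.eventually (gt_mem_nhds h')).mono fun _ => Or.inr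
  exact (this.filter_mono nhdsWithin_le_nhds).mono hmiss

/-- The direction in which a vertex `w` joined to `u` and `v` by segments can be moved such that
the new segments avoid the old segments and each other. -/
theorem exists_direction {w u v : Plane} (hu : u ≠ w) (hv : v ≠ w)
    (h : ∀ s t : ℝ, 0 < s → s ≤ 1 → 0 < t → t ≤ 1 → pt w u s ≠ pt w v t) :
    ∃ d : Plane, ∀ ε, 0 < ε → ε < 1 →
      Misses (shift w d ε) u w u ∧ Misses (shift w d ε) u w v ∧ Misses (shift w d ε) v w u ∧
      Misses (shift w d ε) v w v ∧
      Disjoint (openSegment ℝ (shift w d ε) u) (openSegment ℝ (shift w d ε) v) := by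
  have hmiss : ∀ {x u a : Plane}, (∀ t r, 0 ≤ t → t < 1 → 0 ≤ r → r ≤ 1 → pt x u t = pt w a r →
      False) → Misses x u w a := by
    intro x u a hx t ht ht' hmem
    obtain ⟨r, hr, hr', he⟩ := mem_segment_iff.1 hmem
    exact hx t r ht ht' hr hr' he.symm
  have hdis : ∀ {x : Plane}, (∀ t r, 0 < t → t < 1 → 0 < r → r < 1 → pt x u t = pt x v r →
      False) → Disjoint (openSegment ℝ x u) (openSegment ℝ x v) := by
    intro x hx
    rw [Set.disjoint_left]
    intro p hp hp'
    obtain ⟨t, ht, ht', rfl⟩ := mem_openSegment_iff.1 hp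
    obtain ⟨r, hr, hr', he⟩ := mem_openSegment_iff.1 hp'
    exact hx t r ht ht' hr hr' he.symm
  by_cases hc : cr w u v = 0
  · obtain ⟨k, hk⟩ := exists_pt_of_cr_eq_zero hu.symm hc
    -- Collinear neighbors lie on opposite sides of `w`, since otherwise the two segments would
    -- overlap.
    have hk0 : k < 0 := by
      by_contra hk0
      rcases eq_or_lt_of_le (not_lt.1 hk0) with h' | h'
      · exact hv (by rw [hk, ← h', pt_zero])
      · rcases le_total k 1 with h'' | h''
        · exact h k 1 h' h'' one_pos le_rfl (by rw [pt_one, hk])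
        · refine h 1 (1 / k) one_pos le_rfl (by positivity) ?_ ?_
          · rw [div_le_one h']; exact h''
          · rw [pt_one, hk, ext_iff']
            simp only [pt_apply]
            constructor
            · field_simp; ring
            · field_simp; ring
    have hpos := ne_of_sq_pos hu
    have v0 : v 0 - w 0 = k * (u 0 - w 0) := by rw [hk, pt_apply]; ring
    have v1 : v 1 - w 1 = k * (u 1 - w 1) := by rw [hk, pt_apply]; ring
    -- Collinear case: `w` moves perpendicularly to the line. The new half-open segments stay
    -- strictly off the line, and their interiors lie on opposite sides of the perpendicular at `w`.
    refine ⟨!₂[-(u 1 - w 1), u 0 - w 0], fun ε hε hε' => ?_⟩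
    have key : ∀ t, t < 1 → (1 - t) * ε * ((u 0 - w 0) ^ 2 + (u 1 - w 1) ^ 2) = 0 → False := by
      intro t ht hz
      have : 0 < (1 - t) * ε * ((u 0 - w 0) ^ 2 + (u 1 - w 1) ^ 2) :=
        mul_pos (mul_pos (by linarith) hε) hpos
      linarith
    refine ⟨hmiss ?_, hmiss ?_, hmiss ?_, hmiss ?_, hdis ?_⟩
    · intro t r ht ht' hr hr' he
      rw [ext_iff'] at he
      simp [shift_apply] at he
      obtain ⟨h0, h1⟩ := he
      apply key t ht'
      linear_combination (u 0 - w 0) * h1 - (u 1 - w 1) * h0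
    · intro t r ht ht' hr hr' he
      rw [ext_iff'] at he
      simp [shift_apply] at he
      obtain ⟨h0, h1⟩ := he
      apply key t ht'
      linear_combination (u 0 - w 0) * h1 - (u 1 - w 1) * h0 + (u 0 - w 0) * r * v1 -
        (u 1 - w 1) * r * v0
    · intro t r ht ht' hr hr' he
      rw [ext_iff'] at he
      simp [shift_apply] at he
      obtain ⟨h0, h1⟩ := he
      apply key t ht'
      linear_combination (u 0 - w 0) * h1 - (u 1 - w 1) * h0 - (u 0 - w 0) * t * v1 +
        (u 1 - w 1) * t * v0
    · intro t r ht ht' hr hr' he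
      rw [ext_iff'] at he
      simp [shift_apply] at he
      obtain ⟨h0, h1⟩ := he
      apply key t ht'
      linear_combination (u 0 - w 0) * h1 - (u 1 - w 1) * h0 + (u 0 - w 0) * (r - t) * v1 -
        (u 1 - w 1) * (r - t) * v0
    · intro t r ht ht' hr hr' he
      rw [ext_iff'] at he
      simp [shift_apply] at he
      obtain ⟨h0, h1⟩ := he
      have hz : (t - r * k) * ((u 0 - w 0) ^ 2 + (u 1 - w 1) ^ 2) = 0 := by
        linear_combination (u 0 - w 0) * h0 + (u 1 - w 1) * h1 + (u 0 - w 0) * r * v0 +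
          (u 1 - w 1) * r * v1
      have : 0 < t - r * k := by nlinarith
      have := mul_pos this hpos
      linarith
  -- Otherwise `w` moves into the angle at `w`. In the basis u - w, v - w the points of the new
  -- half-open segments have positive coordinates, while the old segments lie on the axes. The
  -- difference of the two coordinates is positive inside the segment to `u` and negative inside the
  -- one to `v`.
  · refine ⟨!₂[(u 0 - w 0) + (v 0 - w 0), (u 1 - w 1) + (v 1 - w 1)], fun ε hε hε' => ?_⟩
    refine ⟨hmiss ?_, hmiss ?_, hmiss ?_, hmiss ?_, hdis ?_⟩
    · intro t r ht ht' hr hr' he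
      rw [ext_iff'] at he
      simp [shift_apply] at he
      obtain ⟨h0, h1⟩ := he
      have : ((1 - t) * ε) * cr w u v = 0 := by
        unfold cr
        linear_combination (u 0 - w 0) * h1 - (u 1 - w 1) * h0
      have hp : 0 < (1 - t) * ε := mul_pos (by linarith) hε
      exact (mul_ne_zero hp.ne' hc) this
    · intro t r ht ht' hr hr' he
      rw [ext_iff'] at he
      simp [shift_apply] at he
      obtain ⟨h0, h1⟩ := he
      have : ((1 - t) * ε + t) * cr w u v = 0 := by
        unfold cr
        linear_combination (v 1 - w 1) * h0 - (v 0 - w 0) * h1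
      have hp : 0 < (1 - t) * ε + t := by nlinarith
      exact (mul_ne_zero hp.ne' hc) this
    · intro t r ht ht' hr hr' he
      rw [ext_iff'] at he
      simp [shift_apply] at he
      obtain ⟨h0, h1⟩ := he
      have : ((1 - t) * ε + t) * cr w u v = 0 := by
        unfold cr
        linear_combination (u 0 - w 0) * h1 - (u 1 - w 1) * h0
      have hp : 0 < (1 - t) * ε + t := by nlinarith
      exact (mul_ne_zero hp.ne' hc) this
    · intro t r ht ht' hr hr' he
      rw [ext_iff'] at he
      simp [shift_apply] at he
      obtain ⟨h0, h1⟩ := he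
      have : ((1 - t) * ε) * cr w u v = 0 := by
        unfold cr
        linear_combination (v 1 - w 1) * h0 - (v 0 - w 0) * h1
      have hp : 0 < (1 - t) * ε := mul_pos (by linarith) hε
      exact (mul_ne_zero hp.ne' hc) this
    · intro t r ht ht' hr hr' he
      rw [ext_iff'] at he
      simp [shift_apply] at he
      obtain ⟨h0, h1⟩ := he
      have hz : ((1 - t) * ε + t - (1 - r) * ε) * cr w u v = 0 := by
        unfold cr
        linear_combination (v 1 - w 1) * h0 - (v 0 - w 0) * h1
      have hz' : ((1 - t) * ε - (1 - r) * ε - r) * cr w u v = 0 := by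
        unfold cr
        linear_combination (u 0 - w 0) * h1 - (u 1 - w 1) * h0
      have e₁ := (mul_eq_zero.1 hz).resolve_right hc
      have e₂ := (mul_eq_zero.1 hz').resolve_right hc
      have : t = -r := by linarith
      linarith

end Plane

namespace Layout

namespace IsRACOn

variable {V : Type} {D : Layout V} {S : Set V} {E : Finset (Sym2 V)} (h : D.IsRACOn S E)
include h

/-! ### Polylines near a vertex. -/

theorem eq_zero_of_corner_zero_mem {e : Sym2 V} (he : e ∈ E) {i : ℕ} (hi : i ≤ D.bends e)
    (hm : D.corner e 0 ∈ polySegment (D.corner e) i) : i = 0 := by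
  by_contra h0
  have hl : D.corner e 0 ∈ polySegment (D.corner e) 0 := left_mem_segment ℝ _ _
  rcases (by omega : i = 1 ∨ 1 < i) with rfl | h1
  · have := h.consecutive e he 0 (by omega)
    have hm' : D.corner e 0 ∈ polySegment (D.corner e) 0 ∩ polySegment (D.corner e) (0 + 1) :=
      ⟨hl, hm⟩
    rw [this] at hm'
    exact h.nondegenerate e he 0 (by omega) hm'
  · exact Set.disjoint_left.1 (h.disjoint e he 0 i (by omega) hi) hl hm

theorem eq_bends_of_corner_last_mem {e : Sym2 V} (he : e ∈ E) {i : ℕ} (hi : i ≤ D.bends e)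
    (hm : D.corner e (D.bends e + 1) ∈ polySegment (D.corner e) i) : i = D.bends e := by
  by_contra h0
  have hl : D.corner e (D.bends e + 1) ∈ polySegment (D.corner e) (D.bends e) :=
    right_mem_segment ℝ _ _
  rcases (by omega : i + 1 = D.bends e ∨ i + 1 < D.bends e) with h1 | h1
  · have := h.consecutive e he i (by omega)
    rw [h1] at this
    have hm' : D.corner e (D.bends e + 1) ∈ polySegment (D.corner e) i ∩
      polySegment (D.corner e) (D.bends e) := ⟨hm, hl⟩
    rw [this] at hm'
    exact h.nondegenerate e he _ le_rfl hm'.symm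
  · exact Set.disjoint_left.1 (h.disjoint e he i _ h1 le_rfl) hm hl

theorem mem_int_or_eq_pos {e : Sym2 V} (he : e ∈ E) {p : Plane}
    (hp : p ∈ polyline (D.corner e) (D.bends e)) : p ∈ D.int e ∨ ∃ z ∈ e, p = D.pos z := by
  obtain ⟨u, v, rfl, h₁, h₂⟩ := h.joins e he
  by_cases hu : p = D.pos u
  · exact Or.inr ⟨u, Sym2.mem_mk_left _ _, hu⟩
  by_cases hv : p = D.pos v
  · exact Or.inr ⟨v, Sym2.mem_mk_right _ _, hv⟩
  refine Or.inl ⟨hp, ?_⟩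
  rw [h₁, h₂]
  rintro (h' | h')
  · exact hu h'
  · exact hv h'

theorem notMem_polyline {e : Sym2 V} (he : e ∈ E) {w : V} (hw : w ∈ S) (hwe : w ∉ e) :
    D.pos w ∉ polyline (D.corner e) (D.bends e) := by
  intro hp
  rcases h.mem_int_or_eq_pos he hp with hp | ⟨z, hz, hp⟩
  · exact h.avoids e he w hw hwe hp
  · exact hwe (h.pos_injOn hw (h.mem_of_mem e he z hz) hp ▸ hz)

theorem pos_notMem_int {e : Sym2 V} (he : e ∈ E) {u : V} (hu : u ∈ S) : D.pos u ∉ D.int e := by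
  by_cases hue : u ∈ e
  · obtain ⟨a, b, rfl, h₁, h₂⟩ := h.joins e he
    rintro ⟨-, hp⟩
    apply hp
    rw [h₁, h₂]
    rcases Sym2.mem_iff.1 hue with rfl | rfl
    · exact Or.inl rfl
    · exact Or.inr rfl
  · exact h.avoids e he u hu hue

theorem eq_of_mem_segment {w u z : V} (hwu : s(w, u) ∈ E) (hb : D.bends s(w, u) = 0) (hz : z ∈ S)
    (hm : D.pos z ∈ segment ℝ (D.pos w) (D.pos u)) : z = w ∨ z = u := by
  rw [← insert_endpoints_openSegment] at hm
  rcases hm with hm | hm | hm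
  · exact Or.inl (h.pos_injOn hz (h.left_mem hwu) hm)
  · exact Or.inr (h.pos_injOn hz (h.right_mem hwu) hm)
  · have := h.pos_notMem_int hwu hz
    rw [h.int_eq hwu hb] at this
    exact absurd hm this

/-- The closed segment from `w` to `u` meets the edge `e` at most in `u`. If a segment of `e` is
disjoint from it, compactness suffices. Otherwise `u` is an end of `e`, and by simplicity of the
polyline the segment in question is the one that ends at `u`. -/
theorem eventually_misses {w u : V} (hwu : s(w, u) ∈ E) (hb : D.bends s(w, u) = 0) {e : Sym2 V}
    (he : e ∈ E) (hwe : w ∉ e) (hdis : Disjoint (D.int s(w, u)) (D.int e)) {i : ℕ}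
    (hi : i ≤ D.bends e) (d : Plane) :
    ∀ᶠ ε in 𝓝[>] (0 : ℝ), Plane.Misses (Plane.shift (D.pos w) d ε) (D.pos u) (D.corner e i)
      (D.corner e (i + 1)) := by
  have hu := h.right_mem hwu
  have hw := h.left_mem hwu
  have huniq : ∀ p ∈ segment ℝ (D.pos w) (D.pos u), p ∈ polySegment (D.corner e) i →
      p = D.pos u ∧ u ∈ e := by
    intro p hp hp'
    rcases h.mem_int_or_eq_pos he ⟨i, hi, hp'⟩ with hpe | ⟨z, hz, rfl⟩
    · rw [← insert_endpoints_openSegment] at hp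
      rcases hp with rfl | rfl | hp
      · exact absurd hpe (h.pos_notMem_int he hw)
      · exact absurd hpe (h.pos_notMem_int he hu)
      · rw [h.int_eq hwu hb] at hdis
        exact absurd hpe (Set.disjoint_left.1 hdis hp)
    · rcases h.eq_of_mem_segment hwu hb (h.mem_of_mem e he z hz) hp with rfl | rfl
      · exact absurd hz hwe
      · exact ⟨rfl, hz⟩
  by_cases hd : Disjoint (segment ℝ (D.pos w) (D.pos u)) (polySegment (D.corner e) i)
  · exact Plane.eventually_misses_of_disjoint d hd
  obtain ⟨p, hp, hp'⟩ := Set.not_disjoint_iff.1 hd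
  obtain ⟨rfl, hue⟩ := huniq p hp hp'
  have huniq' : ∀ p ∈ segment ℝ (D.pos w) (D.pos u), p ∈ polySegment (D.corner e) i → p = D.pos u :=
    fun p hp hp' => (huniq p hp hp').1
  have hnd := h.nondegenerate e he i hi
  have hends : D.corner e i = D.pos u ∨ D.corner e (i + 1) = D.pos u := by
    obtain ⟨a, b, rfl, h₁, h₂⟩ := h.joins e he
    rcases Sym2.mem_iff.1 hue with rfl | rfl
    · rw [← h₁] at hp'
      obtain rfl := h.eq_zero_of_corner_zero_mem he hi hp'
      exact Or.inl h₁
    · rw [← h₂] at hp'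
      obtain rfl := h.eq_bends_of_corner_last_mem he hi hp'
      exact Or.inr h₂
  unfold polySegment at huniq'
  rcases hends with h₁ | h₁
  · rw [h₁] at huniq' hnd ⊢
    exact Plane.eventually_misses_of_inter d hnd.symm huniq' (h.pos_ne hwu)
  · rw [h₁] at huniq' hnd ⊢
    unfold Plane.Misses
    rw [segment_symm ℝ (D.corner e i)] at huniq' ⊢
    exact Plane.eventually_misses_of_inter d hnd huniq' (h.pos_ne hwu)

open Classical in
/-- A new vertex can be placed at a point from which the new edges can be drawn as segments without
crossings. -/
theorem exists_insert_of_point {x : V} (hx : x ∉ S) {N : Finset V} (hNS : ∀ u ∈ N, u ∈ S)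
    (p : Plane) (hpos : ∀ v ∈ S, D.pos v ≠ p)
    (havoid : ∀ e ∈ E, p ∉ polyline (D.corner e) (D.bends e))
    (hnew : ∀ u ∈ N, ∀ e ∈ E, Disjoint (openSegment ℝ p (D.pos u)) (D.int e))
    (hvert : ∀ u ∈ N, ∀ v ∈ S, D.pos v ∉ openSegment ℝ p (D.pos u))
    (hpair : ∀ u ∈ N, ∀ v ∈ N, u ≠ v →
      Disjoint (openSegment ℝ p (D.pos u)) (openSegment ℝ p (D.pos v))) :
    ∃ D' : Layout V, D'.IsRACOn (insert x S) (E ∪ N.image fun u => s(x, u)) ∧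
      (∀ e ∈ E, D'.bends e = D.bends e ∧ D'.int e = D.int e) ∧
      ∀ u ∈ N, D'.bends s(x, u) = 0 ∧ ∀ e ∈ E, Disjoint (D'.int s(x, u)) (D'.int e) := by
  have hxe : ∀ e ∈ E, x ∉ e := fun e he hxe => hx (h.mem_of_mem e he x hxe)
  have hxN : ∀ u ∈ N, u ≠ x := fun u hu hux => hx (hux ▸ hNS u hu)
  let D' : Layout V :=
    { pos := Function.update D.pos x p
      bends := fun e => if x ∈ e then 0 else D.bends e
      corner := fun e => if hxe : x ∈ e then fun i => if i = 0 then p else D.pos (Sym2.Mem.other hxe)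
        else D.corner e }
  have hposx : D'.pos x = p := Function.update_self (f := D.pos) x p
  have hposS : ∀ v, v ≠ x → D'.pos v = D.pos v := fun v hv => Function.update_of_ne hv _ _
  have hbE : ∀ e ∈ E, D'.bends e = D.bends e := fun e he => if_neg (hxe e he)
  have hcE : ∀ e ∈ E, D'.corner e = D.corner e := fun e he => dif_neg (hxe e he)
  have hiE : ∀ e ∈ E, D'.int e = D.int e := fun e he => by unfold int; rw [hbE e he, hcE e he]
  have hbN : ∀ u, D'.bends s(x, u) = 0 := fun u => if_pos (Sym2.mem_mk_left x u)
  have hcN : ∀ u i, D'.corner s(x, u) i = if i = 0 then p else D.pos u := by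
    intro u i
    have hm := Sym2.mem_mk_left x u
    have ho : Sym2.Mem.other hm = u := Sym2.congr_right.1 (Sym2.other_spec hm)
    have : D'.corner s(x, u) = fun i => if i = 0 then p else D.pos (Sym2.Mem.other hm) := dif_pos hm
    rw [this, ho]
  have hiN : ∀ u ∈ N, D'.int s(x, u) = openSegment ℝ p (D.pos u) := by
    intro u hu
    unfold int polylineInt
    rw [hbN, polyline_zero, hcN, hcN]
    exact segment_diff (hpos u (hNS u hu)).symm
  have hdEN : ∀ u ∈ N, ∀ e ∈ E, Disjoint (D'.int s(x, u)) (D'.int e) := by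
    intro u hu e he
    rw [hiN u hu, hiE e he]
    exact hnew u hu e he
  refine ⟨D', ⟨?_, ?_, ?_, ?_, ?_, ?_, ?_, ?_, ?_, ?_⟩, fun e he => ⟨hbE e he, hiE e he⟩,
    fun u hu => ⟨hbN u, hdEN u hu⟩⟩
  all_goals
    try
      intro e he
      rw [Finset.mem_union, Finset.mem_image] at he
  · rcases he with he | ⟨u, hu, rfl⟩
    · exact fun v hv => Or.inr (h.mem_of_mem e he v hv)
    · intro v hv
      rcases Sym2.mem_iff.1 hv with rfl | rfl
      · exact Or.inl rfl
      · exact Or.inr (hNS _ hu)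
  · rcases he with he | ⟨u, hu, rfl⟩
    · exact h.not_isDiag e he
    · rw [Sym2.mk_isDiag_iff]
      exact (hxN u hu).symm
  · have hne : ∀ v ∈ S, v ≠ x := fun v hv hvx => hx (hvx ▸ hv)
    rintro a (rfl | ha) b (rfl | hb) hab
    · rfl
    · rw [hposx, hposS b (hne b hb)] at hab
      exact absurd hab.symm (hpos b hb)
    · rw [hposx, hposS a (hne a ha)] at hab
      exact absurd hab (hpos a ha)
    · rw [hposS a (hne a ha), hposS b (hne b hb)] at hab
      exact h.pos_injOn ha hb hab
  · rcases he with he | ⟨u, hu, rfl⟩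
    · obtain ⟨u, v, rfl, h₁, h₂⟩ := h.joins e he
      refine ⟨u, v, rfl, ?_⟩
      rw [hcE _ he, hbE _ he, h₁, h₂, hposS, hposS]
      · exact ⟨rfl, rfl⟩
      · rintro rfl; exact hxe _ he (Sym2.mem_mk_right _ _)
      · rintro rfl; exact hxe _ he (Sym2.mem_mk_left _ _)
    · refine ⟨x, u, rfl, ?_⟩
      rw [hbN, hcN, hcN, hposx, hposS u (hxN u hu)]
      exact ⟨rfl, rfl⟩
  · rcases he with he | ⟨u, hu, rfl⟩
    · rw [hcE e he, hbE e he]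
      exact h.nondegenerate e he
    · intro i hi
      rw [hbN] at hi
      obtain rfl : i = 0 := by omega
      rw [hcN, hcN]
      exact (hpos u (hNS u hu)).symm
  · rcases he with he | ⟨u, hu, rfl⟩
    · rw [hcE e he, hbE e he]
      exact h.consecutive e he
    · intro i hi
      rw [hbN] at hi
      omega
  · rcases he with he | ⟨u, hu, rfl⟩
    · rw [hcE e he, hbE e he]
      exact h.angle_ne e he
    · intro i hi
      rw [hbN] at hi
      omega
  · rcases he with he | ⟨u, hu, rfl⟩
    · rw [hcE e he, hbE e he]
      exact h.disjoint e he
    · intro i j hi hj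
      rw [hbN] at hj
      omega
  · rcases he with he | ⟨u, hu, rfl⟩
    · rw [hiE e he]
      rintro v (rfl | hv) hve
      · rw [hposx]
        exact fun hp => havoid e he hp.1
      · rw [hposS v (fun hvx => hx (hvx ▸ hv))]
        exact h.avoids e he v hv hve
    · rw [hiN u hu]
      rintro v (rfl | hv) hve
      · exact absurd (Sym2.mem_mk_left _ _) hve
      · rw [hposS v (fun hvx => hx (hvx ▸ hv))]
        exact hvert u hu v hv
  · intro f hf hne q hq
    rw [Finset.mem_union, Finset.mem_image] at hf
    rcases he with he | ⟨u, hu, rfl⟩ <;> rcases hf with hf | ⟨v, hv, rfl⟩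
    · rw [hiE e he, hiE f hf] at hq
      rw [hcE e he, hcE f hf, hbE e he, hbE f hf]
      exact h.rac e he f hf hne q hq
    · exact absurd hq.1 (Set.disjoint_left.1 (hdEN v hv e he) hq.2)
    · exact absurd hq.2 (Set.disjoint_left.1 (hdEN u hu f hf) hq.1)
    · have huv : u ≠ v := fun huv => hne (by rw [huv])
      rw [hiN u hu, hiN v hv] at hq
      exact absurd hq.2 (Set.disjoint_left.1 (hpair u hu v hv huv) hq.1)

-- With two neighbors this is `exists_direction`. Degrees zero and one are reduced to trivial or
-- fictitious configurations, so that the insertion can treat all degrees alike.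
omit h in
theorem exists_direction_aux (w : Plane) {N : Finset V} (pos : V → Plane) (hN : N.card ≤ 2)
    (hne : ∀ u ∈ N, pos u ≠ w)
    (hpt : ∀ u ∈ N, ∀ v ∈ N, u ≠ v → ∀ s t : ℝ, 0 < s → s ≤ 1 → 0 < t → t ≤ 1 →
      Plane.pt w (pos u) s ≠ Plane.pt w (pos v) t) :
    ∃ d : Plane, ∀ ε, 0 < ε → ε < 1 → Plane.shift w d ε ≠ w ∧
      (∀ u ∈ N, ∀ v ∈ N, Plane.Misses (Plane.shift w d ε) (pos u) w (pos v)) ∧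
      ∀ u ∈ N, ∀ v ∈ N, u ≠ v → Disjoint (openSegment ℝ (Plane.shift w d ε) (pos u))
        (openSegment ℝ (Plane.shift w d ε) (pos v)) := by
  have hself : ∀ {w' u : Plane}, Plane.Misses w' u w u → w' ≠ w := by
    rintro w' u hm rfl
    have := hm 0 le_rfl one_pos
    rw [Plane.pt_zero] at this
    exact this (left_mem_segment ℝ _ _)
  have hsingle : ∀ u : Plane, u ≠ w → ∃ d : Plane, ∀ ε, 0 < ε → ε < 1 →
      Plane.Misses (Plane.shift w d ε) u w u := by
    intro u hu
    have hpos := Plane.ne_of_sq_pos hu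
    -- A single neighbor is supplemented by its reflection in `w`, which lies in the opposite
    -- direction.
    have hv : ∀ s t : ℝ, 0 < s → 0 < t → Plane.pt w u s ≠ Plane.pt w (Plane.pt w u (-1)) t := by
      intro s t hs ht he
      rw [Plane.ext_iff'] at he
      simp only [Plane.pt_apply] at he
      have : (s + t) * ((u 0 - w 0) ^ 2 + (u 1 - w 1) ^ 2) = 0 := by
        linear_combination (u 0 - w 0) * he.1 + (u 1 - w 1) * he.2
      exact (mul_pos (add_pos hs ht) hpos).ne' this
    obtain ⟨d, hd⟩ := Plane.exists_direction hu (v := Plane.pt w u (-1)) (by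
      intro he
      rw [Plane.ext_iff'] at he
      simp only [Plane.pt_apply] at he
      apply hu
      rw [Plane.ext_iff']
      constructor <;> linarith [he.1, he.2]) (fun s t hs _ ht _ => hv s t hs ht)
    exact ⟨d, fun ε hε hε' => (hd ε hε hε').1⟩
  rcases (by omega : N.card = 0 ∨ N.card = 1 ∨ N.card = 2) with h0 | h1 | h2
  · obtain rfl := Finset.card_eq_zero.1 h0
    refine ⟨!₂[1, 0], fun ε hε _ => ⟨fun he => ?_, by simp, by simp⟩⟩
    rw [Plane.ext_iff'] at he
    simp at he
    exact hε.ne' he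
  · obtain ⟨u, rfl⟩ := Finset.card_eq_one.1 h1
    obtain ⟨d, hd⟩ := hsingle (pos u) (hne u (by simp))
    refine ⟨d, fun ε hε hε' => ⟨hself (hd ε hε hε'), ?_, ?_⟩⟩
    · intro a ha b hb
      rw [Finset.mem_singleton] at ha hb
      rw [ha, hb]
      exact hd ε hε hε'
    · intro a ha b hb hab
      rw [Finset.mem_singleton] at ha hb
      exact absurd (ha.trans hb.symm) hab
  · classical
    obtain ⟨u, v, huv, rfl⟩ := Finset.card_eq_two.1 h2
    obtain ⟨d, hd⟩ := Plane.exists_direction (hne u (by simp)) (hne v (by simp))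
      (hpt u (by simp) v (by simp) huv)
    refine ⟨d, fun ε hε hε' => ?_⟩
    obtain ⟨huu, huv', hvu, hvv, hdis⟩ := hd ε hε hε'
    refine ⟨hself huu, ?_, ?_⟩
    · intro a ha b hb
      rw [Finset.mem_insert, Finset.mem_singleton] at ha hb
      rcases ha with rfl | rfl <;> rcases hb with rfl | rfl <;> assumption
    · intro a ha b hb hab
      rw [Finset.mem_insert, Finset.mem_singleton] at ha hb
      rcases ha with rfl | rfl <;> rcases hb with rfl | rfl
      · exact absurd rfl hab
      · exact hdis
      · exact hdis.symm
      · exact absurd rfl hab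

open Classical in
/-- A vertex of degree at most two, whose edges are segments without crossings, can be
duplicated. -/
theorem exists_insert [Finite V] {w x : V} (hw : w ∈ S) (hx : x ∉ S) {N : Finset V}
    (hN : N.card ≤ 2) (hNE : ∀ u, s(w, u) ∈ E ↔ u ∈ N)
    (hclean : ∀ u ∈ N, D.bends s(w, u) = 0 ∧
      ∀ f ∈ E, f ≠ s(w, u) → Disjoint (D.int s(w, u)) (D.int f)) :
    ∃ D' : Layout V, D'.IsRACOn (insert x S) (E ∪ N.image fun u => s(x, u)) ∧
      (∀ e ∈ E, D'.bends e = D.bends e ∧ D'.int e = D.int e) ∧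
      ∀ u ∈ N, D'.bends s(x, u) = 0 ∧ ∀ e ∈ E, Disjoint (D'.int s(x, u)) (D'.int e) := by
  have hE : ∀ u ∈ N, s(w, u) ∈ E := fun u hu => (hNE u).2 hu
  have hne : ∀ u ∈ N, D.pos u ≠ D.pos w := fun u hu => (h.pos_ne (hE u hu)).symm
  -- The edges at `w` do not cross each other, so their segments have only `w` in common; the choice
  -- of the direction requires this.
  have hmem : ∀ u ∈ N, ∀ t : ℝ, 0 < t → t ≤ 1 → ∀ v ∈ N, u ≠ v →
      Plane.pt (D.pos w) (D.pos u) t ∉ segment ℝ (D.pos w) (D.pos v) := by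
    intro u hu t ht ht' v hv huv hm
    rcases eq_or_lt_of_le ht' with rfl | ht'
    · rw [Plane.pt_one] at hm
      rcases h.eq_of_mem_segment (hE v hv) (hclean v hv).1 (h.right_mem (hE u hu)) hm with h' | h'
      · exact h.ne (hE u hu) h'.symm
      · exact huv h'
    · have hi : Plane.pt (D.pos w) (D.pos u) t ∈ D.int s(w, u) := by
        rw [h.int_eq (hE u hu) (hclean u hu).1]
        exact Plane.pt_mem_openSegment _ _ ht ht'
      rw [← insert_endpoints_openSegment] at hm
      rcases hm with hm | hm | hm
      · rw [hm] at hi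
        exact h.pos_notMem_int (hE u hu) hw hi
      · rw [hm] at hi
        exact h.pos_notMem_int (hE u hu) (h.right_mem (hE v hv)) hi
      · refine Set.disjoint_left.1 ((hclean u hu).2 _ (hE v hv) ?_) hi ?_
        · intro he
          exact huv (Sym2.congr_right.1 he).symm
        · rw [h.int_eq (hE v hv) (hclean v hv).1]
          exact hm
  obtain ⟨d, hd⟩ := exists_direction_aux (D.pos w) D.pos hN hne (by
    intro u hu v hv huv s t hs hs' ht ht' he
    refine hmem u hu s hs hs' v hv huv ?_
    rw [he]
    exact Plane.mem_segment_iff.2 ⟨t, ht.le, ht', rfl⟩)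
  -- Edges away from `w` are avoided for small ε. Edges at `w` start where the new point tends to,
  -- so no smallness helps against them; there the direction `d` is what matters.
  have ev_edge : ∀ᶠ ε in 𝓝[>] (0 : ℝ), ∀ e ∈ E, w ∉ e → ∀ i ∈ Finset.range (D.bends e + 1),
      Plane.shift (D.pos w) d ε ∉ segment ℝ (D.corner e i) (D.corner e (i + 1)) ∧
      ∀ u ∈ N, Plane.Misses (Plane.shift (D.pos w) d ε) (D.pos u) (D.corner e i)
        (D.corner e (i + 1)) := by
    rw [Filter.eventually_all_finset]
    intro e he
    by_cases hwe : w ∈ e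
    · exact Eventually.of_forall fun ε h' => absurd hwe h'
    have : ∀ᶠ ε in 𝓝[>] (0 : ℝ), ∀ i ∈ Finset.range (D.bends e + 1),
      Plane.shift (D.pos w) d ε ∉ segment ℝ (D.corner e i) (D.corner e (i + 1)) ∧
      ∀ u ∈ N, Plane.Misses (Plane.shift (D.pos w) d ε) (D.pos u) (D.corner e i)
        (D.corner e (i + 1)) := by
      rw [Filter.eventually_all_finset]
      intro i hi
      have hi' : i ≤ D.bends e := by rw [Finset.mem_range] at hi; omega
      refine (Plane.eventually_notMem d fun hm => h.notMem_polyline he hw hwe ⟨i, hi', hm⟩).and ?_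
      rw [Filter.eventually_all_finset]
      intro u hu
      refine h.eventually_misses (hE u hu) (hclean u hu).1 he hwe
        ((hclean u hu).2 e he ?_) hi' d
      rintro rfl
      exact hwe (Sym2.mem_mk_left _ _)
    exact this.mono fun ε hε _ => hε
  -- Vertices are treated as degenerate segments. They need separate care because isolated vertices
  -- lie on no edge.
  have ev_vert : ∀ᶠ ε in 𝓝[>] (0 : ℝ), ∀ v : V, v ∈ S → v ≠ w →
      Plane.shift (D.pos w) d ε ∉ segment ℝ (D.pos v) (D.pos v) ∧
      ∀ u ∈ N, u ≠ v → Plane.Misses (Plane.shift (D.pos w) d ε) (D.pos u) (D.pos v) (D.pos v) := by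
    rw [Filter.eventually_all]
    intro v
    by_cases hv : v ∈ S ∧ v ≠ w
    · have h₁ : D.pos w ∉ segment ℝ (D.pos v) (D.pos v) := by
        rw [segment_same]
        exact fun h' => hv.2 (h.pos_injOn hv.1 hw h'.symm)
      have h₂ : ∀ᶠ ε in 𝓝[>] (0 : ℝ), ∀ u ∈ N, u ≠ v →
          Plane.Misses (Plane.shift (D.pos w) d ε) (D.pos u) (D.pos v) (D.pos v) := by
        rw [Filter.eventually_all_finset]
        intro u hu
        by_cases huv : u = v
        · exact Eventually.of_forall fun ε h' => absurd huv h'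
        · refine (Plane.eventually_misses_of_disjoint d ?_).mono fun ε hε _ => hε
          rw [segment_same, Set.disjoint_singleton_right]
          intro hm
          rcases h.eq_of_mem_segment (hE u hu) (hclean u hu).1 hv.1 hm with h' | h'
          · exact hv.2 h'
          · exact huv h'.symm
      exact ((Plane.eventually_notMem d h₁).and h₂).mono fun ε hε _ _ => hε
    · exact Eventually.of_forall fun ε h₁ h₂ => absurd ⟨h₁, h₂⟩ hv
  have ev_lt : ∀ᶠ ε in 𝓝[>] (0 : ℝ), ε ∈ Set.Ioo (0 : ℝ) 1 := Ioo_mem_nhdsGT one_pos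
  obtain ⟨ε, ⟨hedge, hvert⟩, hε, hε'⟩ := ((ev_edge.and ev_vert).and ev_lt).exists
  obtain ⟨hself, hmiss, hpair⟩ := hd ε hε hε'
  set p := Plane.shift (D.pos w) d ε with hp
  have hvert0 : ∀ v ∈ S, D.pos v ≠ p := by
    intro v hv he
    by_cases hvw : v = w
    · exact hself (by rw [← he, hvw])
    · exact (hvert v hv hvw).1 (by rw [he]; exact left_mem_segment ℝ _ _)
  have hwe : ∀ e ∈ E, w ∈ e → ∃ v ∈ N, e = s(w, v) := by
    intro e he hwe
    obtain ⟨v, rfl⟩ := hwe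
    exact ⟨v, (hNE v).1 he, rfl⟩
  have hpoly : ∀ u ∈ N, ∀ e ∈ E, ∀ t, 0 ≤ t → t < 1 →
      Plane.pt p (D.pos u) t ∉ polyline (D.corner e) (D.bends e) := by
    rintro u hu e he t ht ht' ⟨i, hi, hm⟩
    by_cases hw' : w ∈ e
    · obtain ⟨v, hv, rfl⟩ := hwe e he hw'
      have hb := (hclean v hv).1
      rw [hb] at hi
      obtain rfl : i = 0 := by omega
      have hj := h.joins' he
      rw [hb] at hj
      refine hmiss u hu v hv t ht ht' ?_
      unfold polySegment at hm
      rcases hj with ⟨h₁, h₂⟩ | ⟨h₁, h₂⟩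
      · rw [h₁, h₂] at hm; exact hm
      · rw [h₁, h₂, segment_symm] at hm; exact hm
    · exact (hedge e he hw' i (by rw [Finset.mem_range]; omega)).2 u hu t ht ht' hm
  refine h.exists_insert_of_point hx (fun u hu => h.right_mem (hE u hu)) p hvert0 ?_ ?_ ?_ hpair
  · rintro e he ⟨i, hi, hm⟩
    by_cases hw' : w ∈ e
    · obtain ⟨v, hv, rfl⟩ := hwe e he hw'
      refine hpoly v hv _ he 0 le_rfl one_pos ?_
      rw [Plane.pt_zero]
      exact ⟨i, hi, hm⟩
    · exact (hedge e he hw' i (by rw [Finset.mem_range]; omega)).1 hm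
  · intro u hu e he
    rw [Set.disjoint_left]
    intro q hq hq'
    obtain ⟨t, ht, ht', rfl⟩ := Plane.mem_openSegment_iff.1 hq
    exact hpoly u hu e he t ht.le ht' hq'.1
  · intro u hu v hv hq
    obtain ⟨t, ht, ht', he⟩ := Plane.mem_openSegment_iff.1 hq
    by_cases huv : u = v
    · subst huv
      rw [← he] at hq
      exact hvert0 u hv (right_mem_openSegment_iff.1 (he ▸ hq)).symm
    · by_cases hvw : v = w
      · refine hmiss u hu u hu t ht.le ht' ?_
        rw [he, hvw]
        exact left_mem_segment ℝ _ _
      · refine (hvert v hv hvw).2 u hu huv t ht.le ht' ?_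
        rw [he]
        exact left_mem_segment ℝ _ _

end IsRACOn

end Layout

/-! ## Extending a layout to twins -/

namespace SimpleGraph

variable {V : Type} (G : SimpleGraph V)

theorem Twin.refl (a : V) : G.Twin a a := fun _ _ _ => Iff.rfl

variable {G}

theorem Twin.symm {a b : V} (h : G.Twin a b) : G.Twin b a := fun c h₁ h₂ => (h c h₂ h₁).symm

theorem Twin.trans {a b c : V} (h : G.Twin a b) (h' : G.Twin b c) : G.Twin a c := by
  by_cases hab : a = b
  · rwa [hab]
  by_cases hbc : b = c
  · rwa [← hbc]
  intro d hda hdc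
  -- The middle vertex is the only one about which the two hypotheses do not speak directly;
  -- adjacency of `a` to it is carried over to `c` through the pair `a`, `c`.
  by_cases hdb : d = b
  · subst hdb
    by_cases hac : a = c
    · rw [hac]
    · rw [G.adj_comm a d, h' a hab hac, G.adj_comm c a, h c (Ne.symm hac) (Ne.symm hbc)]
      exact G.adj_comm d c
  · exact (h d hda hdb).trans (h' d hdb hdc)

theorem Twin.adj_iff {a b c : V} (h : G.Twin a b) (ha : c ≠ a) (hb : c ≠ b) :
    G.Adj a c ↔ G.Adj b c := h c ha hb

open Classical in
/-- The edges of a graph between vertices of a given set. -/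
noncomputable def edgesOn [Fintype V] (G : SimpleGraph V) (S : Finset V) : Finset (Sym2 V) :=
  Finset.univ.filter fun e => e ∈ G.edgeSet ∧ ∀ v ∈ e, v ∈ S

theorem mem_edgesOn [Fintype V] {S : Finset V} {u v : V} :
    s(u, v) ∈ G.edgesOn S ↔ G.Adj u v ∧ u ∈ S ∧ v ∈ S := by
  simp [edgesOn]

theorem mem_edgesOn' [Fintype V] {S : Finset V} {e : Sym2 V} :
    e ∈ G.edgesOn S ↔ e ∈ G.edgeSet ∧ ∀ v ∈ e, v ∈ S := by
  simp [edgesOn]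

open Classical in
/-- The vertices of a set that are twins of a given vertex. -/
noncomputable def twinsIn (G : SimpleGraph V) (K : Finset V) (w : V) : Finset V :=
  K.filter fun v => G.Twin v w

theorem mem_twinsIn {K : Finset V} {v w : V} : v ∈ G.twinsIn K w ↔ v ∈ K ∧ G.Twin v w := by
  simp [twinsIn]

theorem twinsIn_congr {K : Finset V} {v w : V} (h : G.Twin v w) : G.twinsIn K v = G.twinsIn K w := by
  ext x
  rw [mem_twinsIn, mem_twinsIn]
  exact ⟨fun hx => ⟨hx.1, hx.2.trans h⟩, fun hx => ⟨hx.1, hx.2.trans h.symm⟩⟩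

open Classical in
/-- The vertices of a set with few twins in this set. -/
noncomputable def fewTwins (G : SimpleGraph V) (K : Finset V) (b : ℕ) : Finset V :=
  K.filter fun w => (G.twinsIn K w).card ≤ b + 57

end SimpleGraph

namespace Layout.IsRACOn

open SimpleGraph

variable {V : Type} [Fintype V] {G : SimpleGraph V} {D : Layout V} {K : Finset V} {b : ℕ}

section

variable (h : D.IsRACOn (K : Set V) (G.edgesOn K)) (hb : ∑ e ∈ G.edgesOn K, D.bends e ≤ b)
include h hb

/-- Three neighbors of `w` would be common neighbors of all twins of `w` in `K` except possibly
themselves, which is more than b + 57 - 3 = b + 54 vertices. -/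
theorem card_neighbors_le {w : V} (hbig : b + 57 < (G.twinsIn K w).card)
    {N : Finset V} (hN : ∀ u ∈ N, u ∈ K ∧ G.Adj w u) : N.card ≤ 2 := by
  classical
  by_contra hcon
  obtain ⟨x, y, z, hx, hy, hz, hxy, hxz, hyz⟩ := Finset.two_lt_card_iff.1 (not_le.1 hcon)
  let f : Fin 3 → V := ![x, y, z]
  have hf : Function.Injective f := by
    intro i j hij
    fin_cases i <;> fin_cases j <;> simp_all [f]
  have hfN : ∀ i, f i ∈ N := by
    intro i
    fin_cases i <;> simpa [f]
  have hcard : (G.twinsIn K w).card ≤ ((G.twinsIn K w) \ {x, y, z}).card + 3 := by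
    have h₁ := Finset.card_le_card_sdiff_add_card (s := G.twinsIn K w) (t := ({x, y, z} : Finset V))
    have h₂ : ({x, y, z} : Finset V).card ≤ 3 := Finset.card_le_three
    omega
  have := h.card_common_le hb hf ((G.twinsIn K w) \ {x, y, z}) (by
    intro v hv i
    rw [Finset.mem_sdiff, mem_twinsIn] at hv
    obtain ⟨hiK, hadj⟩ := hN _ (hfN i)
    refine mem_edgesOn.2 ⟨?_, hiK, hv.1.1⟩
    rw [G.adj_comm, hv.1.2.adj_iff ?_ hadj.ne']
    · exact hadj
    · rintro rfl
      apply hv.2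
      fin_cases i <;> simp [f])
  omega

/-- One adjacent pair makes the whole class a clique, which would give `w` far more than two
neighbors. -/
theorem not_adj_twin {v w : V} (hbig : b + 57 < (G.twinsIn K w).card)
    (hvw : G.Twin v w) : ¬ G.Adj v w := by
  classical
  intro hadj
  have hN := h.card_neighbors_le hb hbig (N := (G.twinsIn K w).erase w) (by
    intro u hu
    rw [Finset.mem_erase, mem_twinsIn] at hu
    refine ⟨hu.2.1, ?_⟩
    by_cases huv : u = v
    · rw [huv]; exact hadj.symm
    · rw [G.adj_comm, (hu.2.2.trans hvw.symm).adj_iff (Ne.symm hu.1) hadj.ne']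
      exact hadj)
  have := Finset.pred_card_le_card_erase (s := G.twinsIn K w) (a := w)
  omega

/-- All twins of `u` in `K` are neighbors of `w` too, and `w` has at most two of them. -/
theorem card_twinsIn_le {u w : V} (hbig : b + 57 < (G.twinsIn K w).card)
    (hadj : G.Adj w u) : (G.twinsIn K u).card ≤ 2 := by
  have hnt : ¬ G.Twin u w := fun ht => h.not_adj_twin hb hbig ht hadj.symm
  refine h.card_neighbors_le hb hbig fun v hv => ?_
  rw [mem_twinsIn] at hv
  refine ⟨hv.1, ?_⟩
  rw [G.adj_comm, hv.2.adj_iff ?_ hadj.ne]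
  · exact hadj.symm
  · rintro rfl
    exact hnt hv.2.symm

theorem fewTwins_cover {e : Sym2 V} (he : e ∈ G.edgesOn K) : ∃ x ∈ G.fewTwins K b, x ∈ e := by
  induction e using Sym2.ind with
  | _ u v =>
    obtain ⟨hadj, hu, hv⟩ := mem_edgesOn.1 he
    by_cases hbig : (G.twinsIn K u).card ≤ b + 57
    · exact ⟨u, by simp [fewTwins, hu, hbig], Sym2.mem_mk_left _ _⟩
    · have := h.card_twinsIn_le hb (not_le.1 hbig) hadj
      refine ⟨v, ?_, Sym2.mem_mk_right _ _⟩
      simp only [fewTwins, Finset.mem_filter]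
      exact ⟨hv, by omega⟩

/-- One of many twins of degree at most two has only straight edges without crossings. -/
theorem exists_clean {X : Finset V} (hX : ∀ e ∈ G.edgesOn K, ∃ x ∈ X, x ∈ e) {N W : Finset V}
    (hN : N.card ≤ 2) (hNW : ∀ w ∈ W, ∀ u ∈ N, s(w, u) ∈ G.edgesOn K)
    (hW : 5 * b + 6 * X.card < W.card) :
    ∃ w ∈ W, ∀ u ∈ N, D.bends s(w, u) = 0 ∧
      ∀ f ∈ G.edgesOn K, f ≠ s(w, u) → Disjoint (D.int s(w, u)) (D.int f) := by
  classical
  by_contra hcon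
  push Not at hcon
  let A := W.filter fun w => ∃ u ∈ N, D.bends s(u, w) ≠ 0
  let B : V → Finset V := fun u => W.filter fun w => D.bends s(u, w) = 0 ∧
    ∃ f ∈ G.edgesOn K, f ≠ s(u, w) ∧ ∃ p, p ∈ D.seg u w ∧ p ∈ D.int f
  have hNW' : ∀ w ∈ W, ∀ u ∈ N, s(u, w) ∈ G.edgesOn K := fun w hw u hu => by
    rw [Sym2.eq_swap]; exact hNW w hw u hu
  have hA : A.card ≤ b := by
    refine h.card_bent_vertices_le hb N A (fun w hw => ?_) fun w hw => (Finset.mem_filter.1 hw).2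
    exact hNW' w (Finset.mem_filter.1 hw).1
  have hB : ∀ u ∈ N, (B u).card ≤ 3 * X.card + 2 * b := by
    intro u hu
    refine h.card_crossed_le hb hX u (B u) fun w hw => ?_
    obtain ⟨hw, h₁, h₂⟩ := Finset.mem_filter.1 hw
    exact ⟨hNW' w hw u hu, h₁, h₂⟩
  -- Without a clean vertex, every element of `W` has a bent edge (at most `b` elements) or a
  -- crossed straight edge to one of at most two neighbors (at most 3|X| + 2b elements for each).
  have hsub : W ⊆ A ∪ N.biUnion B := by
    intro w hw
    rw [Finset.mem_union, Finset.mem_biUnion]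
    by_cases hwA : w ∈ A
    · exact Or.inl hwA
    right
    have hst : ∀ u ∈ N, D.bends s(u, w) = 0 := by
      intro u hu
      by_contra hne
      exact hwA (Finset.mem_filter.2 ⟨hw, u, hu, hne⟩)
    obtain ⟨u, hu, hcr⟩ := hcon w hw
    rw [Sym2.eq_swap] at hcr
    obtain ⟨f, hf, hfne, hnd⟩ := hcr (hst u hu)
    obtain ⟨p, hp, hp'⟩ := Set.not_disjoint_iff.1 hnd
    rw [h.int_eq (hNW' w hw u hu) (hst u hu)] at hp
    exact ⟨u, hu, Finset.mem_filter.2 ⟨hw, hst u hu, f, hf, hfne, p, hp, hp'⟩⟩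
  have h₁ := (Finset.card_le_card hsub).trans (Finset.card_union_le _ _)
  have h₂ := Finset.card_biUnion_le_card_mul N B _ hB
  have h₃ : N.card * (3 * X.card + 2 * b) ≤ 2 * (3 * X.card + 2 * b) := Nat.mul_le_mul_right _ hN
  omega

/-- Every vertex with many twins in `K` has a twin in `K` that can be duplicated. -/
theorem exists_clean_twin (hmany : ∀ x ∉ K, b + 57 < (G.twinsIn K x).card) {x : V} (hxK : x ∉ K)
    (h₂ : 5 * b + 6 * (G.fewTwins K b).card < (G.twinsIn K x).card) :
    ∃ w ∈ K, ∃ N : Finset V, N.card ≤ 2 ∧ (∀ u, G.Adj w u ↔ u ∈ N) ∧ (∀ u, G.Adj x u ↔ u ∈ N) ∧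
      (∀ u ∈ N, u ∈ K) ∧ ∀ u ∈ N, D.bends s(w, u) = 0 ∧
      ∀ f ∈ G.edgesOn K, f ≠ s(w, u) → Disjoint (D.int s(w, u)) (D.int f) := by
  classical
  have h₁ := hmany x hxK
  let N := Finset.univ.filter fun u => G.Adj x u
  have hbig : ∀ w, G.Twin w x → b + 57 < (G.twinsIn K w).card := by
    intro w hw
    rw [twinsIn_congr hw]
    exact h₁
  have hNadj : ∀ w, w ∈ K → G.Twin w x → ∀ u, G.Adj w u ↔ u ∈ N := by
    intro w hwK hw u
    have hN : u ∈ N ↔ G.Adj x u := by simp [N]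
    rw [hN]
    by_cases hux : u = x
    · subst hux
      refine iff_of_false (fun ha => ?_) (G.loopless.irrefl _)
      exact h.not_adj_twin hb (hbig w hw) hw.symm ha.symm
    by_cases huw : u = w
    · subst huw
      exact iff_of_false (G.loopless.irrefl _) (h.not_adj_twin hb (hbig u hw) hw.symm)
    exact hw.adj_iff huw hux
  -- A neighbor of a large class has at most two twins in `K`, whereas a deleted vertex has many, so
  -- no neighbor was deleted.
  have hmem : ∀ u ∈ N, u ∈ K := by
    intro u hu
    obtain ⟨w, hw⟩ := Finset.card_pos.1 (by omega : 0 < (G.twinsIn K x).card)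
    rw [mem_twinsIn] at hw
    have hadj := (hNadj w hw.1 hw.2 u).2 hu
    by_contra huK
    have h₃ := h.card_twinsIn_le hb (hbig w hw.2) hadj
    have h₄ := hmany u huK
    omega
  have hNcard : N.card ≤ 2 := by
    obtain ⟨w, hw⟩ := Finset.card_pos.1 (by omega : 0 < (G.twinsIn K x).card)
    rw [mem_twinsIn] at hw
    exact h.card_neighbors_le hb (hbig w hw.2) fun u hu =>
      ⟨hmem u hu, (hNadj w hw.1 hw.2 u).2 hu⟩
  obtain ⟨w, hw, hclean⟩ := h.exists_clean hb (fun e he => h.fewTwins_cover hb he) hNcard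
    (W := G.twinsIn K x) (fun w hw u hu => by
      rw [mem_twinsIn] at hw
      exact mem_edgesOn.2 ⟨(hNadj w hw.1 hw.2 u).2 hu, hw.1, hmem u hu⟩) h₂
  rw [mem_twinsIn] at hw
  exact ⟨w, hw.1, N, hNcard, hNadj w hw.1 hw.2, fun u => by simp [N], hmem, hclean⟩

/-- A layout of the vertices in `K` extends to all vertices if all other vertices have many twins
in `K`. -/
theorem exists_extension (hmany : ∀ x ∉ K, b + 57 < (G.twinsIn K x).card)
    (hmany' : ∀ x ∉ K, 5 * b + 6 * (G.fewTwins K b).card < (G.twinsIn K x).card) :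
    ∃ D' : Layout V, D'.IsRACOn Set.univ (G.edgesOn Finset.univ) ∧
      (∀ e ∈ G.edgesOn K, D'.bends e = D.bends e) ∧
      ∀ e ∈ G.edgesOn Finset.univ, e ∉ G.edgesOn K → D'.bends e = 0 := by
  classical
  -- The invariant for inserting vertices one by one: the edges of `K` stay as drawn and no new edge
  -- crosses them. So a vertex that is clean in the given layout remains clean, and may serve as a
  -- model for any number of twins.
  suffices hT : ∀ T : Finset V, Disjoint T K → ∃ D' : Layout V,
      D'.IsRACOn ((K ∪ T : Finset V) : Set V) (G.edgesOn (K ∪ T)) ∧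
      (∀ e ∈ G.edgesOn K, D'.bends e = D.bends e ∧ D'.int e = D.int e) ∧
      ∀ f ∈ G.edgesOn (K ∪ T), f ∉ G.edgesOn K → D'.bends f = 0 ∧
        ∀ e ∈ G.edgesOn K, Disjoint (D'.int f) (D'.int e) by
    obtain ⟨D', hD, h₁, h₂⟩ := hT Kᶜ (disjoint_compl_left)
    rw [Finset.union_compl] at hD h₂
    rw [Finset.coe_univ] at hD
    exact ⟨D', hD, fun e he => (h₁ e he).1, fun e he he' => (h₂ e he he').1⟩
  intro T
  induction T using Finset.induction_on with
  | empty =>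
    intro _
    rw [Finset.union_empty]
    exact ⟨D, h, fun e _ => ⟨rfl, rfl⟩, fun f hf hf' => absurd hf hf'⟩
  | insert x T hxT ih =>
    intro hdis
    rw [Finset.disjoint_insert_left] at hdis
    obtain ⟨D', hD, h₁, h₂⟩ := ih hdis.2
    obtain ⟨w, hwK, N, hN, hwN, hxN, hNK, hclean⟩ :=
      h.exists_clean_twin hb hmany hdis.1 (hmany' x hdis.1)
    have hmono : ∀ {e}, e ∈ G.edgesOn K → e ∈ G.edgesOn (K ∪ T) := by
      intro e he
      rw [mem_edgesOn'] at he ⊢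
      exact ⟨he.1, fun v hv => Finset.mem_union_left _ (he.2 v hv)⟩
    have hwe : ∀ u ∈ N, s(w, u) ∈ G.edgesOn K := fun u hu =>
      mem_edgesOn.2 ⟨(hwN u).2 hu, hwK, hNK u hu⟩
    obtain ⟨D'', hD', h₁', h₂'⟩ := hD.exists_insert (w := w) (x := x)
      (Finset.mem_coe.2 (Finset.mem_union_left _ hwK))
      (by
        rw [Finset.mem_coe, Finset.mem_union, not_or]
        exact ⟨hdis.1, hxT⟩) hN
      (fun u => by
        rw [mem_edgesOn, hwN]
        exact ⟨fun h' => h'.1, fun h' => ⟨h', Finset.mem_union_left _ hwK,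
          Finset.mem_union_left _ (hNK u h')⟩⟩)
      (fun u hu => by
        rw [(h₁ _ (hwe u hu)).1, (h₁ _ (hwe u hu)).2]
        refine ⟨(hclean u hu).1, fun f hf hne => ?_⟩
        by_cases hfK : f ∈ G.edgesOn K
        · rw [(h₁ f hfK).2]
          exact (hclean u hu).2 f hfK hne
        · have := (h₂ f hf hfK).2 _ (hwe u hu)
          rw [(h₁ _ (hwe u hu)).2] at this
          exact this.symm)
    have hset : ((K ∪ insert x T : Finset V) : Set V) = insert x ((K ∪ T : Finset V) : Set V) := by
      rw [Finset.union_insert, Finset.coe_insert]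
    have hedge : G.edgesOn (K ∪ insert x T) = G.edgesOn (K ∪ T) ∪ N.image fun u => s(x, u) := by
      ext e
      induction e using Sym2.ind with
      | _ p q =>
        rw [Finset.mem_union, Finset.mem_image, mem_edgesOn, mem_edgesOn, Finset.union_insert]
        simp only [Finset.mem_insert]
        constructor
        · rintro ⟨hadj, rfl | hp, hq⟩
          · exact Or.inr ⟨q, (hxN q).1 hadj, rfl⟩
          · rcases hq with rfl | hq
            · exact Or.inr ⟨p, (hxN p).1 hadj.symm, Sym2.eq_swap⟩
            · exact Or.inl ⟨hadj, hp, hq⟩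
        · rintro (⟨hadj, hp, hq⟩ | ⟨u, hu, hpq⟩)
          · exact ⟨hadj, Or.inr hp, Or.inr hq⟩
          · have hadj := (hxN u).2 hu
            have huK := Finset.mem_union_left T (hNK u hu)
            rcases Sym2.eq_iff.1 hpq with ⟨rfl, rfl⟩ | ⟨rfl, rfl⟩
            · exact ⟨hadj, Or.inl rfl, Or.inr huK⟩
            · exact ⟨hadj.symm, Or.inr huK, Or.inl rfl⟩
    refine ⟨D'', ?_, fun e he => ?_, fun f hf hfK => ?_⟩
    · rw [hset, hedge]
      exact hD'
    · rw [(h₁' e (hmono he)).1, (h₁' e (hmono he)).2]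
      exact h₁ e he
    · rw [hedge, Finset.mem_union, Finset.mem_image] at hf
      rcases hf with hf | ⟨u, hu, rfl⟩
      · rw [(h₁' f hf).1, (h₁' f hf).2]
        refine ⟨(h₂ f hf hfK).1, fun e he => ?_⟩
        rw [(h₁' e (hmono he)).2]
        exact (h₂ f hf hfK).2 e he
      · exact ⟨(h₂' u hu).1, fun e he => (h₂' u hu).2 e (hmono he)⟩

end

end Layout.IsRACOn

/-! ## Layouts and drawings -/

section Transport

open SimpleGraph

variable {V V' : Type} {G : SimpleGraph V} {g : V' → V}

/-- The edge of `G` that corresponds to an edge of the graph that `G` induces along `g`. -/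
def SimpleGraph.comapEdge (G : SimpleGraph V) (g : V' → V) (e : (G.comap g).edgeSet) : G.edgeSet :=
  ⟨Sym2.map g e, by
    obtain ⟨e, he⟩ := e
    induction e using Sym2.ind with
    | _ a b => simpa using he⟩

theorem SimpleGraph.comapEdge_injective (hg : Function.Injective g) :
    Function.Injective (G.comapEdge g) := fun _ _ hef =>
  Subtype.ext (Sym2.map.injective hg (congrArg Subtype.val hef))

/-- A drawing of `G` restricts to an induced subgraph. -/
theorem AdmitsRACDrawing.comap [Fintype V] [Fintype V'] (hg : Function.Injective g) {b : ℕ}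
    {β : G.edgeSet → Fin 4} (h : AdmitsRACDrawing G b β) :
    AdmitsRACDrawing (G.comap g) b (fun e => β (G.comapEdge g e)) := by
  classical
  obtain ⟨D, hD, hb, hβ⟩ := h
  let D' : PolylineDrawing (G.comap g) :=
    { pos := fun v => D.pos (g v)
      bends := fun e => D.bends (G.comapEdge g e)
      corner := fun e => D.corner (G.comapEdge g e)
      pos_injective := D.pos_injective.comp hg
      joins := by
        intro e
        obtain ⟨u, v, he, h₁, h₂⟩ := D.joins (G.comapEdge g e)
        obtain ⟨e, hm⟩ := e
        induction e using Sym2.ind with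
        | _ p q =>
          rcases Sym2.eq_iff.1 (show s(g p, g q) = s(u, v) from he) with ⟨rfl, rfl⟩ | ⟨rfl, rfl⟩
          · exact ⟨p, q, rfl, h₁, h₂⟩
          · exact ⟨q, p, Sym2.eq_swap, h₁, h₂⟩
      nondegenerate := fun e => D.nondegenerate _
      consecutive := fun e => D.consecutive _
      angle_ne := fun e => D.angle_ne _
      disjoint := fun e => D.disjoint _
      avoids := by
        intro e v hv
        refine D.avoids _ _ fun hm => hv ?_
        obtain ⟨w, hw, hwv⟩ := Sym2.mem_map.1 hm
        rwa [← hg hwv] }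
  refine ⟨D', ?_, ?_, fun e => hβ _⟩
  · intro e f hef
    exact hD _ _ fun h' => hef (comapEdge_injective hg h')
  · refine le_trans ?_ hb
    change ∑ e, D.bends (G.comapEdge g e) ≤ _
    rw [← Finset.sum_image (s := Finset.univ) (g := G.comapEdge g) (f := D.bends)
      (fun e _ f _ hef => comapEdge_injective hg hef)]
    exact Finset.sum_le_sum_of_subset (Finset.subset_univ _)

/-- A layout of all vertices and edges is a drawing. -/
theorem Layout.IsRACOn.admits [Fintype V] {D : Layout V} {b : ℕ}
    (h : D.IsRACOn Set.univ (G.edgesOn Finset.univ)) {β : G.edgeSet → Fin 4}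
    (hb : ∑ e ∈ G.edgesOn Finset.univ, D.bends e ≤ b) (hβ : ∀ e : G.edgeSet, D.bends e ≤ β e) :
    AdmitsRACDrawing G b β := by
  classical
  have hm : ∀ e : G.edgeSet, (e : Sym2 V) ∈ G.edgesOn Finset.univ := fun e =>
    mem_edgesOn'.2 ⟨e.2, fun v _ => Finset.mem_univ v⟩
  let D' : PolylineDrawing G :=
    { pos := D.pos
      bends := fun e => D.bends e
      corner := fun e => D.corner e
      pos_injective := Set.injOn_univ.1 h.pos_injOn
      joins := fun e => h.joins e (hm e)
      nondegenerate := fun e => h.nondegenerate e (hm e)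
      consecutive := fun e => h.consecutive e (hm e)
      angle_ne := fun e => h.angle_ne e (hm e)
      disjoint := fun e => h.disjoint e (hm e)
      avoids := fun e v hv => h.avoids e (hm e) v (Set.mem_univ v) hv }
  refine ⟨D', fun e f hef => h.rac e (hm e) f (hm f) fun h' => hef (Subtype.ext h'), ?_, hβ⟩
  refine le_trans (le_of_eq ?_) hb
  change ∑ e : G.edgeSet, D.bends e = _
  rw [← Finset.sum_image (s := Finset.univ) (g := ((↑) : G.edgeSet → Sym2 V)) (f := D.bends)
    (fun e _ f _ hef => Subtype.ext hef)]
  congr 1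
  ext e
  simp only [Finset.mem_image, Finset.mem_univ, true_and, mem_edgesOn', implies_true, and_true]
  exact ⟨fun ⟨f, hf⟩ => hf ▸ f.2, fun he => ⟨⟨e, he⟩, rfl⟩⟩

/-- A drawing of an induced subgraph is a layout of some of the vertices and edges. -/
theorem PolylineDrawing.exists_layout [Fintype V] [DecidableEq V] [Fintype V']
    [Fintype (G.comap g).edgeSet]
    (hg : Function.Injective g) (D : PolylineDrawing (G.comap g)) (hD : D.IsRAC) :
    ∃ L : Layout V, L.IsRACOn ((Finset.univ.image g : Finset V) : Set V)
      (G.edgesOn (Finset.univ.image g)) ∧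
      ∑ e ∈ G.edgesOn (Finset.univ.image g), L.bends e = ∑ e, D.bends e ∧
      (∀ e, L.bends (G.comapEdge g e) = D.bends e) ∧
      ∀ e ∈ G.edgesOn (Finset.univ.image g), ∃ e', e = G.comapEdge g e' := by
  let emb : (G.comap g).edgeSet → Sym2 V := fun e => G.comapEdge g e
  have hemb : Function.Injective emb := Subtype.val_injective.comp (comapEdge_injective hg)
  -- Values off the image of the embedding are junk and never inspected, because a layout is only
  -- constrained on the given vertices and edges.
  let L : Layout V :=
    { pos := Function.extend g D.pos 0
      bends := Function.extend emb D.bends 0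
      corner := Function.extend emb D.corner 0 }
  have hp : ∀ v, L.pos (g v) = D.pos v := fun v => hg.extend_apply _ _ v
  have hb : ∀ e, L.bends (emb e) = D.bends e := fun e => hemb.extend_apply _ _ e
  have hc : ∀ e, L.corner (emb e) = D.corner e := fun e => hemb.extend_apply _ _ e
  have hmem : ∀ e, e ∈ G.edgesOn (Finset.univ.image g) ↔ ∃ e', emb e' = e := by
    intro e
    constructor
    · intro he
      induction e using Sym2.ind with
      | _ u v =>
        obtain ⟨hadj, hu, hv⟩ := mem_edgesOn.1 he
        obtain ⟨p, -, rfl⟩ := Finset.mem_image.1 hu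
        obtain ⟨q, -, rfl⟩ := Finset.mem_image.1 hv
        exact ⟨⟨s(p, q), hadj⟩, rfl⟩
    · rintro ⟨⟨e, he⟩, rfl⟩
      induction e using Sym2.ind with
      | _ p q =>
        exact mem_edgesOn.2 ⟨he, Finset.mem_image_of_mem _ (Finset.mem_univ _),
          Finset.mem_image_of_mem _ (Finset.mem_univ _)⟩
  have hvm : ∀ (e : (G.comap g).edgeSet) (v : V), v ∈ emb e ↔ ∃ w ∈ (e : Sym2 V'), g w = v :=
    fun e v => Sym2.mem_map
  refine ⟨L, ⟨?_, ?_, ?_, ?_, ?_, ?_, ?_, ?_, ?_, ?_⟩, ?_, hb, fun e he => ?_⟩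
  all_goals try
    intro e he
    obtain ⟨e, rfl⟩ := (hmem e).1 he
  · intro v hv
    obtain ⟨w, -, rfl⟩ := (hvm e v).1 hv
    exact Finset.mem_coe.2 (Finset.mem_image_of_mem _ (Finset.mem_univ _))
  · exact G.not_isDiag_of_mem_edgeSet (G.comapEdge g e).2
  · rw [Finset.coe_image, Finset.coe_univ, Set.image_univ]
    rintro _ ⟨a, rfl⟩ _ ⟨c, rfl⟩ hac
    rw [hp, hp] at hac
    rw [D.pos_injective hac]
  · obtain ⟨u, v, he', h₁, h₂⟩ := D.joins e
    refine ⟨g u, g v, ?_, ?_⟩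
    · change Sym2.map g e = _
      rw [he']
      rfl
    · rw [hc, hb, hp, hp]
      exact ⟨h₁, h₂⟩
  · rw [hc, hb]
    exact D.nondegenerate e
  · rw [hc, hb]
    exact D.consecutive e
  · rw [hc, hb]
    exact D.angle_ne e
  · rw [hc, hb]
    exact D.disjoint e
  · rw [Finset.coe_image, Finset.coe_univ, Set.image_univ]
    rintro _ ⟨v, rfl⟩ hv
    rw [Layout.int, hc, hb, hp]
    exact D.avoids e v fun h' => hv ((hvm e _).2 ⟨v, h', rfl⟩)
  · intro f hf hef
    obtain ⟨f, rfl⟩ := (hmem f).1 hf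
    rw [Layout.int, Layout.int, hc, hb, hc, hb]
    exact hD e f fun h' => hef (by rw [h'])
  · have : G.edgesOn (Finset.univ.image g) = Finset.univ.image emb := by
      ext e
      rw [hmem]
      simp
    rw [this, Finset.sum_image fun e _ f _ hef => hemb hef]
    exact Finset.sum_congr rfl fun e _ => hb e
  · obtain ⟨e', rfl⟩ := (hmem e).1 he
    exact ⟨e', rfl⟩

/-- A drawing of an induced subgraph yields a drawing of the graph, if all other vertices have
many twins in the subgraph. -/
theorem AdmitsRACDrawing.of_comap [Fintype V] [DecidableEq V] [Fintype V']
    (hg : Function.Injective g) {b : ℕ} {β : G.edgeSet → Fin 4}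
    (hmany : ∀ x ∉ Finset.univ.image g, b + 57 < (G.twinsIn (Finset.univ.image g) x).card)
    (hmany' : ∀ x ∉ Finset.univ.image g, 5 * b + 6 * (G.fewTwins (Finset.univ.image g) b).card <
      (G.twinsIn (Finset.univ.image g) x).card)
    (h : AdmitsRACDrawing (G.comap g) b (fun e => β (G.comapEdge g e))) :
    AdmitsRACDrawing G b β := by
  classical
  obtain ⟨D, hD, hb, hβ⟩ := h
  obtain ⟨L, hL, hsum, hbends, hedge⟩ := D.exists_layout hg hD
  have hb' : ∑ e ∈ G.edgesOn (Finset.univ.image g), L.bends e ≤ b := by rw [hsum]; exact hb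
  obtain ⟨L', hL', h₁, h₂⟩ := hL.exists_extension hb' hmany hmany'
  refine hL'.admits (le_trans (le_of_eq ?_) hb') fun e => ?_
  · rw [← Finset.sum_congr rfl h₁]
    refine (Finset.sum_subset ?_ fun e he he' => h₂ e he he').symm
    intro e he
    rw [mem_edgesOn'] at he ⊢
    exact ⟨he.1, fun v _ => Finset.mem_univ v⟩
  · by_cases he : (e : Sym2 V) ∈ G.edgesOn (Finset.univ.image g)
    · obtain ⟨e', he'⟩ := hedge e he
      obtain rfl : e = G.comapEdge g e' := Subtype.ext he'
      rw [h₁ _ he, hbends]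
      exact hβ e'
    · rw [h₂ e (mem_edgesOn'.2 ⟨e.2, fun v _ => Finset.mem_univ v⟩) he]
      exact Nat.zero_le _

end Transport

/-! ## Correctness and size of the kernel -/

namespace SimpleGraph

/-! ### Ranks inside the twin classes and the number of classes. -/

section Count

variable {n : ℕ} {G : SimpleGraph (Fin n)}

theorem Twin.twinRank_lt {i j : Fin n} (h : G.Twin i j) (hij : i < j) : G.twinRank j < G.twinRank i := by
  classical
  refine Finset.card_lt_card ((Finset.ssubset_iff_of_subset ?_).2 ⟨j, ?_, ?_⟩)
  · intro k hk
    rw [Finset.mem_filter] at hk ⊢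
    exact ⟨hk.1, hij.trans hk.2.1, hk.2.2.trans h.symm⟩
  · rw [Finset.mem_filter]
    exact ⟨Finset.mem_univ _, hij, h.symm⟩
  · simp

theorem Twin.eq_of_twinRank_eq {i j : Fin n} (h : G.Twin i j) (hr : G.twinRank i = G.twinRank j) :
    i = j := by
  rcases lt_trichotomy i j with hij | hij | hij
  · have := h.twinRank_lt hij; omega
  · exact hij
  · have := h.symm.twinRank_lt hij; omega

theorem twinRank_injOn (K : Finset (Fin n)) (x : Fin n) :
    Set.InjOn G.twinRank (G.twinsIn K x : Set (Fin n)) := by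
  intro i hi j hj hij
  rw [Finset.mem_coe, mem_twinsIn] at hi hj
  exact (hi.2.trans hj.2.symm).eq_of_twinRank_eq hij

theorem card_twinsIn_le_of_twinRank_lt {K : Finset (Fin n)} {m : ℕ} (hK : ∀ i ∈ K, G.twinRank i < m)
    (x : Fin n) : (G.twinsIn K x).card ≤ m := by
  have := Finset.card_le_card_of_injOn (t := Finset.range m) G.twinRank
    (fun i hi => by
      rw [Finset.mem_coe, Finset.mem_range]
      exact hK i (mem_twinsIn.1 (Finset.mem_coe.1 hi)).1)
    (twinRank_injOn K x)
  rwa [Finset.card_range] at this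

/-- Ranks are injective on a class and smaller than its cardinality, so they are exactly 0, 1, 2, …
without gaps. A vertex of rank at least `m` thus has twins of all ranks below `m`, and these belong
to `K`. -/
theorem le_card_twinsIn {K : Finset (Fin n)} {m : ℕ} (hK : ∀ i, G.twinRank i < m → i ∈ K)
    {x : Fin n} (hx : m ≤ G.twinRank x) : m ≤ (G.twinsIn K x).card := by
  classical
  set C := G.twinsIn Finset.univ x with hC
  have hlt : ∀ i ∈ C, G.twinRank i < C.card := by
    intro i hi
    rw [mem_twinsIn] at hi
    refine Finset.card_lt_card ((Finset.ssubset_iff_of_subset ?_).2 ⟨i, ?_, ?_⟩)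
    · intro k hk
      rw [Finset.mem_filter] at hk
      exact mem_twinsIn.2 ⟨Finset.mem_univ _, hk.2.2.trans hi.2⟩
    · exact mem_twinsIn.2 hi
    · simp
  have himage : C.image G.twinRank = Finset.range C.card := by
    refine Finset.eq_of_subset_of_card_le ?_ ?_
    · intro r hr
      obtain ⟨i, hi, rfl⟩ := Finset.mem_image.1 hr
      exact Finset.mem_range.2 (hlt i hi)
    · rw [Finset.card_range, Finset.card_image_of_injOn (twinRank_injOn Finset.univ x)]
  have hxC := hlt x (mem_twinsIn.2 ⟨Finset.mem_univ _, Twin.refl G x⟩)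
  have hsub : Finset.range m ⊆ (G.twinsIn K x).image G.twinRank := by
    intro r hr
    rw [Finset.mem_range] at hr
    have : r ∈ C.image G.twinRank := by rw [himage, Finset.mem_range]; omega
    obtain ⟨i, hi, rfl⟩ := Finset.mem_image.1 this
    exact Finset.mem_image_of_mem _ (mem_twinsIn.2 ⟨hK i hr, (mem_twinsIn.1 hi).2⟩)
  calc m = (Finset.range m).card := (Finset.card_range m).symm
    _ ≤ _ := Finset.card_le_card hsub
    _ ≤ _ := Finset.card_image_le

/-- The last vertex of a class has rank zero. As ranks are injective on classes, the vertices of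
rank zero represent each class once. -/
theorem exists_twin_twinRank_eq_zero (G : SimpleGraph (Fin n)) (i : Fin n) :
    ∃ j, G.twinRank j = 0 ∧ G.Twin i j := by
  classical
  have hi : i ∈ G.twinsIn Finset.univ i := mem_twinsIn.2 ⟨Finset.mem_univ _, Twin.refl G i⟩
  have hmax := Finset.max'_mem _ ⟨i, hi⟩
  refine ⟨(G.twinsIn Finset.univ i).max' ⟨i, hi⟩, ?_, (mem_twinsIn.1 hmax).2.symm⟩
  rw [twinRank, Finset.card_eq_zero, Finset.filter_eq_empty_iff]
  rintro k - ⟨hlt, hk⟩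
  have := Finset.le_max' _ k (mem_twinsIn.2 ⟨Finset.mem_univ _, hk.trans (mem_twinsIn.1 hmax).2⟩)
  exact absurd this (not_le.2 hlt)

/-- Double counting along the map to the representative of rank zero. -/
theorem card_le_numTwinClasses_mul {S : Finset (Fin n)} {c : ℕ}
    (hS : ∀ i, (G.twinsIn S i).card ≤ c) : S.card ≤ G.numTwinClasses * c := by
  classical
  choose f hf hft using G.exists_twin_twinRank_eq_zero
  rw [mul_comm]
  refine Finset.card_le_mul_card_image_of_maps_to (f := f) (fun i _ => ?_) c fun r _ => ?_
  · exact Finset.mem_filter.2 ⟨Finset.mem_univ _, hf i⟩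
  · refine (Finset.card_le_card fun i hi => ?_).trans (hS r)
    obtain ⟨hiS, rfl⟩ := Finset.mem_filter.1 hi
    exact mem_twinsIn.2 ⟨hiS, hft i⟩

theorem card_fewTwins_le (K : Finset (Fin n)) (b : ℕ) :
    (G.fewTwins K b).card ≤ G.numTwinClasses * (b + 57) := by
  classical
  refine card_le_numTwinClasses_mul fun i => ?_
  by_cases he : G.twinsIn (G.fewTwins K b) i = ∅
  · rw [he]; exact Nat.zero_le _
  obtain ⟨w, hw⟩ := Finset.nonempty_iff_ne_empty.2 he
  obtain ⟨hw, hwi⟩ := mem_twinsIn.1 hw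
  obtain ⟨-, hc⟩ := Finset.mem_filter.1 hw
  rw [twinsIn_congr hwi] at hc
  refine (Finset.card_le_card fun v hv => ?_).trans hc
  obtain ⟨hv, hvi⟩ := mem_twinsIn.1 hv
  exact mem_twinsIn.2 ⟨(Finset.mem_filter.1 hv).1, hvi⟩

theorem twin_of_neighborSet_eq {a b : Fin n}
    (h : G.neighborSet a \ {b} = G.neighborSet b \ {a}) : G.Twin a b := by
  intro c ha hb
  have := Set.ext_iff.1 h c
  simpa [ha, hb] using this

theorem neighborhoodDiversity_spec {V : Type} (G : SimpleGraph V) :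
    ∃ r : Setoid V, Nat.card (Quotient r) = neighborhoodDiversity G ∧
      ∀ a b : V, r a b → G.neighborSet a \ {b} = G.neighborSet b \ {a} := by
  refine Nat.sInf_mem (s := {k : ℕ | ∃ r : Setoid V, Nat.card (Quotient r) = k ∧
    ∀ a b : V, r a b → G.neighborSet a \ {b} = G.neighborSet b \ {a}}) ⟨_, ⊥, rfl, fun a b hab => ?_⟩
  obtain rfl : a = b := hab
  rfl

/-- The parts of an admissible partition consist of twins, so no part contains two vertices of rank
zero. -/
theorem numTwinClasses_le (G : SimpleGraph (Fin n)) :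
    G.numTwinClasses ≤ neighborhoodDiversity G := by
  classical
  obtain ⟨r, hr, hrG⟩ := neighborhoodDiversity_spec G
  rw [← hr, Nat.card_eq_fintype_card, ← Finset.card_univ]
  refine Finset.card_le_card_of_injOn (fun i => (⟦i⟧ : Quotient r)) (fun i _ => Finset.mem_univ _) ?_
  intro i hi j hj hij
  rw [Finset.mem_coe, Finset.mem_filter] at hi hj
  exact (twin_of_neighborSet_eq (hrG i j (Quotient.exact hij))).eq_of_twinRank_eq
    (hi.2.trans hj.2.symm)

theorem numTwinClasses_pos (G : SimpleGraph (Fin n)) (hn : 0 < n) : 0 < G.numTwinClasses := by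
  classical
  obtain ⟨j, hj, -⟩ := G.exists_twin_twinRank_eq_zero ⟨0, hn⟩
  exact Finset.card_pos.2 ⟨j, Finset.mem_filter.2 ⟨Finset.mem_univ _, hj⟩⟩

theorem neighborhoodDiversity_le (G : SimpleGraph (Fin n)) : neighborhoodDiversity G ≤ n := by
  refine (Nat.sInf_le (s := {k : ℕ | ∃ r : Setoid (Fin n), Nat.card (Quotient r) = k ∧
    ∀ a b, r a b → G.neighborSet a \ {b} = G.neighborSet b \ {a}}) ⟨⊥, rfl, fun a b hab => ?_⟩).trans
    ?_
  · obtain rfl : a = b := hab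
    rfl
  · have := Nat.card_le_card_of_surjective (Quotient.mk (⊥ : Setoid (Fin n))) Quotient.mk_surjective
    rwa [Nat.card_fin] at this

end Count

end SimpleGraph

/-! ### Lengths of binary encodings, and the final bounds. -/

theorem Computability.encodePosNum_bounds (p : PosNum) :
    (p : ℕ) + 1 ≤ 2 ^ (encodePosNum p).length ∧ 2 ^ (encodePosNum p).length ≤ 2 * (p : ℕ) := by
  induction p with
  | one => simp [encodePosNum]
  | bit0 p ih =>
    rw [encodePosNum, List.length_cons, pow_succ, PosNum.cast_bit0]
    omega
  | bit1 p ih =>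
    rw [encodePosNum, List.length_cons, pow_succ, PosNum.cast_bit1]
    omega

theorem Computability.encodeNat_bounds (b : ℕ) :
    b + 1 ≤ 2 ^ (encodeNat b).length ∧ 2 ^ (encodeNat b).length ≤ 2 * (b + 1) := by
  have hb : ((b : Num) : ℕ) = b := Num.to_of_nat b
  unfold encodeNat
  cases h : (b : Num) with
  | zero =>
    rw [h] at hb
    simp [encodeNum, ← hb]
  | pos p =>
    rw [h, Num.cast_pos] at hb
    have := encodePosNum_bounds p
    rw [encodeNum]
    omega

namespace BRACInstance

open SimpleGraph

theorem get_injective (I : BRACInstance) : Function.Injective I.kept.get :=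
  List.nodup_iff_injective_get.1 (I.graph.nodup_keptList _)

theorem mem_image_get {I : BRACInstance} {i : Fin I.order} :
    i ∈ Finset.univ.image I.kept.get ↔
      I.graph.twinRank i < (I.graph.numTwinClasses + 1) * 2 ^ (I.bitLength + 9) := by
  rw [← Nat.div_lt_iff_lt_mul (by positivity), Nat.lt_succ_iff, ← I.graph.mem_keptList,
    Finset.mem_image]
  change _ ↔ i ∈ I.kept
  rw [List.mem_iff_get]
  simp

theorem two_pow_bitLength (I : BRACInstance) :
    I.budget + 1 ≤ 2 ^ I.bitLength ∧ 2 ^ I.bitLength ≤ 2 * (I.budget + 1) :=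
  Computability.encodeNat_bounds I.budget

theorem isYes_kernel (I : BRACInstance) : I.kernel.IsYes ↔ I.IsYes := by
  have hinj := I.get_injective
  refine ⟨fun h => ?_, fun h => AdmitsRACDrawing.comap hinj h⟩
  have hM : ∀ x ∉ Finset.univ.image I.kept.get, (I.graph.numTwinClasses + 1) *
      2 ^ (I.bitLength + 9) ≤ (I.graph.twinsIn (Finset.univ.image I.kept.get) x).card := by
    intro x hx
    rw [mem_image_get, not_lt] at hx
    exact le_card_twinsIn (fun i hi => mem_image_get.2 hi) hx
  have hX := I.graph.card_fewTwins_le (Finset.univ.image I.kept.get) I.budget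
  have hL := I.two_pow_bitLength.1
  -- With c the number of classes, the factor 512 leaves room for b + 57 and for 5b + 6c(b + 57),
  -- where the critical coefficient is 6 · 57 = 342.
  have hbound : (I.graph.numTwinClasses + 1) * (512 * (I.budget + 1)) ≤
      (I.graph.numTwinClasses + 1) * 2 ^ (I.bitLength + 9) := by
    rw [pow_add]
    exact Nat.mul_le_mul_left _ (by omega)
  refine AdmitsRACDrawing.of_comap hinj (fun x hx => ?_) (fun x hx => ?_) h
  · have := hM x hx
    nlinarith [Nat.zero_le (I.graph.numTwinClasses * I.budget)]
  · have := hM x hx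
    nlinarith [Nat.zero_le (I.graph.numTwinClasses * I.budget)]

/-- At most c classes with at most (c + 1) 2^(L+9) kept vertices each, where c + 1 ≤ 2 nd and 2^L ≤
2(b + 1); hence 2 · 1024 = 2048. -/
theorem order_kernel_le (I : BRACInstance) :
    I.kernel.order ≤ 2048 * (I.nd ^ 2 * (I.budget + 1)) := by
  have h₁ : (Finset.univ.image I.kept.get).card = I.kernel.order := by
    rw [Finset.card_image_of_injective _ I.get_injective, Finset.card_univ, Fintype.card_fin]
    rfl
  have h₂ := card_le_numTwinClasses_mul (S := Finset.univ.image I.kept.get)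
    (card_twinsIn_le_of_twinRank_lt fun i hi => mem_image_get.1 hi)
  rw [h₁] at h₂
  have h₃ : I.graph.numTwinClasses ≤ I.nd := I.graph.numTwinClasses_le
  have h₄ := I.graph.numTwinClasses_pos I.order_pos
  have h₅ := I.two_pow_bitLength.2
  calc I.kernel.order ≤ _ := h₂
    _ ≤ I.nd * ((2 * I.nd) * (1024 * (I.budget + 1))) := by
        refine Nat.mul_le_mul h₃ (Nat.mul_le_mul (by omega) ?_)
        rw [pow_add]
        omega
    _ = _ := by ring

theorem size_eq (I : BRACInstance) :
    I.size = I.bitLength + 1 + I.order * (I.order + 1) := by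
  rw [size, encode, List.length_append, List.length_map, List.length_cons, List.length_flatten,
    List.map_ofFn]
  have : (List.length ∘ fun i : Fin I.order =>
      (List.ofFn fun j : Fin I.order => Symbol.entry (I.matrixEntry i j)) ++ [Symbol.sep]) =
      fun _ => I.order + 1 := by
    ext i
    simp
  rw [this, List.sum_ofFn, Finset.sum_const, Finset.card_univ, Fintype.card_fin, smul_eq_mul,
    bitLength]
  omega

/-- This trades the nd⁴ of the matrix size for the stated nd · 2^nd. -/
theorem pow_three_le (k : ℕ) : k ^ 3 ≤ 8 * 2 ^ k := by
  by_cases hk : k < 4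
  · interval_cases k <;> norm_num
  · obtain ⟨m, rfl⟩ := Nat.exists_eq_add_of_le (not_lt.1 hk)
    clear hk
    induction m with
    | zero => norm_num
    | succ m ih =>
      rw [← add_assoc, pow_succ 2]
      nlinarith [Nat.zero_le (m ^ 3), Nat.zero_le (m ^ 2)]

theorem kernel_bounds (I : BRACInstance) :
    I.kernel.size ≤ 10 ^ 8 * ((I.budget + 1) ^ 2 * I.nd * 2 ^ I.nd) ∧
    I.kernel.parameter ≤ 10 ^ 8 * ((I.budget + 1) ^ 2 * I.nd * 2 ^ I.nd) := by
  set P := (I.budget + 1) ^ 2 * I.nd * 2 ^ I.nd with hP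
  have hnd : 0 < I.nd := (I.graph.numTwinClasses_pos I.order_pos).trans_le I.graph.numTwinClasses_le
  have h₁ : I.nd ^ 4 * (I.budget + 1) ^ 2 ≤ 8 * P := by
    have := Nat.mul_le_mul_left ((I.budget + 1) ^ 2 * I.nd) (pow_three_le I.nd)
    rw [hP]
    nlinarith
  have h₂ : I.nd ^ 2 * (I.budget + 1) ≤ I.nd ^ 4 * (I.budget + 1) ^ 2 := by
    have := Nat.le_self_pow (two_ne_zero) (I.nd ^ 2 * (I.budget + 1))
    calc _ ≤ _ := this
      _ = _ := by ring
  have hb : I.budget + 1 ≤ I.nd ^ 4 * (I.budget + 1) ^ 2 := by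
    refine le_trans ?_ h₂
    exact Nat.le_mul_of_pos_left _ (by positivity)
  have ho := I.order_kernel_le
  have hpos := I.kernel.order_pos
  have hL : I.kernel.bitLength < 2 * (I.budget + 1) :=
    (Nat.lt_two_pow_self).trans_le I.two_pow_bitLength.2
  -- The constant is 16 · 2048², about 6.7 · 10⁷. The value 10⁸ leaves room for the bits of the bend
  -- bound and the separator.
  have hsq : I.kernel.order * (I.kernel.order + 1) ≤ 2 * (2048 ^ 2 * (8 * P)) := by
    calc I.kernel.order * (I.kernel.order + 1) ≤ 2 * I.kernel.order ^ 2 := by nlinarith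
      _ ≤ 2 * (2048 * (I.nd ^ 2 * (I.budget + 1))) ^ 2 :=
          Nat.mul_le_mul_left _ (Nat.pow_le_pow_left ho 2)
      _ = 2 * (2048 ^ 2 * (I.nd ^ 4 * (I.budget + 1) ^ 2)) := by ring
      _ ≤ _ := by gcongr
  constructor
  · rw [size_eq]
    omega
  · have h₃ : I.kernel.nd ≤ I.kernel.order := neighborhoodDiversity_le _
    change I.budget + I.kernel.nd ≤ _
    omega

end BRACInstance

theorem theorem17 :
    ∃ (K : BRACInstance → BRACInstance) (C : ℕ),
      Nonempty (Turing.TM2ComputableInPolyTime BRACInstance.encode BRACInstance.encode K) ∧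
      ∀ I : BRACInstance,
        (I.IsYes ↔ (K I).IsYes) ∧
        (K I).size ≤ C * ((I.budget + 1) ^ 2 * I.nd * 2 ^ I.nd) ∧
        (K I).parameter ≤ C * ((I.budget + 1) ^ 2 * I.nd * 2 ^ I.nd) :=
  ⟨BRACInstance.kernel, 10 ^ 8, StackProgram.kernel_polyTime,
    fun I => ⟨I.isYes_kernel.symm, I.kernel_bounds⟩⟩
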